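/- Let $\Sigma$ be a closed (compact, without boundary) smooth surface, let $(\tilde M,\tilde g)$ be a smooth Riemannian manifold without boundary, and let $f:(\Sigma,g)\to(\tilde M,\tilde g)$ be a smooth isometric embedding. For a smooth embedding $f$ of $\Sigma$ into a Riemannian manifold, let $\alpha$ be its second fundamental form, $H=\operatorname{trace}\alpha$ its mean curvature vector, $d\mu$ the area measure of the induced metric, $K$ the sectional curvature of the ambient metric and $\{e_1,e_2\}$ an orthonormal tangent frame of $f(\Sigma)$, and set $$\Theta_f(\Sigma)=\int_\Sigma\sum_{i\ne j}K(e_i,e_j)\,d\mu,\qquad \Psi_f(\Sigma)=\int_\Sigma\|H\|^2\,d\mu,\qquad \Pi_f(\Sigma)=\int_\Sigma\|\alpha\|^2\,d\mu,\qquad \mathcal W_f(\Sigma)=2\Theta_f(\Sigma)+\Psi_f(\Sigma).$$ Let $f_t$, $t\in[0,1]$, be a path of conformal diffeomorphism deformations of $f_0=f$, in either of the following senses: (a) $f_t=F_t\circ f:\Sigma\to(\tilde M,\tilde g)$, where $F_t:\tilde M\to\tilde M$ are diffeomorphisms with $F_0=\mathrm{id}$ and $F_t^*\tilde g=e^{2u(t)}\tilde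 g$ for smooth functions $u(t)$ on $\tilde M$; or (b) $f_t$ is the map $f$ regarded as an embedding $(\Sigma,e^{2u(t)\circ f}g)\to(\tilde M,e^{2u(t)}\tilde g)$, where $u(t)$ are smooth functions on $\tilde M$ with $u(0)=0$. Then, for every $t$, $\mathcal W_{f_t}(\Sigma)=\mathcal W_f(\Sigma)$, and the three equalities $\Theta_{f_t}(\Sigma)=\Theta_f(\Sigma)$, $\Psi_{f_t}(\Sigma)=\Psi_f(\Sigma)$, $\Pi_{f_t}(\Sigma)=\Pi_f(\Sigma)$ are equivalent; so if any one of $\Theta$, $\Psi$, $\Pi$ is preserved along the path, so are the other two. In particular, if $(\tilde M,\tilde g)=(\mathbb S^{\tilde n},\tilde g)$ is the round unit sphere and $F:\mathbb S^{\tilde n}\to\mathbb S^{\tilde n}$ is a conformal automorphism (a diffeomorphism with $F^*\tilde g=e^{2u}\tilde g$ for a smooth function $u$), then $\mathcal W_{F\circ f}(\Sigma)=\mathcal W_f(\Sigma)$. -/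

import Mathlib

open Set Metric Manifold
open scoped Manifold ContDiff Topology

noncomputable section

/-- The coordinate space `ℝⁿ`. -/
abbrev Coord (n : ℕ) : Type := EuclideanSpace ℝ (Fin n)

/-- The `i`-th coordinate vector of `ℝⁿ`. -/
def coordVec {n : ℕ} (i : Fin n) : Coord n := EuclideanSpace.single i (1 : ℝ)

/-- A field of bilinear forms on the tangent spaces of an `n`-manifold. Riemannian metrics
(`Bundle.ContMDiffRiemannianMetric`) are used through their field `inner`, of this type. -/
abbrev BilinField (n : ℕ) (M : Type*) [TopologicalSpace M] [ChartedSpace (Coord n) M] : Type _ :=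
  ∀ x : M, TangentSpace (𝓡 n) x →L[ℝ] TangentSpace (𝓡 n) x →L[ℝ] ℝ

/-- A smooth Riemannian metric on an `n`-manifold. -/
abbrev RiemMetric (n : ℕ) (M : Type*) [TopologicalSpace M] [ChartedSpace (Coord n) M]
    [IsManifold (𝓡 n) ∞ M] : Type _ :=
  Bundle.ContMDiffRiemannianMetric (𝓡 n) ∞ (Coord n) (fun x : M => TangentSpace (𝓡 n) x)

section Constructions

variable {m n : ℕ} {N : Type*} [TopologicalSpace N] [ChartedSpace (Coord m) N]
  {M : Type*} [TopologicalSpace M] [ChartedSpace (Coord n) M]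

/-- The pullback `f^* g`, given by `(v, w) ↦ g (df v, df w)`. -/
def pullbackMetric (g : BilinField n M) (f : N → M) : BilinField m N := fun x =>
  (ContinuousLinearMap.precomp ℝ (mfderiv (𝓡 m) (𝓡 n) f x)).comp
    ((g (f x)).comp (mfderiv (𝓡 m) (𝓡 n) f x))

theorem pullbackMetric_apply (g : BilinField n M) (f : N → M) (x : N)
    (v w : TangentSpace (𝓡 m) x) :
    pullbackMetric g f x v w
      = g (f x) (mfderiv (𝓡 m) (𝓡 n) f x v) (mfderiv (𝓡 m) (𝓡 n) f x w) := rfl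

/-- The conformally related metric `e^{2u} g`. -/
def conformalMetric (u : M → ℝ) (g : BilinField n M) : BilinField n M := fun x =>
  Real.exp (2 * u x) • g x

/-- `f : (N, h) → (M, g)` is a smooth isometric embedding. -/
structure IsIsometricEmbedding (h : BilinField m N) (g : BilinField n M) (f : N → M) : Prop where
  isSmoothEmbedding : IsSmoothEmbedding (𝓡 m) (𝓡 n) ∞ f
  pullback_eq : pullbackMetric g f = h

/-- `F` is a conformal diffeomorphism of `(M, g)`: `F^* g = e^{2u} g` for a smooth function `u`. -/
def IsConformalDiffeo (g : BilinField n M) (F : M ≃ₘ^∞⟮𝓡 n, 𝓡 n⟯ M) : Prop :=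
  ∃ u : M → ℝ, ContMDiff (𝓡 n) 𝓘(ℝ, ℝ) ∞ u ∧ pullbackMetric g F = conformalMetric u g

end Constructions

/-! ### Local formulas on an open set of `ℝⁿ`, in terms of the Gram matrix `G` of a metric -/

section Local

variable {n : ℕ}

/-- The partial derivative `∂ᵢ φ` at `y`. -/
def partialDeriv (i : Fin n) (φ : Coord n → ℝ) (y : Coord n) : ℝ := fderiv ℝ φ y (coordVec i)

/-- The Christoffel symbol `Γᵏᵢⱼ` at `y` of the metric with Gram matrix `G`. -/
def christoffel (G : Coord n → Matrix (Fin n) (Fin n) ℝ) (k i j : Fin n) (y : Coord n) : ℝ :=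
  (1 / 2) * ∑ l, (G y)⁻¹ k l *
    (partialDeriv i (fun z => G z j l) y + partialDeriv j (fun z => G z i l) y
      - partialDeriv l (fun z => G z i j) y)

/-- The component `Rˡₖᵢⱼ` of the curvature tensor, `R(∂ᵢ, ∂ⱼ)∂ₖ = ∑ₗ Rˡₖᵢⱼ ∂ₗ`, where
`R(X, Y)Z = ∇_X ∇_Y Z - ∇_Y ∇_X Z - ∇_[X,Y] Z`. -/
def riemannCoeff (G : Coord n → Matrix (Fin n) (Fin n) ℝ) (l k i j : Fin n) (y : Coord n) : ℝ :=
  partialDeriv i (christoffel G l j k) y - partialDeriv j (christoffel G l i k) y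
    + ∑ a, (christoffel G l i a y * christoffel G a j k y
      - christoffel G l j a y * christoffel G a i k y)

end Local

section Ambient

variable {n : ℕ} {M : Type*} [TopologicalSpace M] [ChartedSpace (Coord n) M]

/-- The Gram matrix of `g` in the preferred chart around `p`, at the point of coordinates `y`. -/
def gramInChart (g : BilinField n M) (p : M) (y : Coord n) : Matrix (Fin n) (Fin n) ℝ :=
  Matrix.of fun i j =>
    g ((extChartAt (𝓡 n) p).symm y)
      (mfderiv 𝓘(ℝ, Coord n) (𝓡 n) (extChartAt (𝓡 n) p).symm y (coordVec i))
      (mfderiv 𝓘(ℝ, Coord n) (𝓡 n) (extChartAt (𝓡 n) p).symm y (coordVec j))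

/-- The vector `R(v, w)z` at `p`. The tangent space at `p` is the coordinate space of the
preferred chart around `p`. -/
def curvatureTensor (g : BilinField n M) (p : M) (v w z : Coord n) : TangentSpace (𝓡 n) p :=
  (WithLp.toLp 2 fun l => ∑ i, ∑ j, ∑ k,
    v i * w j * z k * riemannCoeff (gramInChart g p) l k i j (extChartAt (𝓡 n) p p) : Coord n)

/-- The sectional curvature `K(v, w) = ⟨R(v, w)w, v⟩ / (|v|²|w|² - ⟨v, w⟩²)` of `g` at `p`
(equal to `0` when `v`, `w` are linearly dependent). -/
def sectionalCurvature (g : BilinField n M) (p : M) (v w : TangentSpace (𝓡 n) p) : ℝ :=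
  g p (curvatureTensor g p v w w) v / (g p v v * g p w w - g p v w ^ 2)

end Ambient

/-! ### Extrinsic geometry of a surface `f : S → (M, g)` -/

section Surface

variable {S : Type*} [TopologicalSpace S] [ChartedSpace (Coord 2) S]
  {n : ℕ} {M : Type*} [TopologicalSpace M] [ChartedSpace (Coord n) M]

/-- The orthonormal basis for the bilinear form `b`, obtained from the coordinate basis by the
Gram-Schmidt process. Used for `b` an inner product on `T_x S`, which is the coordinate space of
the preferred chart around `x`. -/
def orthoFrame (b : Coord 2 →L[ℝ] Coord 2 →L[ℝ] ℝ) : Fin 2 → Coord 2 :=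
  let e₁ := (Real.sqrt (b (coordVec 0) (coordVec 0)))⁻¹ • coordVec 0
  let c := coordVec 1 - b (coordVec 1) e₁ • e₁
  ![e₁, (Real.sqrt (b c c))⁻¹ • c]

/-- The orthonormal frame `e₁, e₂` of `f(S)` at `f x`, as vectors tangent to `M`. -/
def tangentFrame (g : BilinField n M) (f : S → M) (x : S) (i : Fin 2) :
    TangentSpace (𝓡 n) (f x) :=
  mfderiv (𝓡 2) (𝓡 n) f x (orthoFrame (pullbackMetric g f x) i)

/-- The expression of `f` in the preferred charts around `x` and `f x`. -/
def localRep (f : S → M) (x : S) (y : Coord 2) : Coord n :=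
  extChartAt (𝓡 n) (f x) (f ((extChartAt (𝓡 2) x).symm y))

/-- The covariant Hessian `D²f(v, w) + Γ(df v, df w)` of `f` at `x`, that is, the ambient
covariant derivative `∇_{df v} (df W)` for the extension `W` of `w` by constant coefficients. -/
def covHessian (g : BilinField n M) (f : S → M) (x : S) (v w : Coord 2) :
    TangentSpace (𝓡 n) (f x) :=
  let φ := localRep f x
  let y := extChartAt (𝓡 2) x x
  (fderiv ℝ (fderiv ℝ φ) y v w + WithLp.toLp 2 fun k => ∑ i, ∑ j,
    christoffel (gramInChart g (f x)) k i j (φ y) * fderiv ℝ φ y v i * fderiv ℝ φ y w j : Coord n)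

/-- The second fundamental form `α(v, w)` of `f` at `x`: the normal component of the covariant
Hessian. -/
def secondFundamentalForm (g : BilinField n M) (f : S → M) (x : S)
    (v w : TangentSpace (𝓡 2) x) : TangentSpace (𝓡 n) (f x) :=
  covHessian g f x v w
    - ∑ i, g (f x) (covHessian g f x v w) (tangentFrame g f x i) • tangentFrame g f x i

/-- The mean curvature vector `H = ∑ᵢ α(eᵢ, eᵢ)` at `x`. -/
def meanCurvature (g : BilinField n M) (f : S → M) (x : S) : TangentSpace (𝓡 n) (f x) :=
  ∑ i, secondFundamentalForm g f x
    (orthoFrame (pullbackMetric g f x) i) (orthoFrame (pullbackMetric g f x) i)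

/-- The squared norm `‖H‖²`. -/
def meanCurvatureSq (g : BilinField n M) (f : S → M) (x : S) : ℝ :=
  g (f x) (meanCurvature g f x) (meanCurvature g f x)

/-- The squared norm `‖α‖² = ∑ᵢⱼ ‖α(eᵢ, eⱼ)‖²`. -/
def secondFundamentalFormSq (g : BilinField n M) (f : S → M) (x : S) : ℝ :=
  let e := orthoFrame (pullbackMetric g f x)
  ∑ i, ∑ j, g (f x) (secondFundamentalForm g f x (e i) (e j))
    (secondFundamentalForm g f x (e i) (e j))

/-- The exterior scalar curvature `∑ᵢⱼ K(eᵢ, eⱼ)`, whose diagonal terms vanish. -/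
def exteriorScalarCurvature (g : BilinField n M) (f : S → M) (x : S) : ℝ :=
  ∑ i, ∑ j, sectionalCurvature g (f x) (tangentFrame g f x i) (tangentFrame g f x j)

end Surface

/-! ### Integration on a compact surface, and the functionals -/

section Functionals

variable {S : Type*} [TopologicalSpace S] [ChartedSpace (Coord 2) S]
  [IsManifold (𝓡 2) ∞ S] [CompactSpace S] [T2Space S]

variable (S) in
/-- A smooth partition of unity on `S` subordinate to the charts. -/
def chartPartition : SmoothPartitionOfUnity S (𝓡 2) S univ :=
  (SmoothPartitionOfUnity.exists_isSubordinate_chartAt_source (𝓡 2) S).choose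

/-- The integral `∫_S φ dμ_h` of `φ` against the area measure of the metric `h`: the sum, over the
partition of unity, of the integrals in the charts with respect to `√(det h) dy`. -/
def areaIntegral (h : BilinField 2 S) (φ : S → ℝ) : ℝ :=
  ∑ᶠ p : S, ∫ y in (extChartAt (𝓡 2) p).target,
    chartPartition S p ((extChartAt (𝓡 2) p).symm y) * φ ((extChartAt (𝓡 2) p).symm y)
      * Real.sqrt (gramInChart h p y).det

variable {n : ℕ} {M : Type*} [TopologicalSpace M] [ChartedSpace (Coord n) M]

/-- `Θ_f(S) = ∫ ∑ᵢⱼ K(eᵢ, eⱼ) dμ`, the integral for the induced metric. -/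
def Theta (g : BilinField n M) (f : S → M) : ℝ :=
  areaIntegral (pullbackMetric g f) (exteriorScalarCurvature g f)

/-- `Ψ_f(S) = ∫ ‖H‖² dμ`. -/
def Psi (g : BilinField n M) (f : S → M) : ℝ :=
  areaIntegral (pullbackMetric g f) (meanCurvatureSq g f)

/-- `Π_f(S) = ∫ ‖α‖² dμ`. -/
def Pii (g : BilinField n M) (f : S → M) : ℝ :=
  areaIntegral (pullbackMetric g f) (secondFundamentalFormSq g f)

/-- The Willmore energy `2 Θ + Ψ`. -/
def willmore (g : BilinField n M) (f : S → M) : ℝ := 2 * Theta g f + Psi g f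

end Functionals

/-! ### The round sphere -/

/-- The unit sphere `S^m` of `ℝ^{m+1}`. -/
abbrev UnitSphere (m : ℕ) : Type := sphere (0 : Coord (m + 1)) 1

/-- The round metric on the unit sphere, induced by the Euclidean metric. -/
def roundMetric (m : ℕ) : BilinField m (UnitSphere m) :=
  pullbackMetric (n := m + 1) (M := Coord (m + 1))
    (fun _ => (innerSL ℝ : Coord (m + 1) →L[ℝ] Coord (m + 1) →L[ℝ] ℝ))
    ((↑) : UnitSphere m → Coord (m + 1))

end

/-!
The whole argument is pointwise, except for one integration. Let `g' = e^{2u} g`, and let `Δ` be the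
Laplacian of the metric induced by `g` on the surface. The Levi-Civita connection changes by
`∇'_v w = ∇_v w + du(v) w + du(w) v - g(v, w) grad u` (`levi_conformalForm`), so that the second
fundamental form becomes `α' = α - h ⊗ ν`, where `h` is the induced metric and `ν` is the normal
part of `grad u` (`sffForm_conformal`). With the corresponding formula for the curvature
(`apply_curv_conformalForm`) this gives

* `e^{2u} (2 ∑ K'(e'ᵢ, e'ⱼ) + ‖H'‖²) = 2 ∑ K(eᵢ, eⱼ) + ‖H‖² - 4 Δ(u ∘ f)`
  (`IsSurface.willmore_integrand_conformal`): the terms in `|ν|²` cancel, and what remains of the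
  Hessian of `u` and of `du(H)` is the Laplacian of the restriction of `u` to the surface;
* `e^{2u} (2 ‖α'‖² - ‖H'‖²) = 2 ‖α‖² - ‖H‖²` (`IsSurface.traceFree_integrand_conformal`).

The area measure is multiplied by `e^{2u}`, and `∫ Δ(u ∘ f) dμ = 0` on a closed surface
(`areaIntegral_laplacian`). Hence `2Θ + Ψ` and `2Π - Ψ` are invariant, and each of the three
equalities of `Θ`, `Ψ`, `Π` implies the two others.

A conformal diffeomorphism `F`, with `F^* g = e^{2u} g`, is an isometry from `e^{2u} g` to `g`, and
all the quantities are natural under isometries (`IsSurface.exteriorScalarCurvature_comp`,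
`IsSurface.meanCurvatureSq_comp`, `IsSurface.secondFundamentalFormSq_comp`). So the functionals of
`F ∘ f` for `g` are those of `f` for `e^{2u} g` (`IsSurface.theta_comp`, `IsSurface.psi_comp`,
`IsSurface.pii_comp`), which is the case already treated.

The local computations are made without coordinates, for a field `B` of inner products on a
finite-dimensional vector space `E`. The connection is a field `levi B` of bilinear maps, which is
characterized by its symmetry and compatibility with `B` (`IsChristoffel.unique`); this determines
its transformation laws. The classical formulas with Christoffel symbols are compared with it once
(`MetricNear.christoffel_eq`, `MetricNear.curv_eq_sum`).
-/

noncomputable section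

set_option maxSynthPendingDepth 3

/-! ### Riemannian metrics near a point of a vector space, and their Levi-Civita connection -/

section LocalMetric

variable {E E' : Type*} [NormedAddCommGroup E] [NormedSpace ℝ E]
  [NormedAddCommGroup E'] [NormedSpace ℝ E']

/-- `φ` is `C^∞` in a neighbourhood of `y`. For `ContDiffAt ℝ ∞ φ y` the neighbourhood may
depend on the order of differentiability, so that it does not persist at nearby points. -/
def SmoothNear (φ : E → E') (y : E) : Prop := ∀ᶠ z in 𝓝 y, ContDiffAt ℝ ∞ φ z

theorem SmoothNear.contDiffAt {φ : E → E'} {y : E} (h : SmoothNear φ y) : ContDiffAt ℝ ∞ φ y :=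
  h.self_of_nhds

theorem SmoothNear.differentiableAt {φ : E → E'} {y : E} (h : SmoothNear φ y) :
    DifferentiableAt ℝ φ y := h.contDiffAt.differentiableAt (by simp)

theorem SmoothNear.continuousAt {φ : E → E'} {y : E} (h : SmoothNear φ y) :
    ContinuousAt φ y := h.contDiffAt.continuousAt

theorem SmoothNear.eventually {φ : E → E'} {y : E} (h : SmoothNear φ y) :
    ∀ᶠ z in 𝓝 y, SmoothNear φ z := h.eventually_nhds

theorem SmoothNear.fderiv {φ : E → E'} {y : E} (h : SmoothNear φ y) :
    SmoothNear (fderiv ℝ φ) y := by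
  filter_upwards [h] with z hz
  exact hz.fderiv_right (m := ∞) (by simp)

theorem SmoothNear.comp {F : Type*} [NormedAddCommGroup F] [NormedSpace ℝ F]
    {ψ : E' → F} {φ : E → E'} {y : E} (hψ : SmoothNear ψ (φ y)) (hφ : SmoothNear φ y) :
    SmoothNear (ψ ∘ φ) y := by
  filter_upwards [hφ, hφ.continuousAt.eventually hψ] with z h1 h2
  exact h2.comp z h1

theorem SmoothNear.congr {φ φ' : E → E'} {y : E} (h : SmoothNear φ y) (h' : φ' =ᶠ[𝓝 y] φ) :
    SmoothNear φ' y := by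
  filter_upwards [h, h'.eventually_nhds] with z h1 h2
  exact h1.congr_of_eventuallyEq h2

/-- The second derivative of a function smooth near `y` is symmetric. -/
theorem SmoothNear.fderiv_fderiv_comm {φ : E → E'} {y : E} (h : SmoothNear φ y) (v w : E) :
    _root_.fderiv ℝ (_root_.fderiv ℝ φ) y v w = _root_.fderiv ℝ (_root_.fderiv ℝ φ) y w v :=
  (h.contDiffAt.isSymmSndFDerivAt (by
    rw [minSmoothness_of_isRCLikeNormedField]; exact WithTop.coe_le_coe.2 le_top)).eq v w

/-- `B` is a smooth Riemannian metric in a neighbourhood of `z`, given as a field of bilinear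
forms on the vector space `E`. -/
def MetricNear (B : E → E →L[ℝ] E →L[ℝ] ℝ) (z : E) : Prop :=
  SmoothNear B z ∧ ∀ᶠ z' in 𝓝 z, (∀ v w, B z' v w = B z' w v) ∧ ∀ v, v ≠ 0 → 0 < B z' v v

theorem MetricNear.symm {B : E → E →L[ℝ] E →L[ℝ] ℝ} {z : E} (h : MetricNear B z) (v w : E) :
    B z v w = B z w v := h.2.self_of_nhds.1 v w

theorem MetricNear.pos {B : E → E →L[ℝ] E →L[ℝ] ℝ} {z : E} (h : MetricNear B z) {v : E}
    (hv : v ≠ 0) : 0 < B z v v := h.2.self_of_nhds.2 v hv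

theorem MetricNear.eventually {B : E → E →L[ℝ] E →L[ℝ] ℝ} {z : E} (h : MetricNear B z) :
    ∀ᶠ z' in 𝓝 z, MetricNear B z' := by
  filter_upwards [h.1.eventually, h.2.eventually_nhds] with z' h1 h2
  exact ⟨h1, h2⟩

theorem MetricNear.congr {B B' : E → E →L[ℝ] E →L[ℝ] ℝ} {z : E} (h : MetricNear B z)
    (h' : B' =ᶠ[𝓝 z] B) : MetricNear B' z := by
  refine ⟨h.1.congr h', ?_⟩
  filter_upwards [h.2, h'] with z' h1 h2
  rw [h2]; exact h1

theorem MetricNear.ext {B : E → E →L[ℝ] E →L[ℝ] ℝ} {z : E} (h : MetricNear B z) {v w : E}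
    (hvw : ∀ x, B z v x = B z w x) : v = w := by
  by_contra hne
  have := h.pos (sub_ne_zero.2 hne)
  simp [hvw] at this

/-- `Γ` is the Christoffel tensor at `z` of the metric `B`: symmetric and compatible with `B`. -/
structure IsChristoffel (B : E → E →L[ℝ] E →L[ℝ] ℝ) (z : E) (Γ : E → E → E) : Prop where
  symm : ∀ v w, Γ v w = Γ w v
  compat : ∀ u v w, fderiv ℝ B z u v w = B z (Γ u v) w + B z v (Γ u w)

/-- The algebraic core of the uniqueness of the Levi-Civita connection: a trilinear form symmetric
in its first two arguments is determined by its symmetrization in the last two. -/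
theorem trilinear_unique {X : Type*} {T T' : X → X → X → ℝ} (hT : ∀ u v w, T u v w = T v u w)
    (hT' : ∀ u v w, T' u v w = T' v u w)
    (h : ∀ u v w, T u v w + T u w v = T' u v w + T' u w v) (u v w : X) : T u v w = T' u v w := by
  linarith [h u v w, h v w u, h w u v, hT u v w, hT v w u, hT w u v, hT' u v w, hT' v w u,
    hT' w u v]

theorem IsChristoffel.unique {B : E → E →L[ℝ] E →L[ℝ] ℝ} {z : E} (hB : MetricNear B z)
    {Γ Γ' : E → E → E} (h : IsChristoffel B z Γ) (h' : IsChristoffel B z Γ') (v w : E) :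
    Γ v w = Γ' v w := by
  refine hB.ext fun x => ?_
  refine trilinear_unique (T := fun v w x => B z (Γ v w) x) (T' := fun v w x => B z (Γ' v w) x)
    (fun u v w => by simp only [h.symm u v]) (fun u v w => by simp only [h'.symm u v])
    (fun u v w => ?_) v w x
  have h1 := h.compat u v w
  have h2 := h'.compat u v w
  rw [hB.symm v] at h1 h2
  linarith

/-- The vector representing a linear form with respect to the metric `B` at `z` (by convention zero
if `B z` is not invertible). -/
def sharp (B : E → E →L[ℝ] E →L[ℝ] ℝ) (z : E) : (E →L[ℝ] ℝ) →L[ℝ] E :=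
  ContinuousLinearMap.inverse (B z)

/-- Half of the Koszul formula: the Christoffel symbols of the first kind of `B` at `z`. -/
def koszul (B : E → E →L[ℝ] E →L[ℝ] ℝ) (z : E) : E →L[ℝ] E →L[ℝ] E →L[ℝ] ℝ :=
  (1 / 2 : ℝ) • (fderiv ℝ B z + (fderiv ℝ B z).flip
    - (ContinuousLinearMap.flipₗᵢ ℝ E E ℝ).toLinearIsometry.toContinuousLinearMap.comp
      (fderiv ℝ B z).flip)

theorem koszul_apply (B : E → E →L[ℝ] E →L[ℝ] ℝ) (z v w x : E) :
    koszul B z v w x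
      = (1 / 2) * (fderiv ℝ B z v w x + fderiv ℝ B z w v x - fderiv ℝ B z x v w) := by
  simp [koszul]

/-- The Christoffel tensor of the metric `B` at `z`: for constant vector fields,
`∇_v w = levi B z v w`. -/
def levi (B : E → E →L[ℝ] E →L[ℝ] ℝ) (z : E) : E →L[ℝ] E →L[ℝ] E :=
  (ContinuousLinearMap.compL ℝ E (E →L[ℝ] ℝ) E (sharp B z)).comp (koszul B z)

theorem levi_apply (B : E → E →L[ℝ] E →L[ℝ] ℝ) (z v w : E) :
    levi B z v w = sharp B z (koszul B z v w) := rfl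

theorem levi_congr {B B' : E → E →L[ℝ] E →L[ℝ] ℝ} {z : E} (h : B =ᶠ[𝓝 z] B') :
    levi B z = levi B' z := by
  simp only [levi, koszul, sharp, h.fderiv_eq, h.eq_of_nhds]

theorem MetricNear.fderiv_symm {B : E → E →L[ℝ] E →L[ℝ] ℝ} {z : E} (hB : MetricNear B z)
    (u v w : E) : fderiv ℝ B z u v w = fderiv ℝ B z u w v := by
  have hd := hB.1.differentiableAt
  have e1 : fderiv ℝ (fun z' => B z' v w) z u = fderiv ℝ B z u v w := by
    rw [fderiv_clm_apply (by fun_prop) (by fun_prop), fderiv_clm_apply hd (by fun_prop)]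
    simp
  have e2 : fderiv ℝ (fun z' => B z' w v) z u = fderiv ℝ B z u w v := by
    rw [fderiv_clm_apply (by fun_prop) (by fun_prop), fderiv_clm_apply hd (by fun_prop)]
    simp
  rw [← e1, ← e2]
  have : (fun z' => B z' v w) =ᶠ[𝓝 z] fun z' => B z' w v := by
    filter_upwards [hB.2] with z' h using h.1 v w
  rw [this.fderiv_eq]

variable [FiniteDimensional ℝ E]

theorem MetricNear.exists_equiv {B : E → E →L[ℝ] E →L[ℝ] ℝ} {z : E} (hB : MetricNear B z) :
    ∃ e : E ≃L[ℝ] (E →L[ℝ] ℝ), (e : E →L[ℝ] (E →L[ℝ] ℝ)) = B z := by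
  have hinj : Function.Injective (B z).toLinearMap := fun v w hvw =>
    hB.ext fun x => by
      have : B z v = B z w := hvw
      rw [this]
  have hdim : Module.finrank ℝ E = Module.finrank ℝ (E →L[ℝ] ℝ) := by
    rw [← (LinearMap.toContinuousLinearMap (𝕜 := ℝ) (E := E) (F' := ℝ)).finrank_eq]
    exact (Subspace.dual_finrank_eq (K := ℝ) (V := E)).symm
  exact ⟨(LinearEquiv.ofInjectiveOfFinrankEq (B z).toLinearMap hinj
    hdim).toContinuousLinearEquiv, rfl⟩

theorem MetricNear.apply_sharp {B : E → E →L[ℝ] E →L[ℝ] ℝ} {z : E} (hB : MetricNear B z)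
    (ξ : E →L[ℝ] ℝ) (w : E) : B z (sharp B z ξ) w = ξ w := by
  obtain ⟨e, he⟩ := hB.exists_equiv
  rw [sharp, ← he, ContinuousLinearMap.inverse_equiv]
  simp

theorem MetricNear.sharp_smoothNear {B : E → E →L[ℝ] E →L[ℝ] ℝ} {z : E} (hB : MetricNear B z) :
    SmoothNear (sharp B) z := by
  have : CompleteSpace E := FiniteDimensional.complete ℝ E
  filter_upwards [hB.1, hB.eventually] with z' h1 h2
  obtain ⟨e, he⟩ := h2.exists_equiv
  refine ContDiffAt.comp z' (g := ContinuousLinearMap.inverse) ?_ h1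
  rw [← he]
  exact contDiffAt_map_inverse e

theorem MetricNear.levi_smoothNear {B : E → E →L[ℝ] E →L[ℝ] ℝ} {z : E} (hB : MetricNear B z) :
    SmoothNear (levi B) z := by
  filter_upwards [hB.sharp_smoothNear, hB.1.fderiv] with z' h1 h2
  unfold levi koszul
  have h3 : ContDiffAt ℝ ∞ (fun z => (fderiv ℝ B z).flip) z' :=
    (ContinuousLinearMap.flipₗᵢ ℝ E E (E →L[ℝ] ℝ)).toLinearIsometry.contDiff.contDiffAt.comp z' h2
  have h4 : ContDiffAt ℝ ∞ (fun z => ContinuousLinearMap.compL ℝ E (E →L[ℝ] ℝ) E (sharp B z)) z' :=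
    (ContinuousLinearMap.compL ℝ E (E →L[ℝ] ℝ) E).contDiff.contDiffAt.comp z' h1
  exact h4.clm_comp (((h2.add h3).sub (contDiffAt_const.clm_comp h3)).const_smul _)

theorem MetricNear.isChristoffel_levi {B : E → E →L[ℝ] E →L[ℝ] ℝ} {z : E} (hB : MetricNear B z) :
    IsChristoffel B z fun v w => levi B z v w where
  symm v w := by
    refine hB.ext fun x => ?_
    rw [levi_apply, levi_apply, hB.apply_sharp, hB.apply_sharp, koszul_apply, koszul_apply,
      hB.fderiv_symm x v w]
    ring
  compat u v w := by
    rw [hB.symm v, levi_apply, levi_apply, hB.apply_sharp, hB.apply_sharp, koszul_apply,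
      koszul_apply, hB.fderiv_symm w u v, hB.fderiv_symm v u w, hB.fderiv_symm u w v]
    ring

theorem MetricNear.levi_symm {B : E → E →L[ℝ] E →L[ℝ] ℝ} {z : E} (hB : MetricNear B z) (v w : E) :
    levi B z v w = levi B z w v := hB.isChristoffel_levi.symm v w

theorem MetricNear.fderiv_eq {B : E → E →L[ℝ] E →L[ℝ] ℝ} {z : E} (hB : MetricNear B z)
    (u v w : E) : fderiv ℝ B z u v w = B z (levi B z u v) w + B z v (levi B z u w) :=
  hB.isChristoffel_levi.compat u v w

theorem MetricNear.levi_unique {B : E → E →L[ℝ] E →L[ℝ] ℝ} {z : E} (hB : MetricNear B z)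
    {Γ : E → E → E} (h : IsChristoffel B z Γ) (v w : E) : levi B z v w = Γ v w :=
  hB.isChristoffel_levi.unique hB h v w

end LocalMetric

section Curvature

variable {E : Type*} [NormedAddCommGroup E] [NormedSpace ℝ E]

/-- The curvature `R(v, w)x = ∇_v ∇_w x - ∇_w ∇_v x` at `z` of the connection with Christoffel
tensor `Γ`; the vectors are extended to constant fields, which commute. -/
def curv (Γ : E → E →L[ℝ] E →L[ℝ] E) (z v w x : E) : E :=
  fderiv ℝ Γ z v w x - fderiv ℝ Γ z w v x + (Γ z v (Γ z w x) - Γ z w (Γ z v x))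

end Curvature

/-! ### Naturality and conformal change of the connection and of the curvature -/

section Naturality

variable {E E' : Type*} [NormedAddCommGroup E] [NormedSpace ℝ E]
  [NormedAddCommGroup E'] [NormedSpace ℝ E']

/-- The pullback under `φ` of a field `B` of bilinear forms on a vector space. -/
def pullbackForm (B : E' → E' →L[ℝ] E' →L[ℝ] ℝ) (φ : E → E') (y : E) : E →L[ℝ] E →L[ℝ] ℝ :=
  (B (φ y)).bilinearComp (fderiv ℝ φ y) (fderiv ℝ φ y)

@[simp] theorem pullbackForm_apply (B : E' → E' →L[ℝ] E' →L[ℝ] ℝ) (φ : E → E') (y v w : E) :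
    pullbackForm B φ y v w = B (φ y) (fderiv ℝ φ y v) (fderiv ℝ φ y w) := rfl

/-- The covariant Hessian of a map `φ` into a vector space with metric `B`: the ambient covariant
derivative of `dφ(w)` in the direction `dφ(v)`, for a constant field `w`. -/
def hessMap (B : E' → E' →L[ℝ] E' →L[ℝ] ℝ) (φ : E → E') (y : E) : E →L[ℝ] E →L[ℝ] E' :=
  fderiv ℝ (fderiv ℝ φ) y + (levi B (φ y)).bilinearComp (fderiv ℝ φ y) (fderiv ℝ φ y)

theorem hessMap_apply (B : E' → E' →L[ℝ] E' →L[ℝ] ℝ) (φ : E → E') (y v w : E) :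
    hessMap B φ y v w = fderiv ℝ (fderiv ℝ φ) y v w
      + levi B (φ y) (fderiv ℝ φ y v) (fderiv ℝ φ y w) := rfl

theorem fderiv_apply_two {F : Type*} [NormedAddCommGroup F] [NormedSpace ℝ F]
    {T : E → E' →L[ℝ] E' →L[ℝ] F} {y : E} {f g : E → E'}
    (hT : DifferentiableAt ℝ T y) (hf : DifferentiableAt ℝ f y) (hg : DifferentiableAt ℝ g y)
    (u : E) : fderiv ℝ (fun z => T z (f z) (g z)) y u
      = fderiv ℝ T y u (f y) (g y) + T y (fderiv ℝ f y u) (g y) + T y (f y) (fderiv ℝ g y u) := by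
  rw [fderiv_clm_apply (hT.clm_apply hf) hg, fderiv_clm_apply hT hf]
  simp
  abel

theorem fderiv_apply_one {F : Type*} [NormedAddCommGroup F] [NormedSpace ℝ F]
    {T : E → E' →L[ℝ] F} {y : E} {f : E → E'}
    (hT : DifferentiableAt ℝ T y) (hf : DifferentiableAt ℝ f y)
    (u : E) : fderiv ℝ (fun z => T z (f z)) y u
      = fderiv ℝ T y u (f y) + T y (fderiv ℝ f y u) := by
  rw [fderiv_clm_apply hT hf]
  simp
  abel

theorem fderiv_const_apply_two {F : Type*} [NormedAddCommGroup F] [NormedSpace ℝ F]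
    {T : E → E' →L[ℝ] E' →L[ℝ] F} {y : E} (hT : DifferentiableAt ℝ T y) (u : E) (v w : E') :
    fderiv ℝ (fun z => T z v w) y u = fderiv ℝ T y u v w := by
  rw [fderiv_apply_two hT (by fun_prop) (by fun_prop)]; simp

theorem SmoothNear.pullbackForm {B : E' → E' →L[ℝ] E' →L[ℝ] ℝ} {φ : E → E'} {y : E}
    (hB : SmoothNear B (φ y)) (hφ : SmoothNear φ y) : SmoothNear (pullbackForm B φ) y := by
  filter_upwards [hB.comp hφ, hφ.fderiv] with z h1 h2
  have h3 : ContDiffAt ℝ ∞ (fun z => (B (φ z)).comp (_root_.fderiv ℝ φ z)) z := h1.clm_comp h2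
  have h4 : ContDiffAt ℝ ∞ (fun z => ((B (φ z)).comp (_root_.fderiv ℝ φ z)).flip) z :=
    (ContinuousLinearMap.flipₗᵢ ℝ E E' ℝ).toLinearIsometry.contDiff.contDiffAt.comp z h3
  exact (ContinuousLinearMap.flipₗᵢ ℝ E E ℝ).toLinearIsometry.contDiff.contDiffAt.comp z
    (h4.clm_comp h2)

variable [FiniteDimensional ℝ E']

/-- Compatibility of the ambient connection with the metric, along `φ`. -/
theorem fderiv_pullbackForm {B : E' → E' →L[ℝ] E' →L[ℝ] ℝ} {φ : E → E'} {y : E}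
    (hB : MetricNear B (φ y)) (hφ : SmoothNear φ y) (u v w : E) :
    fderiv ℝ (pullbackForm B φ) y u v w
      = B (φ y) (hessMap B φ y u v) (fderiv ℝ φ y w)
        + B (φ y) (fderiv ℝ φ y v) (hessMap B φ y u w) := by
  have hA := hφ.fderiv.differentiableAt
  have hBd : DifferentiableAt ℝ (fun z => B (φ z)) y := (hB.1.comp hφ).differentiableAt
  rw [← fderiv_const_apply_two (hB.1.pullbackForm hφ).differentiableAt]
  simp only [pullbackForm_apply]
  rw [fderiv_apply_two hBd (by fun_prop) (by fun_prop)]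
  have e1 : fderiv ℝ (fun z => B (φ z)) y u = fderiv ℝ B (φ y) (fderiv ℝ φ y u) := by
    change fderiv ℝ (B ∘ φ) y u = _
    rw [fderiv_comp y hB.1.differentiableAt hφ.differentiableAt]
    rfl
  have e2 (x : E) : fderiv ℝ (fun z => fderiv ℝ φ z x) y u = fderiv ℝ (fderiv ℝ φ) y u x := by
    rw [fderiv_apply_one hA (by fun_prop)]; simp
  rw [e1, e2, e2, hB.fderiv_eq, hessMap_apply, hessMap_apply]
  simp only [map_add, add_apply]
  ring

theorem hessMap_symm {B : E' → E' →L[ℝ] E' →L[ℝ] ℝ} {φ : E → E'} {y : E}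
    (hB : MetricNear B (φ y)) (hφ : SmoothNear φ y) (v w : E) :
    hessMap B φ y v w = hessMap B φ y w v := by
  rw [hessMap_apply, hessMap_apply, hφ.fderiv_fderiv_comm, hB.levi_symm]

variable [FiniteDimensional ℝ E]

/-- The tangential part of the covariant Hessian is given by the Christoffel tensor of the induced
metric. -/
theorem apply_hessMap_tangent {B : E' → E' →L[ℝ] E' →L[ℝ] ℝ} {φ : E → E'} {y : E}
    (hB : MetricNear B (φ y)) (hφ : SmoothNear φ y) (hh : MetricNear (pullbackForm B φ) y)
    (v w x : E) :
    B (φ y) (hessMap B φ y v w) (fderiv ℝ φ y x)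
      = pullbackForm B φ y (levi (pullbackForm B φ) y v w) x := by
  refine trilinear_unique
    (T := fun v w x => B (φ y) (hessMap B φ y v w) (fderiv ℝ φ y x))
    (T' := fun v w x => pullbackForm B φ y (levi (pullbackForm B φ) y v w) x)
    (fun u v w => by simp only [hessMap_symm hB hφ u v]) (fun u v w => by
      simp only [hh.levi_symm u v]) (fun u v w => ?_) v w x
  have h1 := fderiv_pullbackForm hB hφ u v w
  have h2 := hh.fderiv_eq u v w
  rw [hB.symm (fderiv ℝ φ y v)] at h1
  rw [hh.symm v] at h2
  rw [← h1, ← h2]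

/-- The transformation law of the Christoffel tensor under a change of coordinates. -/
theorem fderiv_levi_pullbackForm {B : E' → E' →L[ℝ] E' →L[ℝ] ℝ} {ψ : E → E'} {y : E}
    (hB : MetricNear B (ψ y)) (hψ : SmoothNear ψ y) (hh : MetricNear (pullbackForm B ψ) y)
    (hs : Function.Surjective (fderiv ℝ ψ y)) (v w : E) :
    fderiv ℝ ψ y (levi (pullbackForm B ψ) y v w) = hessMap B ψ y v w := by
  refine hB.ext fun x => ?_
  obtain ⟨x, rfl⟩ := hs x
  rw [apply_hessMap_tangent hB hψ hh, pullbackForm_apply]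

/-- The curvature is a tensor. -/
theorem fderiv_curv_levi_pullbackForm {B : E' → E' →L[ℝ] E' →L[ℝ] ℝ} {ψ : E → E'} {y : E}
    (hB : MetricNear B (ψ y)) (hψ : SmoothNear ψ y) (hh : MetricNear (pullbackForm B ψ) y)
    (hs : ∀ᶠ z in 𝓝 y, Function.Surjective (fderiv ℝ ψ z)) (u v w : E) :
    fderiv ℝ ψ y (curv (levi (pullbackForm B ψ)) y u v w)
      = curv (levi B) (ψ y) (fderiv ℝ ψ y u) (fderiv ℝ ψ y v) (fderiv ℝ ψ y w) := by
  have hev : ∀ᶠ z in 𝓝 y, ∀ v w, fderiv ℝ ψ z (levi (pullbackForm B ψ) z v w)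
      = hessMap B ψ z v w := by
    filter_upwards [hs, hψ.continuousAt.eventually hB.eventually, hψ.eventually, hh.eventually]
      with z h1 h2 h3 h4 v w
    exact fderiv_levi_pullbackForm h2 h3 h4 h1 v w
  have h0 := hev.self_of_nhds
  have hA := hψ.fderiv.differentiableAt
  have hA2 := hψ.fderiv.fderiv.differentiableAt
  have hG' := hh.levi_smoothNear.differentiableAt
  have hG := hB.levi_smoothNear.differentiableAt
  have hGψ : DifferentiableAt ℝ (fun z => levi B (ψ z)) y :=
    (hB.levi_smoothNear.comp hψ).differentiableAt
  have e2 (u x : E) : fderiv ℝ (fun z => fderiv ℝ ψ z x) y u = fderiv ℝ (fderiv ℝ ψ) y u x := by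
    rw [fderiv_apply_one hA (by fun_prop)]; simp
  -- differentiate the transformation law of the Christoffel tensor
  have key (u v w : E) : fderiv ℝ ψ y (fderiv ℝ (levi (pullbackForm B ψ)) y u v w)
      = fderiv ℝ (fderiv ℝ (fderiv ℝ ψ)) y u v w
        + fderiv ℝ (levi B) (ψ y) (fderiv ℝ ψ y u) (fderiv ℝ ψ y v) (fderiv ℝ ψ y w)
        + levi B (ψ y) (fderiv ℝ (fderiv ℝ ψ) y u v) (fderiv ℝ ψ y w)
        + levi B (ψ y) (fderiv ℝ ψ y v) (fderiv ℝ (fderiv ℝ ψ) y u w)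
        - fderiv ℝ (fderiv ℝ ψ) y u (levi (pullbackForm B ψ) y v w) := by
    have h1 : (fun z => fderiv ℝ ψ z (levi (pullbackForm B ψ) z v w)) =ᶠ[𝓝 y]
        fun z => hessMap B ψ z v w := by
      filter_upwards [hev] with z hz using hz v w
    have h2 := DFunLike.congr_fun (h1.fderiv_eq (𝕜 := ℝ)) u
    simp only [hessMap_apply] at h2
    rw [fderiv_apply_one hA (by fun_prop), fderiv_const_apply_two hG',
      fderiv_fun_add (by fun_prop) (by fun_prop), add_apply,
      fderiv_const_apply_two hA2, fderiv_apply_two hGψ (by fun_prop) (by fun_prop), e2, e2] at h2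
    have e1 : fderiv ℝ (fun z => levi B (ψ z)) y u = fderiv ℝ (levi B) (ψ y) (fderiv ℝ ψ y u) := by
      change fderiv ℝ (levi B ∘ ψ) y u = _
      rw [fderiv_comp y hG hψ.differentiableAt]
      rfl
    rw [e1] at h2
    rw [eq_sub_iff_add_eq, add_comm, h2]
    abel
  simp only [curv, map_add, map_sub, key, h0, hessMap_apply]
  rw [hψ.fderiv.fderiv_fderiv_comm u v, hψ.fderiv_fderiv_comm u v]
  abel

end Naturality

section Conformal

variable {E : Type*} [NormedAddCommGroup E] [NormedSpace ℝ E]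

/-- The conformally related metric `e^{2u} B` on a vector space. -/
def conformalForm (u : E → ℝ) (B : E → E →L[ℝ] E →L[ℝ] ℝ) (z : E) : E →L[ℝ] E →L[ℝ] ℝ :=
  Real.exp (2 * u z) • B z

theorem conformalForm_apply (u : E → ℝ) (B : E → E →L[ℝ] E →L[ℝ] ℝ) (z v w : E) :
    conformalForm u B z v w = Real.exp (2 * u z) * B z v w := rfl

theorem MetricNear.conformalForm {u : E → ℝ} {B : E → E →L[ℝ] E →L[ℝ] ℝ} {z : E}
    (hB : MetricNear B z) (hu : SmoothNear u z) : MetricNear (conformalForm u B) z := by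
  refine ⟨?_, ?_⟩
  · filter_upwards [hB.1, hu] with z' h1 h2
    exact (Real.contDiff_exp.contDiffAt.comp z' (contDiffAt_const.mul h2)).smul h1
  · filter_upwards [hB.2] with z' h1
    refine ⟨fun v w => ?_, fun v hv => ?_⟩
    · rw [conformalForm_apply, conformalForm_apply, h1.1]
    · rw [conformalForm_apply]
      have := h1.2 v hv
      positivity

/-- The gradient of `u` with respect to the metric `B`. -/
def gradForm (B : E → E →L[ℝ] E →L[ℝ] ℝ) (u : E → ℝ) (z : E) : E := sharp B z (fderiv ℝ u z)

variable [FiniteDimensional ℝ E]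

theorem MetricNear.apply_gradForm {u : E → ℝ} {B : E → E →L[ℝ] E →L[ℝ] ℝ} {z : E}
    (hB : MetricNear B z) (w : E) : B z (gradForm B u z) w = fderiv ℝ u z w :=
  hB.apply_sharp _ _

theorem MetricNear.gradForm_smoothNear {u : E → ℝ} {B : E → E →L[ℝ] E →L[ℝ] ℝ} {z : E}
    (hB : MetricNear B z) (hu : SmoothNear u z) : SmoothNear (gradForm B u) z := by
  filter_upwards [hB.sharp_smoothNear, hu.fderiv] with z' h1 h2
  exact h1.clm_apply h2

/-- The conformal change of the Levi-Civita connection: the right-hand side is symmetric and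
compatible with `e^{2u} B`. -/
theorem levi_conformalForm {u : E → ℝ} {B : E → E →L[ℝ] E →L[ℝ] ℝ} {z : E}
    (hB : MetricNear B z) (hu : SmoothNear u z) (v w : E) :
    levi (conformalForm u B) z v w = levi B z v w
      + (fderiv ℝ u z v • w + fderiv ℝ u z w • v - B z v w • gradForm B u z) := by
  have hud := hu.differentiableAt
  refine (hB.conformalForm hu).levi_unique
    (Γ := fun v w => levi B z v w
      + (fderiv ℝ u z v • w + fderiv ℝ u z w • v - B z v w • gradForm B u z)) ⟨?_, ?_⟩ v w
  · intro v w
    simp only [hB.levi_symm v w, hB.symm v w]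
    abel
  · intro a v w
    have hexp : DifferentiableAt ℝ (fun z => Real.exp (2 * u z)) z := by fun_prop
    have h1 : fderiv ℝ (conformalForm u B) z a v w
        = Real.exp (2 * u z) * (fderiv ℝ B z a v w + 2 * fderiv ℝ u z a * B z v w) := by
      unfold conformalForm
      rw [fderiv_fun_smul hexp hB.1.differentiableAt, fderiv_exp (by fun_prop),
        fderiv_const_mul hud]
      simp
      ring
    rw [h1, hB.fderiv_eq]
    simp only [conformalForm_apply, map_add, map_sub, map_smul, add_apply,
      sub_apply, smul_apply, hB.apply_gradForm, smul_eq_mul,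
      hB.symm v (gradForm B u z), hB.symm v a]
    ring

/-- The covariant Hessian of a function. -/
def hessFun (B : E → E →L[ℝ] E →L[ℝ] ℝ) (u : E → ℝ) (z v w : E) : ℝ :=
  fderiv ℝ (fderiv ℝ u) z v w - fderiv ℝ u z (levi B z v w)

/-- The conformal change of sectional curvature. -/
theorem apply_curv_conformalForm {u : E → ℝ} {B : E → E →L[ℝ] E →L[ℝ] ℝ} {z : E}
    (hB : MetricNear B z) (hu : SmoothNear u z) {a b : E} (ha : B z a a = 1) (hb : B z b b = 1)
    (hab : B z a b = 0) :
    B z (curv (levi (conformalForm u B)) z a b b) a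
      = B z (curv (levi B) z a b b) a - hessFun B u z a a - hessFun B u z b b
        + fderiv ℝ u z a ^ 2 + fderiv ℝ u z b ^ 2 - B z (gradForm B u z) (gradForm B u z) := by
  have hud := hu.differentiableAt
  have hu1 := hu.fderiv.differentiableAt
  have hBd := hB.1.differentiableAt
  have hX := (hB.gradForm_smoothNear hu).differentiableAt
  have hG := hB.levi_smoothNear.differentiableAt
  have e2 (p x : E) : fderiv ℝ (fun z => fderiv ℝ u z x) z p = fderiv ℝ (fderiv ℝ u) z p x := by
    rw [fderiv_apply_one hu1 (by fun_prop)]; simp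
  -- the covariant derivative of the gradient is the covariant Hessian
  have hDX (p x : E) : B z (fderiv ℝ (gradForm B u) z p) x
      = fderiv ℝ (fderiv ℝ u) z p x - B z (levi B z p (gradForm B u z)) x
        - fderiv ℝ u z (levi B z p x) := by
    have h1 : (fun z' => B z' (gradForm B u z') x) =ᶠ[𝓝 z] fun z' => fderiv ℝ u z' x := by
      filter_upwards [hB.eventually] with z' h using h.apply_gradForm x
    have h2 := DFunLike.congr_fun (h1.fderiv_eq (𝕜 := ℝ)) p
    rw [e2] at h2
    rw [fderiv_apply_two hBd hX (by fun_prop), hB.fderiv_eq, hB.apply_gradForm] at h2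
    simp at h2
    linarith
  have key (p v w : E) : fderiv ℝ (levi (conformalForm u B)) z p v w
      = fderiv ℝ (levi B) z p v w + (fderiv ℝ (fderiv ℝ u) z p v • w
        + fderiv ℝ (fderiv ℝ u) z p w • v
        - (fderiv ℝ B z p v w • gradForm B u z + B z v w • fderiv ℝ (gradForm B u) z p)) := by
    rw [← fderiv_const_apply_two (hB.conformalForm hu).levi_smoothNear.differentiableAt]
    have h1 : (fun z' => levi (conformalForm u B) z' v w) =ᶠ[𝓝 z] fun z' => levi B z' v w
        + (fderiv ℝ u z' v • w + fderiv ℝ u z' w • v - B z' v w • gradForm B u z') := by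
      filter_upwards [hB.eventually, hu.eventually] with z' h h' using levi_conformalForm h h' v w
    rw [h1.fderiv_eq, fderiv_fun_add (by fun_prop) (by fun_prop),
      fderiv_fun_sub (by fun_prop) (by fun_prop), fderiv_fun_add (by fun_prop) (by fun_prop),
      fderiv_fun_smul (by fun_prop) hX, fderiv_smul_const (by fun_prop),
      fderiv_smul_const (by fun_prop)]
    simp only [add_apply, sub_apply,
      smul_apply, ContinuousLinearMap.smulRight_apply, e2,
      fderiv_const_apply_two hBd, fderiv_const_apply_two hG]
    abel
  simp only [curv, key, levi_conformalForm hB hu, map_add, map_sub, map_smul,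
    add_apply, sub_apply, smul_apply,
    smul_eq_mul, hDX, hB.apply_gradForm, hB.fderiv_eq, hessFun]
  have hba : B z b a = 0 := by rw [hB.symm, hab]
  rw [hB.levi_symm b a, hu.fderiv_fderiv_comm b a]
  simp only [hB.symm a (gradForm B u z), hB.symm b (gradForm B u z), hB.symm a (levi B z _ _),
    hB.symm b (levi B z _ _), hB.apply_gradForm, ha, hb, hab, hba]
  have h3 : fderiv ℝ u z (gradForm B u z) = B z (gradForm B u z) (gradForm B u z) :=
    (hB.apply_gradForm _).symm
  rw [h3]
  ring

end Conformal

/-! ### Comparison with the classical coordinate formulas -/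

section Coordinates

variable {n : ℕ}

theorem sum_smul_coordVec (v : Coord n) : ∑ i, v i • coordVec i = v := by
  ext j
  simp [coordVec, Pi.single_apply]

/-- The Gram matrix of a field of bilinear forms on `ℝⁿ`. -/
def gramMatrix (B : Coord n → Coord n →L[ℝ] Coord n →L[ℝ] ℝ) (z : Coord n) :
    Matrix (Fin n) (Fin n) ℝ :=
  Matrix.of fun i j => B z (coordVec i) (coordVec j)

theorem MetricNear.gramMatrix_det_ne_zero {B : Coord n → Coord n →L[ℝ] Coord n →L[ℝ] ℝ}
    {z : Coord n} (hB : MetricNear B z) : (gramMatrix B z).det ≠ 0 := by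
  intro h
  obtain ⟨v, hv, hv0⟩ := Matrix.exists_mulVec_eq_zero_iff.2 h
  refine hv ?_
  have h1 : (WithLp.toLp 2 v : Coord n) = 0 := by
    refine hB.ext fun x => ?_
    rw [hB.symm, map_zero, ← sum_smul_coordVec x, ← sum_smul_coordVec (WithLp.toLp 2 v)]
    simp only [map_sum, map_smul, sum_apply, smul_apply, zero_apply]
    simp only [smul_eq_mul, Finset.mul_sum, mul_zero, Finset.sum_const_zero]
    rw [Finset.sum_comm]
    refine Finset.sum_eq_zero fun i _ => ?_
    have h2 : ∑ j, gramMatrix B z i j * v j = 0 := congrFun hv0 i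
    rw [← mul_zero (x i), ← h2, Finset.mul_sum]
    refine Finset.sum_congr rfl fun j _ => ?_
    simp only [gramMatrix, Matrix.of_apply]
    ring
  simpa using congrArg (fun x : Coord n => x.ofLp) h1

/-- The Christoffel symbols of the Gram matrix are the components of `levi B`. -/
theorem MetricNear.christoffel_eq {B : Coord n → Coord n →L[ℝ] Coord n →L[ℝ] ℝ}
    {z : Coord n} (hB : MetricNear B z) (k i j : Fin n) :
    christoffel (gramMatrix B) k i j z = levi B z (coordVec i) (coordVec j) k := by
  have hpd (a b c : Fin n) : partialDeriv a (fun z => gramMatrix B z b c) z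
      = fderiv ℝ B z (coordVec a) (coordVec b) (coordVec c) :=
    fderiv_const_apply_two hB.1.differentiableAt _ _ _
  have hdet : IsUnit (gramMatrix B z).det := hB.gramMatrix_det_ne_zero.isUnit
  have hsym (a b : Fin n) : gramMatrix B z a b = gramMatrix B z b a := hB.symm _ _
  have : (WithLp.toLp 2 fun k => christoffel (gramMatrix B) k i j z : Coord n)
      = levi B z (coordVec i) (coordVec j) := by
    refine hB.ext fun x => ?_
    rw [levi_apply, hB.apply_sharp, ← sum_smul_coordVec x]
    simp only [map_sum, map_smul]
    refine Finset.sum_congr rfl fun l _ => ?_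
    congr 1
    rw [koszul_apply, ← sum_smul_coordVec (WithLp.toLp 2 _)]
    simp only [map_sum, map_smul, sum_apply, smul_apply, smul_eq_mul, christoffel, hpd]
    have hmul (m : Fin n) : ∑ k, gramMatrix B z l k * (gramMatrix B z)⁻¹ k m
        = if l = m then 1 else 0 := by
      rw [← Matrix.mul_apply, Matrix.mul_nonsing_inv _ hdet, Matrix.one_apply]
    have e1 (k : Fin n) : B z (coordVec k) (coordVec l) = gramMatrix B z l k := hsym k l
    simp only [e1, mul_assoc, ← Finset.mul_sum, Finset.sum_mul]
    congr 1
    rw [Finset.sum_comm]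
    calc _ = ∑ m, (∑ k, gramMatrix B z l k * (gramMatrix B z)⁻¹ k m)
          * (fderiv ℝ B z (coordVec i) (coordVec j) (coordVec m)
            + fderiv ℝ B z (coordVec j) (coordVec i) (coordVec m)
            - fderiv ℝ B z (coordVec m) (coordVec i) (coordVec j)) := by
          refine Finset.sum_congr rfl fun m _ => ?_
          rw [Finset.sum_mul]
          exact Finset.sum_congr rfl fun k _ => by ring
      _ = _ := by simp [hmul]
  rw [← this]

theorem MetricNear.levi_eq_sum {B : Coord n → Coord n →L[ℝ] Coord n →L[ℝ] ℝ}
    {z : Coord n} (hB : MetricNear B z) (v w : Coord n) :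
    levi B z v w
      = WithLp.toLp 2 fun k => ∑ i, ∑ j, christoffel (gramMatrix B) k i j z * v i * w j := by
  conv_lhs => rw [← sum_smul_coordVec v, ← sum_smul_coordVec w]
  ext k
  simp only [map_sum, map_smul, sum_apply, smul_apply, PiLp.smul_apply,
    WithLp.ofLp_sum, Finset.sum_apply, hB.christoffel_eq, smul_eq_mul]
  simp only [Finset.mul_sum]
  rw [Finset.sum_comm]
  refine Finset.sum_congr rfl fun i _ => Finset.sum_congr rfl fun j _ => ?_
  ring

/-- The coefficients `Rˡₖᵢⱼ` of the Gram matrix are the components of the curvature of `levi B`. -/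
theorem MetricNear.riemannCoeff_eq {B : Coord n → Coord n →L[ℝ] Coord n →L[ℝ] ℝ}
    {z : Coord n} (hB : MetricNear B z) (l k i j : Fin n) :
    riemannCoeff (gramMatrix B) l k i j z
      = curv (levi B) z (coordVec i) (coordVec j) (coordVec k) l := by
  have hG := hB.levi_smoothNear.differentiableAt
  have hpd (i l j k : Fin n) : partialDeriv i (christoffel (gramMatrix B) l j k) z
      = fderiv ℝ (levi B) z (coordVec i) (coordVec j) (coordVec k) l := by
    have h1 : christoffel (gramMatrix B) l j k =ᶠ[𝓝 z]
        fun z' => EuclideanSpace.proj (𝕜 := ℝ) l (levi B z' (coordVec j) (coordVec k)) := by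
      filter_upwards [hB.eventually] with z' h using h.christoffel_eq l j k
    rw [partialDeriv, h1.fderiv_eq]
    change fderiv ℝ ((EuclideanSpace.proj (𝕜 := ℝ) l) ∘
      fun z' => levi B z' (coordVec j) (coordVec k)) z _ = _
    rw [fderiv_comp z (ContinuousLinearMap.differentiableAt _) (by fun_prop),
      ContinuousLinearMap.fderiv, ContinuousLinearMap.comp_apply,
      fderiv_const_apply_two hG]
    rfl
  have hcomp (v x : Coord n) : ∑ a, levi B z v (coordVec a) l * x a = levi B z v x l := by
    conv_rhs => rw [← sum_smul_coordVec x]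
    simp only [map_sum, map_smul, WithLp.ofLp_sum, Finset.sum_apply, PiLp.smul_apply, smul_eq_mul]
    exact Finset.sum_congr rfl fun _ _ => mul_comm _ _
  simp only [riemannCoeff, hpd, hB.christoffel_eq, Finset.sum_sub_distrib, hcomp, curv]
  simp

theorem MetricNear.curv_eq_sum {B : Coord n → Coord n →L[ℝ] Coord n →L[ℝ] ℝ}
    {z : Coord n} (hB : MetricNear B z) (v w x : Coord n) :
    curv (levi B) z v w x = WithLp.toLp 2 fun l => ∑ i, ∑ j, ∑ k,
      v i * w j * x k * riemannCoeff (gramMatrix B) l k i j z := by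
  let T : Coord n →ₗ[ℝ] Coord n →ₗ[ℝ] Coord n →ₗ[ℝ] Coord n :=
    LinearMap.mk₂ ℝ (fun v w =>
      { toFun := fun x => curv (levi B) z v w x
        map_add' := fun a b => by simp only [curv, map_add]; abel
        map_smul' := fun c a => by
          simp only [curv, map_smul, smul_sub, smul_add, RingHom.id_apply] })
      (fun a b c => by
        ext1 x
        simp only [curv, map_add, add_apply, LinearMap.coe_mk, AddHom.coe_mk, LinearMap.add_apply]
        abel)
      (fun a b c => by
        ext1 x
        simp only [curv, map_smul, smul_apply, LinearMap.coe_mk, AddHom.coe_mk,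
          LinearMap.smul_apply, smul_sub, smul_add])
      (fun a b c => by
        ext1 x
        simp only [curv, map_add, add_apply, LinearMap.coe_mk, AddHom.coe_mk, LinearMap.add_apply]
        abel)
      (fun a b c => by
        ext1 x
        simp only [curv, map_smul, smul_apply, LinearMap.coe_mk, AddHom.coe_mk,
          LinearMap.smul_apply, smul_sub, smul_add])
  have hT : curv (levi B) z v w x = T v w x := rfl
  rw [hT]
  conv_lhs => rw [← sum_smul_coordVec v, ← sum_smul_coordVec w, ← sum_smul_coordVec x]
  have hT' (i j k l : Fin n) : T (coordVec i) (coordVec j) (coordVec k) l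
      = riemannCoeff (gramMatrix B) l k i j z := (hB.riemannCoeff_eq l k i j).symm
  ext l
  simp only [map_sum, map_smul, LinearMap.sum_apply, LinearMap.smul_apply, WithLp.ofLp_sum,
    Finset.sum_apply, PiLp.smul_apply, smul_eq_mul, hT']
  simp only [Finset.mul_sum]
  rw [Finset.sum_comm]
  conv_lhs =>
    enter [2, j]
    rw [Finset.sum_comm]
  rw [Finset.sum_comm]
  refine Finset.sum_congr rfl fun i _ => Finset.sum_congr rfl fun j _ =>
    Finset.sum_congr rfl fun k _ => ?_
  ring

end Coordinates

/-! ### Orthonormal frames -/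

section Frames

/-- `e` is an orthonormal frame for the bilinear form `h` on the plane. -/
def IsOrthoFrame (h : Coord 2 →L[ℝ] Coord 2 →L[ℝ] ℝ) (e : Fin 2 → Coord 2) : Prop :=
  ∀ i j, h (e i) (e j) = if i = j then 1 else 0

/-- The bilinear form `h` is an inner product: symmetric and positive definite. -/
def IsInner {E : Type*} [NormedAddCommGroup E] [NormedSpace ℝ E] (h : E →L[ℝ] E →L[ℝ] ℝ) : Prop :=
  (∀ v w, h v w = h w v) ∧ ∀ v, v ≠ 0 → 0 < h v v

theorem MetricNear.isInner {E : Type*} [NormedAddCommGroup E] [NormedSpace ℝ E]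
    {B : E → E →L[ℝ] E →L[ℝ] ℝ} {z : E} (hB : MetricNear B z) : IsInner (B z) :=
  ⟨hB.symm, fun _ => hB.pos⟩

variable {h : Coord 2 →L[ℝ] Coord 2 →L[ℝ] ℝ} {e e' : Fin 2 → Coord 2}

theorem IsOrthoFrame.sum_eq (he : IsOrthoFrame h e) (v : Coord 2) :
    ∑ i, h v (e i) • e i = v := by
  have hli : LinearIndependent ℝ e := by
    rw [Fintype.linearIndependent_iff]
    intro c hc j
    have := congrArg (fun x => h x (e j)) hc
    fin_cases j <;> simpa [he _ _] using this
  have hspan : Submodule.span ℝ (Set.range e) = ⊤ :=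
    hli.span_eq_top_of_card_eq_finrank (by simp)
  have hv : v ∈ Submodule.span ℝ (Set.range e) := hspan ▸ Submodule.mem_top
  obtain ⟨c, rfl⟩ := (Submodule.mem_span_range_iff_exists_fun ℝ).1 hv
  refine Finset.sum_congr rfl fun i _ => ?_
  fin_cases i <;> simp [he _ _]

/-- The trace of a bilinear map does not depend on the orthonormal frame. -/
theorem IsOrthoFrame.sum_apply_eq {F : Type*} [AddCommGroup F] [Module ℝ F]
    (he : IsOrthoFrame h e) (he' : IsOrthoFrame h e') (hh : IsInner h)
    (β : Coord 2 →ₗ[ℝ] Coord 2 →ₗ[ℝ] F) : ∑ i, β (e i) (e i) = ∑ i, β (e' i) (e' i) := by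
  calc ∑ i, β (e i) (e i) = ∑ i, β (∑ j, h (e i) (e' j) • e' j) (e i) := by
        simp only [he'.sum_eq]
    _ = ∑ j, β (e' j) (∑ i, h (e' j) (e i) • e i) := by
        simp only [map_sum, map_smul, LinearMap.sum_apply, LinearMap.smul_apply]
        rw [Finset.sum_comm]
        simp only [hh.1]
    _ = _ := by simp only [he.sum_eq]

theorem coordVec_zero_ne : (coordVec 0 : Coord 2) ≠ 0 := by
  intro h
  simpa [coordVec] using congrArg (fun x : Coord 2 => x 0) h

/-- The second vector of the Gram-Schmidt process does not vanish. -/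
theorem gramSchmidt_vec_ne (c : ℝ) : (coordVec 1 - c • coordVec 0 : Coord 2) ≠ 0 := by
  intro h
  simpa [coordVec] using congrArg (fun x : Coord 2 => x 1) h

theorem isOrthoFrame_orthoFrame (hh : IsInner h) : IsOrthoFrame h (orthoFrame h) := by
  have h0 := hh.2 _ coordVec_zero_ne
  set e₁ : Coord 2 := (Real.sqrt (h (coordVec 0) (coordVec 0)))⁻¹ • coordVec 0 with he₁
  set c : Coord 2 := coordVec 1 - h (coordVec 1) e₁ • e₁ with hc
  have hfr : orthoFrame h = ![e₁, (Real.sqrt (h c c))⁻¹ • c] := rfl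
  clear_value e₁
  have e11 : h e₁ e₁ = 1 := by
    have := Real.mul_self_sqrt h0.le
    have hs := Real.sqrt_pos.2 h0
    simp only [he₁, map_smul, smul_apply, smul_eq_mul]
    field_simp
    linarith
  have hc0 : c ≠ 0 := by
    rw [hc, he₁, smul_smul]
    exact gramSchmidt_vec_ne _
  have hcc := hh.2 _ hc0
  have ec : h e₁ c = 0 := by
    rw [hc, map_sub, map_smul, e11, hh.1 e₁]; simp
  have ecc : h ((Real.sqrt (h c c))⁻¹ • c) ((Real.sqrt (h c c))⁻¹ • c) = 1 := by
    have := Real.mul_self_sqrt hcc.le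
    have hs := Real.sqrt_pos.2 hcc
    simp only [map_smul, smul_apply, smul_eq_mul]
    field_simp
    linarith
  intro i j
  rw [hfr]
  fin_cases i <;> fin_cases j
  · simpa using e11
  · simp [ec]
  · simp [hh.1 c, ec]
  · simpa using ecc

theorem orthoFrame_smoothNear {E : Type*} [NormedAddCommGroup E] [NormedSpace ℝ E]
    {H : E → Coord 2 →L[ℝ] Coord 2 →L[ℝ] ℝ} {y : E}
    (hs : SmoothNear H y) (hH : ∀ᶠ z in 𝓝 y, IsInner (H z)) (i : Fin 2) :
    SmoothNear (fun z => orthoFrame (H z) i) y := by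
  filter_upwards [hs, hH] with z h1 h2
  have e1 : ContDiffAt ℝ ∞ (fun z => orthoFrame (H z) 0) z := by
    change ContDiffAt ℝ ∞ (fun z => (Real.sqrt (H z (coordVec 0) (coordVec 0)))⁻¹ •
      (coordVec 0 : Coord 2)) z
    have h0 := h2.2 _ coordVec_zero_ne
    exact (((h1.clm_apply contDiffAt_const).clm_apply contDiffAt_const).sqrt h0.ne').inv
      (Real.sqrt_pos.2 h0).ne' |>.smul contDiffAt_const
  have ec : ContDiffAt ℝ ∞ (fun z => (coordVec 1 : Coord 2)
      - H z (coordVec 1) (orthoFrame (H z) 0) • orthoFrame (H z) 0) z :=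
    contDiffAt_const.sub (((h1.clm_apply contDiffAt_const).clm_apply e1).smul e1)
  have e2 : ContDiffAt ℝ ∞ (fun z => orthoFrame (H z) 1) z := by
    set c : E → Coord 2 := fun z => (coordVec 1 : Coord 2)
      - H z (coordVec 1) (orthoFrame (H z) 0) • orthoFrame (H z) 0 with hc
    change ContDiffAt ℝ ∞ (fun z => (Real.sqrt (H z (c z) (c z)))⁻¹ • c z) z
    have hc0 : c z ≠ 0 := by
      change (coordVec 1 : Coord 2) - _ • (_ • coordVec 0) ≠ 0
      rw [smul_smul]
      exact gramSchmidt_vec_ne _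
    have h0 := h2.2 _ hc0
    exact (((h1.clm_apply ec).clm_apply ec).sqrt h0.ne').inv
      (Real.sqrt_pos.2 h0).ne' |>.smul ec
  fin_cases i
  · exact e1
  · exact e2

end Frames

/-! ### Parametrized surfaces: independence of frame, parameters and ambient coordinates -/

section Composition

variable {E E' F : Type*} [NormedAddCommGroup E] [NormedSpace ℝ E]
  [NormedAddCommGroup E'] [NormedSpace ℝ E'] [NormedAddCommGroup F] [NormedSpace ℝ F]

theorem SmoothNear.fderiv_comp {ψ : E' → F} {φ : E → E'} {y : E} (hψ : SmoothNear ψ (φ y))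
    (hφ : SmoothNear φ y) (v : E) :
    _root_.fderiv ℝ (ψ ∘ φ) y v = _root_.fderiv ℝ ψ (φ y) (_root_.fderiv ℝ φ y v) := by
  rw [_root_.fderiv_comp y hψ.differentiableAt hφ.differentiableAt]; rfl

/-- The second derivative of a composition. -/
theorem SmoothNear.fderiv_fderiv_comp {ψ : E' → F} {φ : E → E'} {y : E}
    (hψ : SmoothNear ψ (φ y)) (hφ : SmoothNear φ y) (v w : E) :
    _root_.fderiv ℝ (_root_.fderiv ℝ (ψ ∘ φ)) y v w
      = _root_.fderiv ℝ (_root_.fderiv ℝ ψ) (φ y) (_root_.fderiv ℝ φ y v) (_root_.fderiv ℝ φ y w)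
        + _root_.fderiv ℝ ψ (φ y) (_root_.fderiv ℝ (_root_.fderiv ℝ φ) y v w) := by
  have h1 : (fun z => _root_.fderiv ℝ (ψ ∘ φ) z w) =ᶠ[𝓝 y]
      fun z => _root_.fderiv ℝ ψ (φ z) (_root_.fderiv ℝ φ z w) := by
    filter_upwards [hφ.eventually, hφ.continuousAt.eventually hψ.eventually] with z h2 h3
    exact h3.fderiv_comp h2 w
  have hφ1 := hφ.fderiv.differentiableAt
  have h4 : DifferentiableAt ℝ (fun z => _root_.fderiv ℝ ψ (φ z)) y :=
    (hψ.fderiv.comp hφ).differentiableAt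
  have h2 := DFunLike.congr_fun (h1.fderiv_eq (𝕜 := ℝ)) v
  rw [fderiv_apply_one (hψ.comp hφ).fderiv.differentiableAt (by fun_prop),
    fderiv_apply_one h4 (by fun_prop), fderiv_apply_one hφ1 (by fun_prop)] at h2
  have h5 : _root_.fderiv ℝ (fun z => _root_.fderiv ℝ ψ (φ z)) y v
      = _root_.fderiv ℝ (_root_.fderiv ℝ ψ) (φ y) (_root_.fderiv ℝ φ y v) :=
    hψ.fderiv.fderiv_comp hφ v
  rw [h5] at h2
  simpa using h2

theorem hessMap_comp {B : F → F →L[ℝ] F →L[ℝ] ℝ} {ψ : E' → F} {φ : E → E'} {y : E}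
    (hψ : SmoothNear ψ (φ y)) (hφ : SmoothNear φ y) (v w : E) :
    hessMap B (ψ ∘ φ) y v w = hessMap B ψ (φ y) (fderiv ℝ φ y v) (fderiv ℝ φ y w)
      + fderiv ℝ ψ (φ y) (fderiv ℝ (fderiv ℝ φ) y v w) := by
  rw [hessMap_apply, hessMap_apply, hψ.fderiv_fderiv_comp hφ, hψ.fderiv_comp hφ,
    hψ.fderiv_comp hφ]
  simp only [Function.comp_apply]
  abel

theorem pullbackForm_comp {B : F → F →L[ℝ] F →L[ℝ] ℝ} {ψ : E' → F} {φ : E → E'} {y : E}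
    (hψ : SmoothNear ψ (φ y)) (hφ : SmoothNear φ y) :
    pullbackForm B (ψ ∘ φ) y = pullbackForm (pullbackForm B ψ) φ y := by
  ext v w
  simp only [pullbackForm_apply, hψ.fderiv_comp hφ, Function.comp_apply]

/-- Covariant Hessians of functions are compatible with changes of coordinates. -/
theorem hessFun_comp [FiniteDimensional ℝ E] [FiniteDimensional ℝ E']
    {H : E' → E' →L[ℝ] E' →L[ℝ] ℝ} {H' : E → E →L[ℝ] E →L[ℝ] ℝ} {κ : E → E'} {v : E' → ℝ} {y : E}
    (hH : MetricNear H (κ y)) (hH' : MetricNear H' y) (hHH : H' =ᶠ[𝓝 y] pullbackForm H κ)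
    (hκ : SmoothNear κ y) (hs : Function.Surjective (fderiv ℝ κ y)) (hv : SmoothNear v (κ y))
    (a b : E) :
    hessFun H' (v ∘ κ) y a b = hessFun H v (κ y) (fderiv ℝ κ y a) (fderiv ℝ κ y b) := by
  rw [hessFun, hessFun, hv.fderiv_fderiv_comp hκ, hv.fderiv_comp hκ, levi_congr hHH,
    fderiv_levi_pullbackForm hH hκ (hH'.congr hHH.symm) hs, hessMap_apply, map_add]
  ring

end Composition

section Surface

variable {E E' : Type*} [NormedAddCommGroup E] [NormedSpace ℝ E]
  [NormedAddCommGroup E'] [NormedSpace ℝ E']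

/-- The second fundamental form at `y` of the parametrized surface `φ` in a vector space with
metric `B`, computed with the frame `e` of the parameter plane. -/
def sffForm (B : E → E →L[ℝ] E →L[ℝ] ℝ) (φ : Coord 2 → E) (e : Fin 2 → Coord 2)
    (y v w : Coord 2) : E :=
  hessMap B φ y v w
    - ∑ i, B (φ y) (hessMap B φ y v w) (fderiv ℝ φ y (e i)) • fderiv ℝ φ y (e i)

/-- The mean curvature vector of the parametrized surface `φ`. -/
def meanForm (B : E → E →L[ℝ] E →L[ℝ] ℝ) (φ : Coord 2 → E) (e : Fin 2 → Coord 2)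
    (y : Coord 2) : E := ∑ i, sffForm B φ e y (e i) (e i)

/-- The squared norm of the mean curvature vector of `φ`, for the metric `B`. -/
def meanSqForm (B : E → E →L[ℝ] E →L[ℝ] ℝ) (φ : Coord 2 → E) (e : Fin 2 → Coord 2)
    (y : Coord 2) : ℝ := B (φ y) (meanForm B φ e y) (meanForm B φ e y)

/-- The squared norm of the second fundamental form of `φ`. -/
def sffSqForm (B : E → E →L[ℝ] E →L[ℝ] ℝ) (φ : Coord 2 → E) (e : Fin 2 → Coord 2)
    (y : Coord 2) : ℝ :=
  ∑ i, ∑ j, B (φ y) (sffForm B φ e y (e i) (e j)) (sffForm B φ e y (e i) (e j))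

/-- The exterior scalar curvature of `φ`: the sum of the ambient sectional curvatures of the
tangent frame. No denominators appear, as `e` is meant to be orthonormal. -/
def extScalForm (B : E → E →L[ℝ] E →L[ℝ] ℝ) (φ : Coord 2 → E) (e : Fin 2 → Coord 2)
    (y : Coord 2) : ℝ :=
  ∑ i, ∑ j, B (φ y) (curv (levi B) (φ y) (fderiv ℝ φ y (e i)) (fderiv ℝ φ y (e j))
    (fderiv ℝ φ y (e j))) (fderiv ℝ φ y (e i))

section FrameIndependence

variable {B : E → E →L[ℝ] E →L[ℝ] ℝ} {φ : Coord 2 → E} {y : Coord 2} {e e' : Fin 2 → Coord 2}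

theorem sffForm_frame (hh : IsInner (pullbackForm B φ y)) (he : IsOrthoFrame (pullbackForm B φ y) e)
    (he' : IsOrthoFrame (pullbackForm B φ y) e') (v w : Coord 2) :
    sffForm B φ e y v w = sffForm B φ e' y v w := by
  unfold sffForm
  congr 1
  exact he.sum_apply_eq he' hh (LinearMap.mk₂ ℝ
    (fun a b => B (φ y) (hessMap B φ y v w) (fderiv ℝ φ y a) • fderiv ℝ φ y b)
    (fun _ _ _ => by simp only [map_add, add_smul])
    (fun _ _ _ => by simp only [map_smul, smul_smul, smul_eq_mul])
    (fun _ _ _ => by simp only [map_add, smul_add])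
    (fun c a b => by rw [map_smul, smul_comm]))

theorem sffForm_add_left (a b w : Coord 2) :
    sffForm B φ e y (a + b) w = sffForm B φ e y a w + sffForm B φ e y b w := by
  simp only [sffForm, map_add, add_apply, add_smul, Finset.sum_add_distrib]
  abel

theorem sffForm_add_right (a b w : Coord 2) :
    sffForm B φ e y w (a + b) = sffForm B φ e y w a + sffForm B φ e y w b := by
  simp only [sffForm, map_add, add_apply, add_smul, Finset.sum_add_distrib]
  abel

theorem sffForm_smul_left (c : ℝ) (a w : Coord 2) :
    sffForm B φ e y (c • a) w = c • sffForm B φ e y a w := by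
  simp only [sffForm, map_smul, smul_apply, smul_sub, Finset.smul_sum, smul_eq_mul, mul_smul]

theorem sffForm_smul_right (c : ℝ) (a w : Coord 2) :
    sffForm B φ e y w (c • a) = c • sffForm B φ e y w a := by
  simp only [sffForm, map_smul, smul_apply, smul_sub, Finset.smul_sum, smul_eq_mul, mul_smul]

theorem meanForm_frame (hh : IsInner (pullbackForm B φ y))
    (he : IsOrthoFrame (pullbackForm B φ y) e) (he' : IsOrthoFrame (pullbackForm B φ y) e') :
    meanForm B φ e y = meanForm B φ e' y := by
  unfold meanForm
  simp only [sffForm_frame hh he he']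
  exact he.sum_apply_eq he' hh (LinearMap.mk₂ ℝ (fun a b => sffForm B φ e' y a b)
    (fun _ _ _ => sffForm_add_left _ _ _) (fun _ _ _ => sffForm_smul_left _ _ _)
    (fun _ _ _ => sffForm_add_right _ _ _) (fun _ _ _ => sffForm_smul_right _ _ _))

theorem meanSqForm_frame (hh : IsInner (pullbackForm B φ y))
    (he : IsOrthoFrame (pullbackForm B φ y) e) (he' : IsOrthoFrame (pullbackForm B φ y) e') :
    meanSqForm B φ e y = meanSqForm B φ e' y := by
  rw [meanSqForm, meanSqForm, meanForm_frame hh he he']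

/-- `‖α‖²` does not depend on the frame, being a trace in each of its two indices. -/
theorem sffSqForm_frame (hh : IsInner (pullbackForm B φ y))
    (he : IsOrthoFrame (pullbackForm B φ y) e) (he' : IsOrthoFrame (pullbackForm B φ y) e') :
    sffSqForm B φ e y = sffSqForm B φ e' y := by
  unfold sffSqForm
  simp only [sffForm_frame hh he he']
  calc _ = ∑ i, ∑ j, B (φ y) (sffForm B φ e' y (e i) (e' j)) (sffForm B φ e' y (e i) (e' j)) := by
        refine Finset.sum_congr rfl fun i _ => ?_
        exact he.sum_apply_eq he' hh (LinearMap.mk₂ ℝ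
          (fun a b => B (φ y) (sffForm B φ e' y (e i) a) (sffForm B φ e' y (e i) b))
          (fun _ _ _ => by simp only [sffForm_add_right, map_add, add_apply])
          (fun _ _ _ => by simp only [sffForm_smul_right, map_smul, smul_apply])
          (fun _ _ _ => by simp only [sffForm_add_right, map_add])
          (fun _ _ _ => by simp only [sffForm_smul_right, map_smul]))
    _ = _ := by
        rw [Finset.sum_comm]
        conv_rhs => rw [Finset.sum_comm]
        refine Finset.sum_congr rfl fun j _ => ?_
        exact he.sum_apply_eq he' hh (LinearMap.mk₂ ℝ
          (fun a b => B (φ y) (sffForm B φ e' y a (e' j)) (sffForm B φ e' y b (e' j)))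
          (fun _ _ _ => by simp only [sffForm_add_left, map_add, add_apply])
          (fun _ _ _ => by simp only [sffForm_smul_left, map_smul, smul_apply])
          (fun _ _ _ => by simp only [sffForm_add_left, map_add])
          (fun _ _ _ => by simp only [sffForm_smul_left, map_smul]))

theorem extScalForm_frame (hh : IsInner (pullbackForm B φ y))
    (he : IsOrthoFrame (pullbackForm B φ y) e) (he' : IsOrthoFrame (pullbackForm B φ y) e') :
    extScalForm B φ e y = extScalForm B φ e' y := by
  unfold extScalForm
  calc _ = ∑ i, ∑ j, B (φ y) (curv (levi B) (φ y) (fderiv ℝ φ y (e i)) (fderiv ℝ φ y (e' j))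
            (fderiv ℝ φ y (e' j))) (fderiv ℝ φ y (e i)) := by
        refine Finset.sum_congr rfl fun i _ => ?_
        exact he.sum_apply_eq he' hh (LinearMap.mk₂ ℝ
          (fun a b => B (φ y) (curv (levi B) (φ y) (fderiv ℝ φ y (e i)) (fderiv ℝ φ y a)
            (fderiv ℝ φ y b)) (fderiv ℝ φ y (e i)))
          (fun _ _ _ => by simp only [curv, map_add, map_sub, sub_apply, add_apply]; ring)
          (fun _ _ _ => by
            simp only [curv, map_add, map_sub, map_smul, sub_apply, add_apply, smul_apply,
              smul_eq_mul]; ring)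
          (fun _ _ _ => by simp only [curv, map_add, map_sub, sub_apply, add_apply]; ring)
          (fun _ _ _ => by
            simp only [curv, map_add, map_sub, map_smul, sub_apply, add_apply, smul_apply,
              smul_eq_mul]; ring))
    _ = _ := by
        rw [Finset.sum_comm]
        conv_rhs => rw [Finset.sum_comm]
        refine Finset.sum_congr rfl fun j _ => ?_
        exact he.sum_apply_eq he' hh (LinearMap.mk₂ ℝ
          (fun a b => B (φ y) (curv (levi B) (φ y) (fderiv ℝ φ y a) (fderiv ℝ φ y (e' j))
            (fderiv ℝ φ y (e' j))) (fderiv ℝ φ y b))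
          (fun _ _ _ => by simp only [curv, map_add, map_sub, sub_apply, add_apply]; ring)
          (fun _ _ _ => by
            simp only [curv, map_add, map_sub, map_smul, sub_apply, add_apply, smul_apply,
              smul_eq_mul]; ring)
          (fun _ _ _ => by simp only [map_add])
          (fun _ _ _ => by simp only [map_smul]))

end FrameIndependence

/-- The geometric data of a parametrized surface `φ` in `(E, B)` at `y`: everything is smooth, `B`
is a metric near `φ y`, and `φ` is an immersion near `y`. -/
structure SurfaceNear (B : E → E →L[ℝ] E →L[ℝ] ℝ) (φ : Coord 2 → E) (y : Coord 2) : Prop where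
  metric : MetricNear B (φ y)
  smooth : SmoothNear φ y
  induced : MetricNear (pullbackForm B φ) y

section Reparametrization

variable {B : E → E →L[ℝ] E →L[ℝ] ℝ} {φ : Coord 2 → E} {κ : Coord 2 → Coord 2} {y : Coord 2}
  {e : Fin 2 → Coord 2}

theorem IsOrthoFrame.reparam (hφ : SmoothNear φ (κ y)) (hκ : SmoothNear κ y)
    (he : IsOrthoFrame (pullbackForm B (φ ∘ κ) y) e) :
    IsOrthoFrame (pullbackForm B φ (κ y)) fun i => fderiv ℝ κ y (e i) := by
  intro i j
  rw [← he i j, pullbackForm_comp hφ hκ]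
  rfl

/-- The second fundamental form is a tensor: the second derivatives of the change of parameters `κ`
contribute only tangential terms. -/
theorem sffForm_reparam (hφ : SmoothNear φ (κ y)) (hκ : SmoothNear κ y)
    (he : IsOrthoFrame (pullbackForm B (φ ∘ κ) y) e) (v w : Coord 2) :
    sffForm B (φ ∘ κ) e y v w
      = sffForm B φ (fun i => fderiv ℝ κ y (e i)) (κ y) (fderiv ℝ κ y v) (fderiv ℝ κ y w) := by
  unfold sffForm
  simp only [hessMap_comp hφ hκ, hφ.fderiv_comp hκ, Function.comp_apply, map_add, add_apply,
    add_smul, Finset.sum_add_distrib]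
  have h1 := congrArg (fderiv ℝ φ (κ y))
    ((he.reparam hφ hκ).sum_eq (fderiv ℝ (fderiv ℝ κ) y v w))
  simp only [map_sum, map_smul, pullbackForm_apply] at h1
  rw [h1]
  abel

end Reparametrization

section AmbientChange

variable {B : E → E →L[ℝ] E →L[ℝ] ℝ} {B' : E' → E' →L[ℝ] E' →L[ℝ] ℝ} {φ : Coord 2 → E}
  {ψ : E → E'} {y : Coord 2} {e : Fin 2 → Coord 2} [FiniteDimensional ℝ E] [FiniteDimensional ℝ E']

/-- The second fundamental form is carried along by a local isometry `ψ`. -/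
theorem sffForm_ambient (hφ : SmoothNear φ y) (hψ : SmoothNear ψ (φ y))
    (hB : MetricNear B (φ y)) (hB' : MetricNear B' (ψ (φ y)))
    (hBB : B =ᶠ[𝓝 (φ y)] pullbackForm B' ψ)
    (hs : Function.Surjective (fderiv ℝ ψ (φ y))) (v w : Coord 2) :
    sffForm B' (ψ ∘ φ) e y v w = fderiv ℝ ψ (φ y) (sffForm B φ e y v w) := by
  have h1 : hessMap B' (ψ ∘ φ) y v w = fderiv ℝ ψ (φ y) (hessMap B φ y v w) := by
    rw [hessMap_comp hψ hφ, hessMap_apply (B := B), levi_congr hBB, map_add,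
      fderiv_levi_pullbackForm hB' hψ (hB.congr hBB.symm) hs, add_comm]
  simp only [sffForm, h1, hψ.fderiv_comp hφ, Function.comp_apply, map_sub, map_sum, map_smul,
    hBB.self_of_nhds, pullbackForm_apply]

end AmbientChange

/-- Two descriptions `φ` in `(E, B)` and `φ'` in `(E', B')` of one surface, related by the change of
parameters `κ` and the local isometry `ψ`. -/
structure SameSurface (B : E → E →L[ℝ] E →L[ℝ] ℝ) (φ : Coord 2 → E)
    (B' : E' → E' →L[ℝ] E' →L[ℝ] ℝ) (φ' : Coord 2 → E') (ψ : E → E') (κ : Coord 2 → Coord 2)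
    (y : Coord 2) : Prop where
  surface : SurfaceNear B φ (κ y)
  surface' : SurfaceNear B' φ' y
  smooth_left : SmoothNear ψ (φ (κ y))
  smooth_right : SmoothNear κ y
  surjective : ∀ᶠ z in 𝓝 (φ (κ y)), Function.Surjective (fderiv ℝ ψ z)
  isometry : B =ᶠ[𝓝 (φ (κ y))] pullbackForm B' ψ
  eq_comp : φ' =ᶠ[𝓝 y] ψ ∘ φ ∘ κ

variable {B : E → E →L[ℝ] E →L[ℝ] ℝ} {B' : E' → E' →L[ℝ] E' →L[ℝ] ℝ} {φ : Coord 2 → E}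
  {φ' : Coord 2 → E'} {ψ : E → E'} {κ : Coord 2 → Coord 2} {y : Coord 2} {e e' : Fin 2 → Coord 2}

theorem SameSurface.metric_left (h : SameSurface B φ B' φ' ψ κ y) :
    MetricNear B' (ψ (φ (κ y))) := by
  have := h.surface'.metric
  rwa [h.eq_comp.eq_of_nhds] at this

theorem SameSurface.pullbackForm_eq (h : SameSurface B φ B' φ' ψ κ y) :
    pullbackForm B' φ' y = pullbackForm B (φ ∘ κ) y := by
  have h1 : pullbackForm B' φ' y = pullbackForm B' (ψ ∘ (φ ∘ κ)) y := by
    simp only [pullbackForm, h.eq_comp.fderiv_eq, h.eq_comp.eq_of_nhds]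
  rw [h1, pullbackForm_comp (φ := φ ∘ κ) h.smooth_left (h.surface.smooth.comp h.smooth_right)]
  simp only [pullbackForm, Function.comp_apply, h.isometry.eq_of_nhds]

theorem SameSurface.orthoFrame (h : SameSurface B φ B' φ' ψ κ y)
    (he' : IsOrthoFrame (pullbackForm B' φ' y) e') :
    IsOrthoFrame (pullbackForm B φ (κ y)) fun i => fderiv ℝ κ y (e' i) := by
  rw [h.pullbackForm_eq] at he'
  exact he'.reparam h.surface.smooth h.smooth_right

theorem SameSurface.fderiv_eq (h : SameSurface B φ B' φ' ψ κ y) (v : Coord 2) :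
    fderiv ℝ φ' y v = fderiv ℝ ψ (φ (κ y)) (fderiv ℝ φ (κ y) (fderiv ℝ κ y v)) := by
  rw [h.eq_comp.fderiv_eq, SmoothNear.fderiv_comp (φ := φ ∘ κ) h.smooth_left
    (h.surface.smooth.comp h.smooth_right), h.surface.smooth.fderiv_comp h.smooth_right]
  rfl

theorem SameSurface.apply_eq (h : SameSurface B φ B' φ' ψ κ y) (a b : E) :
    B' (φ' y) (fderiv ℝ ψ (φ (κ y)) a) (fderiv ℝ ψ (φ (κ y)) b) = B (φ (κ y)) a b := by
  rw [h.isometry.eq_of_nhds, h.eq_comp.eq_of_nhds]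
  rfl

variable [FiniteDimensional ℝ E] [FiniteDimensional ℝ E']

theorem SameSurface.sffForm_eq (h : SameSurface B φ B' φ' ψ κ y)
    (he' : IsOrthoFrame (pullbackForm B' φ' y) e') (v w : Coord 2) :
    sffForm B' φ' e' y v w = fderiv ℝ ψ (φ (κ y)) (sffForm B φ (fun i => fderiv ℝ κ y (e' i)) (κ y)
      (fderiv ℝ κ y v) (fderiv ℝ κ y w)) := by
  have h1 : sffForm B' φ' e' y v w = sffForm B' (ψ ∘ (φ ∘ κ)) e' y v w := by
    have h2 : fderiv ℝ φ' =ᶠ[𝓝 y] fderiv ℝ (ψ ∘ φ ∘ κ) := h.eq_comp.fderiv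
    simp only [sffForm, hessMap, h.eq_comp.fderiv_eq, h.eq_comp.eq_of_nhds, h2.fderiv_eq]
  rw [h1, sffForm_ambient (φ := φ ∘ κ) (h.surface.smooth.comp h.smooth_right) h.smooth_left
    h.surface.metric h.metric_left h.isometry h.surjective.self_of_nhds,
    sffForm_reparam h.surface.smooth h.smooth_right (h.pullbackForm_eq ▸ he')]
  rfl

theorem SameSurface.meanSqForm_eq (h : SameSurface B φ B' φ' ψ κ y)
    (he' : IsOrthoFrame (pullbackForm B' φ' y) e') (he : IsOrthoFrame (pullbackForm B φ (κ y)) e) :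
    meanSqForm B' φ' e' y = meanSqForm B φ e (κ y) := by
  rw [meanSqForm_frame h.surface.induced.isInner he (h.orthoFrame he')]
  simp only [meanSqForm, meanForm, h.sffForm_eq he', ← map_sum, h.apply_eq]

theorem SameSurface.sffSqForm_eq (h : SameSurface B φ B' φ' ψ κ y)
    (he' : IsOrthoFrame (pullbackForm B' φ' y) e') (he : IsOrthoFrame (pullbackForm B φ (κ y)) e) :
    sffSqForm B' φ' e' y = sffSqForm B φ e (κ y) := by
  rw [sffSqForm_frame h.surface.induced.isInner he (h.orthoFrame he')]
  simp only [sffSqForm, h.sffForm_eq he', h.apply_eq]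

theorem SameSurface.extScalForm_eq (h : SameSurface B φ B' φ' ψ κ y)
    (he' : IsOrthoFrame (pullbackForm B' φ' y) e') (he : IsOrthoFrame (pullbackForm B φ (κ y)) e) :
    extScalForm B' φ' e' y = extScalForm B φ e (κ y) := by
  rw [extScalForm_frame h.surface.induced.isInner he (h.orthoFrame he')]
  have hc (a b c : E) : curv (levi B') (φ' y) (fderiv ℝ ψ (φ (κ y)) a)
      (fderiv ℝ ψ (φ (κ y)) b) (fderiv ℝ ψ (φ (κ y)) c)
      = fderiv ℝ ψ (φ (κ y)) (curv (levi B) (φ (κ y)) a b c) := by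
    have h1 : φ' y = ψ (φ (κ y)) := h.eq_comp.eq_of_nhds
    have h2 : levi B =ᶠ[𝓝 (φ (κ y))] levi (pullbackForm B' ψ) := by
      filter_upwards [h.isometry.eventually_nhds] with z hz using levi_congr hz
    rw [h1, ← fderiv_curv_levi_pullbackForm h.metric_left h.smooth_left
      (h.surface.metric.congr h.isometry.symm) h.surjective]
    simp only [curv, h2.fderiv_eq, h2.eq_of_nhds]
  simp only [extScalForm, h.fderiv_eq, hc, h.apply_eq]

end Surface

/-! ### Conformal change of the extrinsic invariants, and the Laplacian as a divergence -/

section ConformalSurface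

variable {E : Type*} [NormedAddCommGroup E] [NormedSpace ℝ E] [FiniteDimensional ℝ E]
  {B : E → E →L[ℝ] E →L[ℝ] ℝ} {φ : Coord 2 → E} {y : Coord 2} {e : Fin 2 → Coord 2} {u : E → ℝ}

/-- The Laplacian of `v` at `y` for the metric `H`, as the trace of the covariant Hessian in the
orthonormal frame `e`. -/
def lapForm (H : Coord 2 → Coord 2 →L[ℝ] Coord 2 →L[ℝ] ℝ) (v : Coord 2 → ℝ)
    (e : Fin 2 → Coord 2) (y : Coord 2) : ℝ := ∑ i, hessFun H v y (e i) (e i)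

/-- The covariant Hessian of the restriction of a function to a surface differs from the ambient
one by the second fundamental form. -/
theorem hessFun_comp_surface (hS : SurfaceNear B φ y) (hu : SmoothNear u (φ y))
    (he : IsOrthoFrame (pullbackForm B φ y) e) (v w : Coord 2) :
    hessFun (pullbackForm B φ) (u ∘ φ) y v w
      = hessFun B u (φ y) (fderiv ℝ φ y v) (fderiv ℝ φ y w)
        + fderiv ℝ u (φ y) (sffForm B φ e y v w) := by
  have h1 := congrArg (fun x => fderiv ℝ u (φ y) (fderiv ℝ φ y x))
    (he.sum_eq (levi (pullbackForm B φ) y v w))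
  simp only [map_sum, map_smul] at h1
  rw [hessFun, hessFun, hu.fderiv_fderiv_comp hS.smooth, hu.fderiv_comp hS.smooth, ← h1, sffForm,
    map_sub, map_sum]
  simp only [apply_hessMap_tangent hS.metric hS.smooth hS.induced, map_smul]
  rw [hessMap_apply, map_add]
  ring

/-- The Laplacian of the restriction of `u` to the surface. -/
theorem lapForm_comp_surface (hS : SurfaceNear B φ y) (hu : SmoothNear u (φ y))
    (he : IsOrthoFrame (pullbackForm B φ y) e) :
    lapForm (pullbackForm B φ) (u ∘ φ) e y
      = ∑ i, hessFun B u (φ y) (fderiv ℝ φ y (e i)) (fderiv ℝ φ y (e i))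
        + fderiv ℝ u (φ y) (meanForm B φ e y) := by
  simp only [lapForm, hessFun_comp_surface hS hu he, Finset.sum_add_distrib, meanForm, map_sum]

/-- The component of the gradient of `u` normal to the surface. -/
def normalGrad (B : E → E →L[ℝ] E →L[ℝ] ℝ) (φ : Coord 2 → E) (u : E → ℝ) (e : Fin 2 → Coord 2)
    (y : Coord 2) : E :=
  gradForm B u (φ y) - ∑ i, fderiv ℝ u (φ y) (fderiv ℝ φ y (e i)) • fderiv ℝ φ y (e i)

omit [FiniteDimensional ℝ E] in
/-- An orthonormal frame for `B`, divided by `e^u`, is orthonormal for `e^{2u} B`. -/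
theorem IsOrthoFrame.conformal (he : IsOrthoFrame (pullbackForm B φ y) e) :
    IsOrthoFrame (pullbackForm (conformalForm u B) φ y)
      fun i => Real.exp (-u (φ y)) • e i := by
  intro i j
  have h1 := he i j
  have h2 : Real.exp (2 * u (φ y)) * (Real.exp (-u (φ y)) * Real.exp (-u (φ y))) = 1 := by
    rw [← Real.exp_add, ← Real.exp_add, ← Real.exp_zero]; ring_nf
  simp only [pullbackForm_apply, conformalForm_apply, map_smul, smul_apply, smul_eq_mul] at h1 ⊢
  rw [h1]
  linear_combination (if i = j then (1 : ℝ) else 0) * h2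

/-- The conformal change of the second fundamental form: `α' = α - h ⊗ ν`, with `h` the induced
metric and `ν` the normal part of the gradient of `u`. -/
theorem sffForm_conformal (hS : SurfaceNear B φ y) (hu : SmoothNear u (φ y))
    (he : IsOrthoFrame (pullbackForm B φ y) e) (v w : Coord 2) :
    sffForm (conformalForm u B) φ (fun i => Real.exp (-u (φ y)) • e i) y v w
      = sffForm B φ e y v w - pullbackForm B φ y v w • normalGrad B φ u e y := by
  have h2 : Real.exp (-u (φ y)) * (Real.exp (2 * u (φ y)) * Real.exp (-u (φ y))) = 1 := by
    rw [← Real.exp_add, ← Real.exp_add, ← Real.exp_zero]; ring_nf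
  have hproj (w : Coord 2) : ∑ i, B (φ y) (fderiv ℝ φ y w) (fderiv ℝ φ y (e i)) •
      fderiv ℝ φ y (e i) = fderiv ℝ φ y w := by
    have h1 := congrArg (fderiv ℝ φ y) (he.sum_eq w)
    simp only [map_sum, map_smul, pullbackForm_apply] at h1
    exact h1
  have h3 (Z : E) (i : Fin 2) : conformalForm u B (φ y) Z (fderiv ℝ φ y (Real.exp (-u (φ y)) • e i))
      • fderiv ℝ φ y (Real.exp (-u (φ y)) • e i)
      = B (φ y) Z (fderiv ℝ φ y (e i)) • fderiv ℝ φ y (e i) := by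
    simp only [conformalForm_apply, map_smul, smul_smul, smul_eq_mul]
    congr 1
    linear_combination (B (φ y) Z (fderiv ℝ φ y (e i))) * h2
  have h4 : hessMap (conformalForm u B) φ y v w = hessMap B φ y v w
      + (fderiv ℝ u (φ y) (fderiv ℝ φ y v) • fderiv ℝ φ y w
        + fderiv ℝ u (φ y) (fderiv ℝ φ y w) • fderiv ℝ φ y v
        - pullbackForm B φ y v w • gradForm B u (φ y)) := by
    rw [hessMap_apply, hessMap_apply, levi_conformalForm hS.metric hu, add_assoc]
    rfl
  simp only [sffForm, h3, h4, normalGrad]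
  simp only [map_add, map_sub, map_smul, add_apply, sub_apply, smul_apply, add_smul, sub_smul,
    Finset.sum_add_distrib, Finset.sum_sub_distrib, hS.metric.apply_gradForm, smul_eq_mul, mul_smul,
    ← Finset.smul_sum, hproj, smul_sub]
  abel

omit [FiniteDimensional ℝ E] in
theorem apply_sffForm_tangent (he : IsOrthoFrame (pullbackForm B φ y) e) (v w : Coord 2)
    (i : Fin 2) : B (φ y) (sffForm B φ e y v w) (fderiv ℝ φ y (e i)) = 0 := by
  have h1 (j : Fin 2) : B (φ y) (fderiv ℝ φ y (e j)) (fderiv ℝ φ y (e i))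
      = if j = i then 1 else 0 := he j i
  simp only [sffForm, map_sub, sub_apply, map_sum, sum_apply, map_smul, smul_apply, h1, smul_eq_mul]
  simp

theorem apply_sffForm_normalGrad (hS : SurfaceNear B φ y)
    (he : IsOrthoFrame (pullbackForm B φ y) e) (v w : Coord 2) :
    B (φ y) (sffForm B φ e y v w) (normalGrad B φ u e y)
      = fderiv ℝ u (φ y) (sffForm B φ e y v w) := by
  simp only [normalGrad, map_sub, map_sum, map_smul, apply_sffForm_tangent he, smul_zero,
    Finset.sum_const_zero, sub_zero]
  rw [hS.metric.symm, hS.metric.apply_gradForm]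

theorem apply_normalGrad_self (hS : SurfaceNear B φ y)
    (he : IsOrthoFrame (pullbackForm B φ y) e) :
    B (φ y) (normalGrad B φ u e y) (normalGrad B φ u e y)
      = B (φ y) (gradForm B u (φ y)) (gradForm B u (φ y))
        - ∑ i, fderiv ℝ u (φ y) (fderiv ℝ φ y (e i)) ^ 2 := by
  have h1 (i j : Fin 2) : B (φ y) (fderiv ℝ φ y (e i)) (fderiv ℝ φ y (e j))
      = if i = j then 1 else 0 := he i j
  have h2 (i : Fin 2) : B (φ y) (fderiv ℝ φ y (e i)) (gradForm B u (φ y))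
      = fderiv ℝ u (φ y) (fderiv ℝ φ y (e i)) := by
    rw [hS.metric.symm, hS.metric.apply_gradForm]
  simp only [normalGrad, Fin.sum_univ_two, map_sub, map_add, map_smul, sub_apply, add_apply,
    smul_apply, h1, h2, hS.metric.apply_gradForm, smul_eq_mul]
  simp
  ring

omit [FiniteDimensional ℝ E] in
theorem curv_self (Γ : E → E →L[ℝ] E →L[ℝ] E) (z v x : E) : curv Γ z v v x = 0 := by
  simp [curv]

omit [FiniteDimensional ℝ E] in
theorem curv_smul (Γ : E → E →L[ℝ] E →L[ℝ] E) (a b c : ℝ) (z v w x : E) :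
    curv Γ z (a • v) (b • w) (c • x) = (a * b * c) • curv Γ z v w x := by
  simp only [curv, map_smul, smul_apply]
  module

/-- The conformal change of the exterior scalar curvature. -/
theorem extScalForm_conformal (hS : SurfaceNear B φ y) (hu : SmoothNear u (φ y))
    (he : IsOrthoFrame (pullbackForm B φ y) e) :
    Real.exp (2 * u (φ y))
        * extScalForm (conformalForm u B) φ (fun i => Real.exp (-u (φ y)) • e i) y
      = extScalForm B φ e y
        - 2 * ∑ i, hessFun B u (φ y) (fderiv ℝ φ y (e i)) (fderiv ℝ φ y (e i))
        - 2 * B (φ y) (normalGrad B φ u e y) (normalGrad B φ u e y) := by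
  have h2 : Real.exp (2 * u (φ y)) * Real.exp (2 * u (φ y)) * Real.exp (-u (φ y)) ^ 4 = 1 := by
    rw [← Real.exp_nat_mul, ← Real.exp_add, ← Real.exp_add, ← Real.exp_zero]
    push_cast
    ring_nf
  have h3 (i j : Fin 2) : Real.exp (2 * u (φ y)) * conformalForm u B (φ y)
      (curv (levi (conformalForm u B)) (φ y) (fderiv ℝ φ y (Real.exp (-u (φ y)) • e i))
        (fderiv ℝ φ y (Real.exp (-u (φ y)) • e j)) (fderiv ℝ φ y (Real.exp (-u (φ y)) • e j)))
        (fderiv ℝ φ y (Real.exp (-u (φ y)) • e i))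
      = B (φ y) (curv (levi (conformalForm u B)) (φ y) (fderiv ℝ φ y (e i))
        (fderiv ℝ φ y (e j)) (fderiv ℝ φ y (e j))) (fderiv ℝ φ y (e i)) := by
    simp only [curv_smul, conformalForm_apply, map_smul, smul_apply, smul_eq_mul]
    linear_combination (B (φ y) (curv (levi (conformalForm u B)) (φ y) (fderiv ℝ φ y (e i))
        (fderiv ℝ φ y (e j)) (fderiv ℝ φ y (e j))) (fderiv ℝ φ y (e i))) * h2
  have ho (i j : Fin 2) : B (φ y) (fderiv ℝ φ y (e i)) (fderiv ℝ φ y (e j))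
      = if i = j then 1 else 0 := he i j
  simp only [extScalForm, Finset.mul_sum, h3]
  simp only [Fin.sum_univ_two, curv_self, map_zero, zero_apply, apply_normalGrad_self hS he]
  rw [apply_curv_conformalForm hS.metric hu (by simp [ho]) (by simp [ho]) (by simp [ho]),
    apply_curv_conformalForm hS.metric hu (by simp [ho]) (by simp [ho]) (by simp [ho])]
  ring

theorem meanForm_conformal (hS : SurfaceNear B φ y) (hu : SmoothNear u (φ y))
    (he : IsOrthoFrame (pullbackForm B φ y) e) :
    meanForm (conformalForm u B) φ (fun i => Real.exp (-u (φ y)) • e i) y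
      = Real.exp (-u (φ y)) ^ 2 • (meanForm B φ e y - (2 : ℝ) • normalGrad B φ u e y) := by
  have ho (i : Fin 2) : pullbackForm B φ y (e i) (e i) = 1 := by simp [he _ _]
  have hi (i : Fin 2) : sffForm (conformalForm u B) φ (fun i => Real.exp (-u (φ y)) • e i) y
      (Real.exp (-u (φ y)) • e i) (Real.exp (-u (φ y)) • e i)
      = Real.exp (-u (φ y)) ^ 2 • (sffForm B φ e y (e i) (e i) - normalGrad B φ u e y) := by
    rw [sffForm_smul_left, sffForm_smul_right, sffForm_conformal hS hu he, ho]
    module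
  simp only [meanForm, hi, Fin.sum_univ_two]
  module

/-- The conformal change of the squared mean curvature. -/
theorem meanSqForm_conformal (hS : SurfaceNear B φ y) (hu : SmoothNear u (φ y))
    (he : IsOrthoFrame (pullbackForm B φ y) e) :
    Real.exp (2 * u (φ y))
        * meanSqForm (conformalForm u B) φ (fun i => Real.exp (-u (φ y)) • e i) y
      = meanSqForm B φ e y - 4 * fderiv ℝ u (φ y) (meanForm B φ e y)
        + 4 * B (φ y) (normalGrad B φ u e y) (normalGrad B φ u e y) := by
  have h2 : Real.exp (2 * u (φ y)) * Real.exp (2 * u (φ y)) * Real.exp (-u (φ y)) ^ 4 = 1 := by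
    rw [← Real.exp_nat_mul, ← Real.exp_add, ← Real.exp_add, ← Real.exp_zero]
    push_cast
    ring_nf
  have h3 : B (φ y) (meanForm B φ e y) (normalGrad B φ u e y)
      = fderiv ℝ u (φ y) (meanForm B φ e y) := by
    simp only [meanForm, map_sum, sum_apply, apply_sffForm_normalGrad hS he]
  rw [meanSqForm, meanForm_conformal hS hu he, meanSqForm]
  simp only [conformalForm_apply, map_smul, map_sub, smul_apply, sub_apply, smul_eq_mul,
    hS.metric.symm (normalGrad B φ u e y) (meanForm B φ e y), h3]
  linear_combination (B (φ y) (meanForm B φ e y) (meanForm B φ e y)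
    - 4 * fderiv ℝ u (φ y) (meanForm B φ e y)
    + 4 * B (φ y) (normalGrad B φ u e y) (normalGrad B φ u e y)) * h2

/-- The conformal change of the squared norm of the second fundamental form. -/
theorem sffSqForm_conformal (hS : SurfaceNear B φ y) (hu : SmoothNear u (φ y))
    (he : IsOrthoFrame (pullbackForm B φ y) e) :
    Real.exp (2 * u (φ y))
        * sffSqForm (conformalForm u B) φ (fun i => Real.exp (-u (φ y)) • e i) y
      = sffSqForm B φ e y - 2 * fderiv ℝ u (φ y) (meanForm B φ e y)
        + 2 * B (φ y) (normalGrad B φ u e y) (normalGrad B φ u e y) := by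
  have h2 : Real.exp (2 * u (φ y)) * Real.exp (2 * u (φ y)) * Real.exp (-u (φ y)) ^ 4 = 1 := by
    rw [← Real.exp_nat_mul, ← Real.exp_add, ← Real.exp_add, ← Real.exp_zero]
    push_cast
    ring_nf
  have h3 (v w : Coord 2) : B (φ y) (normalGrad B φ u e y) (sffForm B φ e y v w)
      = fderiv ℝ u (φ y) (sffForm B φ e y v w) := by
    rw [hS.metric.symm, apply_sffForm_normalGrad hS he]
  have h4 (i j : Fin 2) : Real.exp (2 * u (φ y)) * conformalForm u B (φ y)
      (sffForm (conformalForm u B) φ (fun i => Real.exp (-u (φ y)) • e i) y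
        (Real.exp (-u (φ y)) • e i) (Real.exp (-u (φ y)) • e j))
      (sffForm (conformalForm u B) φ (fun i => Real.exp (-u (φ y)) • e i) y
        (Real.exp (-u (φ y)) • e i) (Real.exp (-u (φ y)) • e j))
      = B (φ y) (sffForm B φ e y (e i) (e j)) (sffForm B φ e y (e i) (e j))
        - 2 * (if i = j then 1 else 0) * fderiv ℝ u (φ y) (sffForm B φ e y (e i) (e j))
        + (if i = j then 1 else 0) ^ 2
          * B (φ y) (normalGrad B φ u e y) (normalGrad B φ u e y) := by
    simp only [sffForm_smul_left, sffForm_smul_right, sffForm_conformal hS hu he, he i j,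
      conformalForm_apply, map_smul, map_sub, smul_apply, sub_apply, smul_eq_mul,
      apply_sffForm_normalGrad hS he, h3]
    linear_combination (B (φ y) (sffForm B φ e y (e i) (e j)) (sffForm B φ e y (e i) (e j))
        - 2 * (if i = j then 1 else 0) * fderiv ℝ u (φ y) (sffForm B φ e y (e i) (e j))
        + (if i = j then 1 else 0) ^ 2
          * B (φ y) (normalGrad B φ u e y) (normalGrad B φ u e y)) * h2
  simp only [sffSqForm, Finset.mul_sum, h4]
  simp only [meanForm, Fin.sum_univ_two, map_add]
  simp
  ring

end ConformalSurface

section Divergence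

variable {H : Coord 2 → Coord 2 →L[ℝ] Coord 2 →L[ℝ] ℝ} {v : Coord 2 → ℝ} {y : Coord 2}
  {e e' : Fin 2 → Coord 2}

theorem lapForm_frame (hh : IsInner (H y)) (he : IsOrthoFrame (H y) e)
    (he' : IsOrthoFrame (H y) e') : lapForm H v e y = lapForm H v e' y :=
  he.sum_apply_eq he' hh (LinearMap.mk₂ ℝ (fun a b => hessFun H v y a b)
    (fun _ _ _ => by simp only [hessFun, map_add, add_apply]; ring)
    (fun _ _ _ => by simp only [hessFun, map_smul, smul_apply, smul_eq_mul]; ring)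
    (fun _ _ _ => by simp only [hessFun, map_add]; ring)
    (fun _ _ _ => by simp only [hessFun, map_smul, smul_eq_mul]; ring))

/-- The trace of an endomorphism, computed in an orthonormal frame. -/
theorem IsOrthoFrame.trace_eq {h : Coord 2 →L[ℝ] Coord 2 →L[ℝ] ℝ} (he : IsOrthoFrame h e)
    (A : Coord 2 →L[ℝ] Coord 2) : ∑ i, h (A (e i)) (e i) = ∑ k, A (coordVec k) k := by
  have h1 (k : Fin 2) : A (coordVec k) k = ∑ i, h (coordVec k) (e i) * A (e i) k := by
    conv_lhs => rw [← he.sum_eq (coordVec k)]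
    simp
  simp only [h1]
  rw [Finset.sum_comm]
  refine Finset.sum_congr rfl fun i _ => ?_
  conv_lhs => rw [← sum_smul_coordVec (A (e i))]
  simp only [map_sum, map_smul, sum_apply, smul_apply, smul_eq_mul]
  exact Finset.sum_congr rfl fun _ _ => mul_comm _ _

theorem gramMatrix_det_two (H : Coord 2 → Coord 2 →L[ℝ] Coord 2 →L[ℝ] ℝ) (y : Coord 2) :
    (gramMatrix H y).det = H y (coordVec 0) (coordVec 0) * H y (coordVec 1) (coordVec 1)
      - H y (coordVec 0) (coordVec 1) * H y (coordVec 1) (coordVec 0) := by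
  rw [Matrix.det_fin_two]; rfl

theorem IsInner.gram_pos {h : Coord 2 →L[ℝ] Coord 2 →L[ℝ] ℝ} (hh : IsInner h) :
    0 < h (coordVec 0) (coordVec 0) * h (coordVec 1) (coordVec 1)
      - h (coordVec 0) (coordVec 1) * h (coordVec 1) (coordVec 0) := by
  have h0 := hh.2 _ coordVec_zero_ne
  have h1 := hh.2 _ (gramSchmidt_vec_ne
    (h (coordVec 0) (coordVec 1) / h (coordVec 0) (coordVec 0)))
  simp only [map_sub, map_smul, sub_apply, smul_apply, smul_eq_mul,
    hh.1 (coordVec 1) (coordVec 0)] at h1 ⊢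
  have h2 := mul_pos h0 h1
  field_simp at h2
  nlinarith

theorem MetricNear.gramMatrix_det_pos (hH : MetricNear H y) : 0 < (gramMatrix H y).det := by
  rw [gramMatrix_det_two]; exact hH.isInner.gram_pos

theorem SmoothNear.gramMatrix_det (hH : SmoothNear H y) :
    SmoothNear (fun z => (gramMatrix H z).det) y := by
  filter_upwards [hH] with z hz
  simp only [gramMatrix_det_two]
  fun_prop

/-- The derivative of the area density is given by the trace of the Christoffel tensor. -/
theorem fderiv_sqrt_gramMatrix_det (hH : MetricNear H y) (w : Coord 2) :
    fderiv ℝ (fun z => √(gramMatrix H z).det) y w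
      = √(gramMatrix H y).det * ∑ k, levi H y w (coordVec k) k := by
  have hd := hH.1.differentiableAt
  have hpos := hH.gramMatrix_det_pos
  have hsq := Real.mul_self_sqrt hpos.le
  have hs := Real.sqrt_pos.2 hpos
  have e1 (a b : Fin 2) : fderiv ℝ (fun z => H z (coordVec a) (coordVec b)) y w
      = fderiv ℝ H y w (coordVec a) (coordVec b) := fderiv_const_apply_two hd _ _ _
  have e2 (a : Fin 2) := sum_smul_coordVec (levi H y w (coordVec a))
  have e3 : fderiv ℝ (fun z => (gramMatrix H z).det) y w
      = 2 * (gramMatrix H y).det * ∑ k, levi H y w (coordVec k) k := by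
    simp only [gramMatrix_det_two]
    rw [fderiv_fun_sub (by fun_prop) (by fun_prop), fderiv_fun_mul (by fun_prop) (by fun_prop),
      fderiv_fun_mul (by fun_prop) (by fun_prop)]
    simp only [sub_apply, add_apply, smul_apply, smul_eq_mul, e1, hH.fderiv_eq]
    rw [← e2 0, ← e2 1]
    simp only [Fin.sum_univ_two, map_add, map_smul, add_apply, smul_apply, smul_eq_mul,
      hH.symm (coordVec 1) (coordVec 0)]
    simp [coordVec]
    ring
  rw [fderiv_sqrt hH.1.gramMatrix_det.differentiableAt hpos.ne', smul_apply, e3, smul_eq_mul]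
  field_simp
  linear_combination (-(∑ k, levi H y w (coordVec k) k)) * hsq

/-- The Laplacian in divergence form, `Δv √(det H) = ∑ₖ ∂ₖ(√(det H) (grad v)ᵏ)`. -/
theorem lapForm_eq_divergence (hH : MetricNear H y) (hv : SmoothNear v y)
    (he : IsOrthoFrame (H y) e) :
    lapForm H v e y * √(gramMatrix H y).det
      = ∑ k, fderiv ℝ (fun z => √(gramMatrix H z).det * gradForm H v z k) y (coordVec k) := by
  have hX := (hH.gradForm_smoothNear hv).differentiableAt
  have hv1 := hv.fderiv.differentiableAt
  have hHd := hH.1.differentiableAt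
  have hess (a b : Coord 2) : hessFun H v y a b
      = H y ((fderiv ℝ (gradForm H v) y + (levi H y).flip (gradForm H v y)) a) b := by
    have h1 : (fun z' => H z' (gradForm H v z') b) =ᶠ[𝓝 y] fun z' => fderiv ℝ v z' b := by
      filter_upwards [hH.eventually] with z' h using h.apply_gradForm b
    have h2 := DFunLike.congr_fun (h1.fderiv_eq (𝕜 := ℝ)) a
    rw [fderiv_apply_two hHd hX (by fun_prop), fderiv_apply_one hv1 (by fun_prop),
      hH.fderiv_eq, hH.apply_gradForm] at h2
    simp at h2
    simp only [hessFun, add_apply, map_add, ContinuousLinearMap.flip_apply]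
    linarith
  have hlap : lapForm H v e y
      = ∑ k, (fderiv ℝ (gradForm H v) y + (levi H y).flip (gradForm H v y)) (coordVec k) k := by
    simp only [lapForm, hess]
    exact he.trace_eq _
  have hpos := hH.gramMatrix_det_pos
  have hdd : DifferentiableAt ℝ (fun z => √(gramMatrix H z).det) y :=
    hH.1.gramMatrix_det.differentiableAt.sqrt hpos.ne'
  have hXk (k : Fin 2) (w : Coord 2) : fderiv ℝ (fun z => gradForm H v z k) y w
      = fderiv ℝ (gradForm H v) y w k := by
    change fderiv ℝ (EuclideanSpace.proj (𝕜 := ℝ) k ∘ gradForm H v) y w = _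
    rw [fderiv_comp y (ContinuousLinearMap.differentiableAt _) hX, ContinuousLinearMap.fderiv]
    rfl
  have hXd (k : Fin 2) : DifferentiableAt ℝ (fun z => gradForm H v z k) y :=
    (ContinuousLinearMap.differentiableAt (EuclideanSpace.proj (𝕜 := ℝ) k)).comp y hX
  have hk (k : Fin 2) : fderiv ℝ (fun z => √(gramMatrix H z).det * gradForm H v z k) y (coordVec k)
      = √(gramMatrix H y).det * fderiv ℝ (gradForm H v) y (coordVec k) k
        + gradForm H v y k * fderiv ℝ (fun z => √(gramMatrix H z).det) y (coordVec k) := by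
    rw [fderiv_fun_mul hdd (hXd k)]
    simp [hXk]
  have hsum : ∑ k, gradForm H v y k * fderiv ℝ (fun z => √(gramMatrix H z).det) y (coordVec k)
      = fderiv ℝ (fun z => √(gramMatrix H z).det) y (gradForm H v y) := by
    conv_rhs => rw [← sum_smul_coordVec (gradForm H v y)]
    simp only [map_sum, map_smul, smul_eq_mul]
  rw [Finset.sum_congr rfl fun k _ => hk k, Finset.sum_add_distrib, hsum,
    fderiv_sqrt_gramMatrix_det hH, hlap, ← Finset.mul_sum, ← mul_add, mul_comm,
    ← Finset.sum_add_distrib]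
  simp [hH.levi_symm]

end Divergence

section Continuity

variable {E : Type*} [NormedAddCommGroup E] [NormedSpace ℝ E] [FiniteDimensional ℝ E]
  {B : E → E →L[ℝ] E →L[ℝ] ℝ} {φ : Coord 2 → E} {y : Coord 2} {e : Coord 2 → Fin 2 → Coord 2}

theorem continuousAt_sffForm (hS : SurfaceNear B φ y) {a b : Coord 2 → Coord 2}
    (he : ∀ i, ContinuousAt (fun z => e z i) y) (ha : ContinuousAt a y) (hb : ContinuousAt b y) :
    ContinuousAt (fun z => sffForm B φ (e z) z (a z) (b z)) y := by
  have h1 := hS.smooth.fderiv.continuousAt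
  have h2 := hS.smooth.fderiv.fderiv.continuousAt
  have h3 : ContinuousAt (fun z => levi B (φ z)) y :=
    (hS.metric.levi_smoothNear.comp hS.smooth).continuousAt
  have h4 : ContinuousAt (fun z => B (φ z)) y := (hS.metric.1.comp hS.smooth).continuousAt
  have h5 : ContinuousAt (fun z => hessMap B φ z (a z) (b z)) y :=
    ((h2.clm_apply ha).clm_apply hb).add
      ((h3.clm_apply (h1.clm_apply ha)).clm_apply (h1.clm_apply hb))
  have h6 (i : Fin 2) := h1.clm_apply (he i)
  have h7 (i : Fin 2) := ((h4.clm_apply h5).clm_apply (h6 i)).smul (h6 i)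
  simp only [sffForm, Fin.sum_univ_two]
  exact h5.sub ((h7 0).add (h7 1))

theorem continuousAt_meanSqForm (hS : SurfaceNear B φ y)
    (he : ∀ i, ContinuousAt (fun z => e z i) y) :
    ContinuousAt (fun z => meanSqForm B φ (e z) z) y := by
  have h4 : ContinuousAt (fun z => B (φ z)) y := (hS.metric.1.comp hS.smooth).continuousAt
  have h5 (i : Fin 2) := continuousAt_sffForm hS he (he i) (he i)
  simp only [meanSqForm, meanForm, Fin.sum_univ_two]
  exact (h4.clm_apply ((h5 0).add (h5 1))).clm_apply ((h5 0).add (h5 1))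

theorem continuousAt_sffSqForm (hS : SurfaceNear B φ y)
    (he : ∀ i, ContinuousAt (fun z => e z i) y) :
    ContinuousAt (fun z => sffSqForm B φ (e z) z) y := by
  have h4 : ContinuousAt (fun z => B (φ z)) y := (hS.metric.1.comp hS.smooth).continuousAt
  have h5 (i j : Fin 2) := continuousAt_sffForm hS he (he i) (he j)
  have h6 (i j : Fin 2) := (h4.clm_apply (h5 i j)).clm_apply (h5 i j)
  simp only [sffSqForm, Fin.sum_univ_two]
  exact ((h6 0 0).add (h6 0 1)).add ((h6 1 0).add (h6 1 1))

theorem continuousAt_extScalForm (hS : SurfaceNear B φ y)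
    (he : ∀ i, ContinuousAt (fun z => e z i) y) :
    ContinuousAt (fun z => extScalForm B φ (e z) z) y := by
  have h1 := hS.smooth.fderiv.continuousAt
  have h2 : ContinuousAt (fun z => fderiv ℝ (levi B) (φ z)) y :=
    (hS.metric.levi_smoothNear.fderiv.comp hS.smooth).continuousAt
  have h3 : ContinuousAt (fun z => levi B (φ z)) y :=
    (hS.metric.levi_smoothNear.comp hS.smooth).continuousAt
  have h4 : ContinuousAt (fun z => B (φ z)) y := (hS.metric.1.comp hS.smooth).continuousAt
  have h5 (i : Fin 2) := h1.clm_apply (he i)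
  have h6 (i j : Fin 2) : ContinuousAt (fun z => curv (levi B) (φ z) (fderiv ℝ φ z (e z i))
      (fderiv ℝ φ z (e z j)) (fderiv ℝ φ z (e z j))) y :=
    ((((h2.clm_apply (h5 i)).clm_apply (h5 j)).clm_apply (h5 j)).sub
      (((h2.clm_apply (h5 j)).clm_apply (h5 i)).clm_apply (h5 j))).add
    (((h3.clm_apply (h5 i)).clm_apply ((h3.clm_apply (h5 j)).clm_apply (h5 j))).sub
      ((h3.clm_apply (h5 j)).clm_apply ((h3.clm_apply (h5 i)).clm_apply (h5 j))))
  have h7 (i j : Fin 2) := (h4.clm_apply (h6 i j)).clm_apply (h5 i)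
  simp only [extScalForm, Fin.sum_univ_two]
  exact ((h7 0 0).add (h7 0 1)).add ((h7 1 0).add (h7 1 1))

theorem continuousAt_lapForm {H : Coord 2 → Coord 2 →L[ℝ] Coord 2 →L[ℝ] ℝ} {v : Coord 2 → ℝ}
    (hH : MetricNear H y) (hv : SmoothNear v y) (he : ∀ i, ContinuousAt (fun z => e z i) y) :
    ContinuousAt (fun z => lapForm H v (e z) z) y := by
  have h1 := hv.fderiv.continuousAt
  have h2 := hv.fderiv.fderiv.continuousAt
  have h3 := hH.levi_smoothNear.continuousAt
  simp only [lapForm, hessFun]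
  fun_prop

end Continuity

/-! ### Charts: from manifolds to vector spaces -/

section Charts

variable {k m n : ℕ} {P : Type*} [TopologicalSpace P] [ChartedSpace (Coord k) P]
  {N : Type*} [TopologicalSpace N] [ChartedSpace (Coord m) N]
  {M : Type*} [TopologicalSpace M] [ChartedSpace (Coord n) M]

/-- The derivative of `f` at `x`, as a map of coordinate spaces. All tangent spaces of an
`n`-manifold are copies of `ℝⁿ`; forgetting the base points avoids transports between them. -/
def coordDeriv (m n : ℕ) {N : Type*} [TopologicalSpace N] [ChartedSpace (Coord m) N]
    {M : Type*} [TopologicalSpace M] [ChartedSpace (Coord n) M] (f : N → M) (x : N) :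
    Coord m →L[ℝ] Coord n := mfderiv (𝓡 m) (𝓡 n) f x

/-- The value of `g` at `x`, as a bilinear form on the coordinate space. -/
def coordForm (g : BilinField n M) (x : M) : Coord n →L[ℝ] Coord n →L[ℝ] ℝ := g x

theorem coordDeriv_comp {f : N → M} {h : P → N} {x : P}
    (hf : MDifferentiableAt (𝓡 m) (𝓡 n) f (h x)) (hh : MDifferentiableAt (𝓡 k) (𝓡 m) h x)
    (v : Coord k) : coordDeriv k n (f ∘ h) x v = coordDeriv m n f (h x) (coordDeriv k m h x v) :=
  mfderiv_comp_apply x hf hh v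

theorem coordDeriv_congr {f f' : N → M} {x : N} (h : f =ᶠ[𝓝 x] f') :
    coordDeriv m n f x = coordDeriv m n f' x := h.mfderiv_eq

theorem coordDeriv_eq_fderiv (f : Coord m → Coord n) (x : Coord m) :
    coordDeriv m n f x = fderiv ℝ f x := mfderiv_eq_fderiv

theorem coordForm_pullbackMetric (g : BilinField n M) (f : N → M) (x : N) (v w : Coord m) :
    coordForm (pullbackMetric (m := m) g f) x v w
      = coordForm g (f x) (coordDeriv m n f x v) (coordDeriv m n f x w) := rfl

/-- A tangent vector, as an element of the coordinate space. -/
def toCoord {x : M} (v : TangentSpace (𝓡 n) x) : Coord n := v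

theorem coordForm_conformalMetric (g : BilinField n M) (u : M → ℝ) (x : M) (v w : Coord n) :
    coordForm (conformalMetric u g) x v w = Real.exp (2 * u x) * coordForm g x v w := rfl

/-- The metric `g` in the preferred chart around `p`. -/
def localMetric (g : BilinField n M) (p : M) : Coord n → Coord n →L[ℝ] Coord n →L[ℝ] ℝ :=
  coordForm (pullbackMetric (N := Coord n) g (extChartAt (𝓡 n) p).symm)

theorem localMetric_apply (g : BilinField n M) (p : M) (y v w : Coord n) :
    localMetric g p y v w = coordForm g ((extChartAt (𝓡 n) p).symm y)
      (coordDeriv n n (extChartAt (𝓡 n) p).symm y v)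
      (coordDeriv n n (extChartAt (𝓡 n) p).symm y w) := rfl

theorem localMetric_conformalMetric (g : BilinField n M) (u : M → ℝ) (p : M) :
    localMetric (conformalMetric u g) p
      = conformalForm (u ∘ (extChartAt (𝓡 n) p).symm) (localMetric g p) := rfl

theorem target_mem_nhds {p : M} {y : Coord n} (hy : y ∈ (extChartAt (𝓡 n) p).target) :
    (extChartAt (𝓡 n) p).target ∈ 𝓝 y := extChartAt_target_mem_nhds' hy

theorem source_mem_nhds {p x : M} (hx : x ∈ (extChartAt (𝓡 n) p).source) :
    (extChartAt (𝓡 n) p).source ∈ 𝓝 x := (isOpen_extChartAt_source p).mem_nhds hx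

theorem continuousAt_symm {p : M} {y : Coord n} (hy : y ∈ (extChartAt (𝓡 n) p).target) :
    ContinuousAt (extChartAt (𝓡 n) p).symm y := continuousAt_extChartAt_symm'' hy

/-- The expression of `f` in the preferred charts around `p` and `q`. -/
def coordMap (m n : ℕ) {N : Type*} [TopologicalSpace N] [ChartedSpace (Coord m) N]
    {M : Type*} [TopologicalSpace M] [ChartedSpace (Coord n) M] (f : N → M) (p : N)
    (q : M) : Coord m → Coord n :=
  extChartAt (𝓡 n) q ∘ f ∘ (extChartAt (𝓡 m) p).symm

variable [IsManifold (𝓡 m) ∞ N] [IsManifold (𝓡 n) ∞ M] [IsManifold (𝓡 k) ∞ P]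

theorem contMDiffAt_symm {p : M} {y : Coord n} (hy : y ∈ (extChartAt (𝓡 n) p).target) :
    ContMDiffAt (𝓡 n) (𝓡 n) ∞ (extChartAt (𝓡 n) p).symm y :=
  (contMDiffOn_extChartAt_symm p).contMDiffAt (target_mem_nhds hy)

theorem contMDiffAt_chart {p x : M} (hx : x ∈ (extChartAt (𝓡 n) p).source) :
    ContMDiffAt (𝓡 n) (𝓡 n) ∞ (extChartAt (𝓡 n) p) x :=
  contMDiffAt_extChartAt' (by rwa [extChartAt_source] at hx)

theorem coordMap_smoothNear {f : N → M} (hf : ContMDiff (𝓡 m) (𝓡 n) ∞ f) {p : N} {q : M}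
    {y : Coord m} (hy : y ∈ (extChartAt (𝓡 m) p).target)
    (hq : f ((extChartAt (𝓡 m) p).symm y) ∈ (extChartAt (𝓡 n) q).source) :
    SmoothNear (coordMap m n f p q) y := by
  have hc : ContinuousAt (fun z => f ((extChartAt (𝓡 m) p).symm z)) y :=
    (hf.continuous.continuousAt).comp (continuousAt_symm hy)
  filter_upwards [target_mem_nhds hy, hc.eventually (source_mem_nhds hq)] with z h1 h2
  exact ((contMDiffAt_chart h2).comp z ((hf.contMDiffAt).comp z (contMDiffAt_symm h1))).contDiffAt

theorem smoothNear_comp_symm {u : M → ℝ} (hu : ContMDiff (𝓡 n) 𝓘(ℝ, ℝ) ∞ u) {p : M} {y : Coord n}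
    (hy : y ∈ (extChartAt (𝓡 n) p).target) : SmoothNear (u ∘ (extChartAt (𝓡 n) p).symm) y := by
  filter_upwards [target_mem_nhds hy] with z h1
  exact (hu.contMDiffAt.comp z (contMDiffAt_symm h1)).contDiffAt

omit [IsManifold (𝓡 m) ∞ N] [IsManifold (𝓡 n) ∞ M] in
theorem symm_coordMap {f : N → M} {p : N} {q : M} {y : Coord m}
    (hq : f ((extChartAt (𝓡 m) p).symm y) ∈ (extChartAt (𝓡 n) q).source) :
    (extChartAt (𝓡 n) q).symm (coordMap m n f p q y) = f ((extChartAt (𝓡 m) p).symm y) :=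
  (extChartAt (𝓡 n) q).left_inv hq

/-- The pullback of a metric under a smooth map, in charts. -/
theorem localMetric_pullbackMetric (g : BilinField n M) {f : N → M}
    (hf : ContMDiff (𝓡 m) (𝓡 n) ∞ f) {p : N} {q : M} {y : Coord m}
    (hy : y ∈ (extChartAt (𝓡 m) p).target)
    (hq : f ((extChartAt (𝓡 m) p).symm y) ∈ (extChartAt (𝓡 n) q).source) :
    localMetric (pullbackMetric (m := m) g f) p y
      = pullbackForm (localMetric g q) (coordMap m n f p q) y := by
  have hφ := coordMap_smoothNear hf hy hq
  have hz : coordMap m n f p q y ∈ (extChartAt (𝓡 n) q).target := (extChartAt (𝓡 n) q).map_source hq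
  have hc : ContinuousAt (fun z => f ((extChartAt (𝓡 m) p).symm z)) y :=
    (hf.continuous.continuousAt).comp (continuousAt_symm hy)
  have h1 : (extChartAt (𝓡 n) q).symm ∘ coordMap m n f p q
      =ᶠ[𝓝 y] f ∘ (extChartAt (𝓡 m) p).symm := by
    filter_upwards [hc.eventually (source_mem_nhds hq)] with z h2 using symm_coordMap h2
  have h2 (v : Coord m) : coordDeriv n n (extChartAt (𝓡 n) q).symm (coordMap m n f p q y)
      (fderiv ℝ (coordMap m n f p q) y v)
      = coordDeriv m n f ((extChartAt (𝓡 m) p).symm y)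
        (coordDeriv m m (extChartAt (𝓡 m) p).symm y v) := by
    rw [← coordDeriv_comp (hf.contMDiffAt.mdifferentiableAt (by simp))
      ((contMDiffAt_symm hy).mdifferentiableAt (by simp)), ← coordDeriv_congr h1,
      coordDeriv_comp ((contMDiffAt_symm hz).mdifferentiableAt (by simp))
        hφ.differentiableAt.mdifferentiableAt, coordDeriv_eq_fderiv]
  ext v w
  rw [localMetric_apply, coordForm_pullbackMetric, pullbackForm_apply, localMetric_apply,
    symm_coordMap hq, h2, h2]

omit [IsManifold (𝓡 n) ∞ M] in
theorem pullbackMetric_id (g : BilinField n M) : pullbackMetric g (id : M → M) = g := by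
  funext x
  ext v w
  rw [pullbackMetric_apply, mfderiv_id]
  rfl

theorem coordDeriv_symm_injective {p : M} {y : Coord n} (hy : y ∈ (extChartAt (𝓡 n) p).target) :
    Function.Injective (coordDeriv n n (extChartAt (𝓡 n) p).symm y) := by
  have h := isInvertible_mfderivWithin_extChartAt_symm (I := 𝓡 n) hy
  rw [ModelWithCorners.range_eq_univ, mfderivWithin_univ] at h
  exact h.injective

/-- The tangent space at `p` is the coordinate space of the preferred chart around `p`, so that the
derivative of this chart at `p` is the identity. -/
theorem coordDeriv_symm_self (p : M) : coordDeriv n n (extChartAt (𝓡 n) p).symm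
    (extChartAt (𝓡 n) p p) = ContinuousLinearMap.id ℝ _ := by
  have h := mfderivWithin_range_extChartAt_symm (I := 𝓡 n) (x := p)
  rw [ModelWithCorners.range_eq_univ, mfderivWithin_univ] at h
  exact h

theorem localMetric_self (g : BilinField n M) (p : M) :
    localMetric g p (extChartAt (𝓡 n) p p) = coordForm g p := by
  ext v w
  rw [localMetric_apply, coordDeriv_symm_self, extChartAt_to_inv]
  rfl

omit [IsManifold (𝓡 m) ∞ N] [IsManifold (𝓡 n) ∞ M] in
theorem coordDeriv_eq_coordMap {f : N → M} {x : N} (hf : MDifferentiableAt (𝓡 m) (𝓡 n) f x) :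
    coordDeriv m n f x = fderiv ℝ (coordMap m n f x (f x)) (extChartAt (𝓡 m) x x) := by
  rw [coordDeriv, hf.mfderiv, ModelWithCorners.range_eq_univ, fderivWithin_univ]
  rfl

/-- `g` is a smooth Riemannian metric, in terms of its expressions in charts. -/
structure IsSmoothMetric (g : BilinField n M) : Prop where
  symm : ∀ x v w, coordForm g x v w = coordForm g x w v
  pos : ∀ x v, v ≠ 0 → 0 < coordForm g x v v
  smooth : ∀ p, ∀ y ∈ (extChartAt (𝓡 n) p).target, SmoothNear (localMetric g p) y

theorem IsSmoothMetric.metricNear {g : BilinField n M} (hg : IsSmoothMetric g) {p : M}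
    {y : Coord n} (hy : y ∈ (extChartAt (𝓡 n) p).target) : MetricNear (localMetric g p) y := by
  refine ⟨hg.smooth p y hy, ?_⟩
  filter_upwards [target_mem_nhds hy] with z hz
  refine ⟨fun v w => hg.symm _ _ _, fun v hv => hg.pos _ _ fun h => hv ?_⟩
  exact coordDeriv_symm_injective hz (h.trans (map_zero _).symm)

theorem IsSmoothMetric.conformal {g : BilinField n M} (hg : IsSmoothMetric g) {u : M → ℝ}
    (hu : ContMDiff (𝓡 n) 𝓘(ℝ, ℝ) ∞ u) : IsSmoothMetric (conformalMetric u g) where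
  symm x v w := by rw [coordForm_conformalMetric, coordForm_conformalMetric, hg.symm]
  pos x v hv := by
    have := hg.pos x v hv
    rw [coordForm_conformalMetric]
    positivity
  smooth p y hy := by
    rw [localMetric_conformalMetric]
    exact ((hg.metricNear hy).conformalForm (smoothNear_comp_symm hu hy)).1

/-- The pullback of a smooth metric under a smooth map is a smooth metric if it is positive. -/
theorem IsSmoothMetric.pullback {g : BilinField n M} (hg : IsSmoothMetric g) {f : N → M}
    (hf : ContMDiff (𝓡 m) (𝓡 n) ∞ f)
    (hpos : ∀ x v, v ≠ 0 → 0 < coordForm (pullbackMetric (m := m) g f) x v v) :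
    IsSmoothMetric (pullbackMetric (m := m) g f) where
  symm x v w := hg.symm _ _ _
  pos := hpos
  smooth p y hy := by
    set q := f ((extChartAt (𝓡 m) p).symm y) with hqd
    have hq : f ((extChartAt (𝓡 m) p).symm y) ∈ (extChartAt (𝓡 n) q).source :=
      mem_extChartAt_source q
    have hz : coordMap m n f p q y ∈ (extChartAt (𝓡 n) q).target :=
      (extChartAt (𝓡 n) q).map_source hq
    have hc : ContinuousAt (fun z => f ((extChartAt (𝓡 m) p).symm z)) y :=
      (hf.continuous.continuousAt).comp (continuousAt_symm hy)
    refine ((hg.smooth q _ hz).pullbackForm (coordMap_smoothNear hf hy hq)).congr ?_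
    filter_upwards [target_mem_nhds hy, hc.eventually (source_mem_nhds hq)] with z h1 h2
    exact localMetric_pullbackMetric g hf h1 h2

end Charts

section SurfaceInManifold

variable {S : Type*} [TopologicalSpace S] [ChartedSpace (Coord 2) S] [IsManifold (𝓡 2) ∞ S]
  {n : ℕ} {M : Type*} [TopologicalSpace M] [ChartedSpace (Coord n) M] [IsManifold (𝓡 n) ∞ M]

omit [IsManifold (𝓡 2) ∞ S] [IsManifold (𝓡 n) ∞ M] in
theorem coordMap_self (f : S → M) (x : S) :
    coordMap 2 n f x (f x) (extChartAt (𝓡 2) x x) = extChartAt (𝓡 n) (f x) (f x) := by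
  simp [coordMap]

omit [IsManifold (𝓡 2) ∞ S] in
theorem localMetric_coordMap_self (g : BilinField n M) (f : S → M) (x : S) :
    localMetric g (f x) (coordMap 2 n f x (f x) (extChartAt (𝓡 2) x x)) = coordForm g (f x) := by
  rw [coordMap_self, localMetric_self]

/-- `f` is a smooth immersion of the surface `S` into `M`, with smooth metric `g`; the immersion
property is stated as the positivity of the induced metric. -/
structure IsSurface (g : BilinField n M) (f : S → M) : Prop where
  metric : IsSmoothMetric g
  smooth : ContMDiff (𝓡 2) (𝓡 n) ∞ f
  induced : IsSmoothMetric (pullbackMetric (m := 2) g f)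

variable {g : BilinField n M} {f : S → M}

theorem IsSurface.surfaceNear (h : IsSurface g f) {p : S} {q : M} {y : Coord 2}
    (hy : y ∈ (extChartAt (𝓡 2) p).target)
    (hq : f ((extChartAt (𝓡 2) p).symm y) ∈ (extChartAt (𝓡 n) q).source) :
    SurfaceNear (localMetric g q) (coordMap 2 n f p q) y := by
  have hc : ContinuousAt (fun z => f ((extChartAt (𝓡 2) p).symm z)) y :=
    (h.smooth.continuous.continuousAt).comp (continuousAt_symm hy)
  refine ⟨h.metric.metricNear ((extChartAt (𝓡 n) q).map_source hq),
    coordMap_smoothNear h.smooth hy hq, (h.induced.metricNear hy).congr ?_⟩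
  filter_upwards [target_mem_nhds hy, hc.eventually (source_mem_nhds hq)] with z h1 h2
  exact (localMetric_pullbackMetric g h.smooth h1 h2).symm

/-- The Gram-Schmidt frame at the point of coordinates `y` in the charts around `p` and `q`. -/
def chartFrame (g : BilinField n M) (f : S → M) (p : S) (q : M) (y : Coord 2) : Fin 2 → Coord 2 :=
  orthoFrame (pullbackForm (localMetric g q) (coordMap 2 n f p q) y)

omit [IsManifold (𝓡 2) ∞ S] [IsManifold (𝓡 n) ∞ M] in
theorem SurfaceNear.isOrthoFrame_chartFrame {p : S} {q : M} {y : Coord 2}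
    (h : SurfaceNear (localMetric g q) (coordMap 2 n f p q) y) :
    IsOrthoFrame (pullbackForm (localMetric g q) (coordMap 2 n f p q) y) (chartFrame g f p q y) :=
  isOrthoFrame_orthoFrame h.induced.isInner

omit [IsManifold (𝓡 2) ∞ S] [IsManifold (𝓡 n) ∞ M] in
theorem SurfaceNear.continuousAt_chartFrame {p : S} {q : M} {y : Coord 2}
    (h : SurfaceNear (localMetric g q) (coordMap 2 n f p q) y) (i : Fin 2) :
    ContinuousAt (fun z => chartFrame g f p q z i) y :=
  (orthoFrame_smoothNear h.induced.1 h.induced.2 i).continuousAt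

section Pointwise

variable (h : IsSurface g f) (x : S)
include h

theorem IsSurface.surfaceNear_self :
    SurfaceNear (localMetric g (f x)) (coordMap 2 n f x (f x)) (extChartAt (𝓡 2) x x) :=
  h.surfaceNear (mem_extChartAt_target x) (by
    rw [extChartAt_to_inv]; exact mem_extChartAt_source _)

omit [IsManifold (𝓡 2) ∞ S] [IsManifold (𝓡 n) ∞ M] in
theorem IsSurface.mdifferentiableAt : MDifferentiableAt (𝓡 2) (𝓡 n) f x :=
  h.smooth.contMDiffAt.mdifferentiableAt (by simp)

omit [IsManifold (𝓡 2) ∞ S] in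
theorem IsSurface.pullbackMetric_eq : coordForm (pullbackMetric (m := 2) g f) x
    = pullbackForm (localMetric g (f x)) (coordMap 2 n f x (f x)) (extChartAt (𝓡 2) x x) := by
  ext v w
  rw [pullbackForm_apply, localMetric_coordMap_self, coordForm_pullbackMetric,
    coordDeriv_eq_coordMap (h.mdifferentiableAt x)]

omit [IsManifold (𝓡 2) ∞ S] in
theorem IsSurface.orthoFrame_eq : orthoFrame (pullbackMetric (m := 2) g f x)
    = chartFrame g f x (f x) (extChartAt (𝓡 2) x x) :=
  congrArg orthoFrame (h.pullbackMetric_eq x)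

omit [IsManifold (𝓡 2) ∞ S] in
theorem IsSurface.tangentFrame_eq (i : Fin 2) : toCoord (tangentFrame g f x i)
    = fderiv ℝ (coordMap 2 n f x (f x)) (extChartAt (𝓡 2) x x)
        (chartFrame g f x (f x) (extChartAt (𝓡 2) x x) i) := by
  rw [← coordDeriv_eq_coordMap (h.mdifferentiableAt x), ← h.orthoFrame_eq]
  rfl

theorem IsSurface.covHessian_eq (v w : Coord 2) : toCoord (covHessian g f x v w)
    = hessMap (localMetric g (f x)) (coordMap 2 n f x (f x)) (extChartAt (𝓡 2) x x) v w := by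
  rw [hessMap_apply, (h.surfaceNear_self x).metric.levi_eq_sum]
  rfl

theorem IsSurface.secondFundamentalForm_eq (v w : Coord 2) :
    toCoord (secondFundamentalForm g f x v w)
    = sffForm (localMetric g (f x)) (coordMap 2 n f x (f x))
        (chartFrame g f x (f x) (extChartAt (𝓡 2) x x)) (extChartAt (𝓡 2) x x) v w := by
  rw [sffForm, localMetric_coordMap_self, ← h.covHessian_eq]
  simp only [← h.tangentFrame_eq x]
  rfl

theorem IsSurface.meanCurvature_eq : toCoord (meanCurvature g f x)
    = meanForm (localMetric g (f x)) (coordMap 2 n f x (f x))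
        (chartFrame g f x (f x) (extChartAt (𝓡 2) x x)) (extChartAt (𝓡 2) x x) := by
  rw [meanForm]
  simp only [← h.secondFundamentalForm_eq x]
  simp only [← h.orthoFrame_eq x]
  rfl

theorem IsSurface.meanCurvatureSq_eq_self : meanCurvatureSq g f x
    = meanSqForm (localMetric g (f x)) (coordMap 2 n f x (f x))
        (chartFrame g f x (f x) (extChartAt (𝓡 2) x x)) (extChartAt (𝓡 2) x x) := by
  rw [meanSqForm, localMetric_coordMap_self, ← h.meanCurvature_eq]
  rfl

theorem IsSurface.secondFundamentalFormSq_eq_self : secondFundamentalFormSq g f x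
    = sffSqForm (localMetric g (f x)) (coordMap 2 n f x (f x))
        (chartFrame g f x (f x) (extChartAt (𝓡 2) x x)) (extChartAt (𝓡 2) x x) := by
  rw [sffSqForm, localMetric_coordMap_self]
  simp only [← h.secondFundamentalForm_eq x]
  simp only [← h.orthoFrame_eq x]
  rfl

theorem IsSurface.exteriorScalarCurvature_eq_self : exteriorScalarCurvature g f x
    = extScalForm (localMetric g (f x)) (coordMap 2 n f x (f x))
        (chartFrame g f x (f x) (extChartAt (𝓡 2) x x)) (extChartAt (𝓡 2) x x) := by
  have hS := h.surfaceNear_self x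
  have ho := hS.isOrthoFrame_chartFrame
  set y := extChartAt (𝓡 2) x x with hy
  set φ := coordMap 2 n f x (f x) with hφ
  set e := chartFrame g f x (f x) y with he
  have hB : localMetric g (f x) (φ y) = coordForm g (f x) := localMetric_coordMap_self g f x
  have htf (i : Fin 2) : toCoord (tangentFrame g f x i) = fderiv ℝ φ y (e i) :=
    h.tangentFrame_eq x i
  refine Finset.sum_congr rfl fun i _ => Finset.sum_congr rfl fun j _ => ?_
  have hcurv (a b c : Coord n) : toCoord (curvatureTensor g (f x) a b c)
      = curv (levi (localMetric g (f x))) (φ y) a b c := by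
    rw [hS.metric.curv_eq_sum, hφ, hy, coordMap_self]
    rfl
  change coordForm g (f x) (toCoord (curvatureTensor g (f x) (toCoord (tangentFrame g f x i))
      (toCoord (tangentFrame g f x j)) (toCoord (tangentFrame g f x j))))
      (toCoord (tangentFrame g f x i))
    / (coordForm g (f x) (toCoord (tangentFrame g f x i)) (toCoord (tangentFrame g f x i))
      * coordForm g (f x) (toCoord (tangentFrame g f x j)) (toCoord (tangentFrame g f x j))
      - coordForm g (f x) (toCoord (tangentFrame g f x i)) (toCoord (tangentFrame g f x j)) ^ 2) = _
  rw [htf, htf, hcurv, ← hB]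
  have ho' (i j : Fin 2) : localMetric g (f x) (φ y) (fderiv ℝ φ y (e i)) (fderiv ℝ φ y (e j))
      = if i = j then 1 else 0 := ho i j
  simp only [ho']
  by_cases hij : i = j
  · subst hij
    simp [curv_self]
  · simp [hij]

end Pointwise

end SurfaceInManifold

/-! ### Invariance under isometries, and the conformal change of the integrands -/

section Invariance

variable {S : Type*} [TopologicalSpace S] [ChartedSpace (Coord 2) S] [IsManifold (𝓡 2) ∞ S]
  {n : ℕ} {M : Type*} [TopologicalSpace M] [ChartedSpace (Coord n) M] [IsManifold (𝓡 n) ∞ M]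
  {M' : Type*} [TopologicalSpace M'] [ChartedSpace (Coord n) M'] [IsManifold (𝓡 n) ∞ M']
  {g : BilinField n M} {g' : BilinField n M'} {f : S → M} {F : M → M'}

omit [IsManifold (𝓡 2) ∞ S] [IsManifold (𝓡 n) ∞ M] in
theorem coordMap_chart {p : S} {q : M} {x : S} (hx : x ∈ (extChartAt (𝓡 2) p).source) :
    coordMap 2 n f p q (extChartAt (𝓡 2) p x) = extChartAt (𝓡 n) q (f x) := by
  simp only [coordMap, Function.comp_apply, (extChartAt (𝓡 2) p).left_inv hx]

theorem MetricNear.surjective_fderiv {E : Type*} [NormedAddCommGroup E] [NormedSpace ℝ E]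
    [FiniteDimensional ℝ E] {B : E → E →L[ℝ] E →L[ℝ] ℝ} {ψ : E → E} {z : E}
    (h : MetricNear (pullbackForm B ψ) z) : Function.Surjective (fderiv ℝ ψ z) := by
  refine LinearMap.injective_iff_surjective (f := (fderiv ℝ ψ z).toLinearMap) |>.1 ?_
  refine (injective_iff_map_eq_zero _).2 fun v hv => ?_
  by_contra hne
  have h1 := h.pos hne
  have h2 : fderiv ℝ ψ z v = 0 := hv
  simp [h2] at h1

/-- A map which pulls back a metric to a metric is, in charts, a local isometry with surjective
derivative. -/
theorem coordMap_surjective_fderiv (hg : IsSmoothMetric g) (hF : ContMDiff (𝓡 n) (𝓡 n) ∞ F)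
    (hgF : g = pullbackMetric (m := n) g' F) {q : M} {q' : M'} {z : Coord n}
    (hz : z ∈ (extChartAt (𝓡 n) q).target)
    (hq' : F ((extChartAt (𝓡 n) q).symm z) ∈ (extChartAt (𝓡 n) q').source) :
    (∀ᶠ w in 𝓝 z, Function.Surjective (fderiv ℝ (coordMap n n F q q') w)) ∧
      localMetric g q =ᶠ[𝓝 z] pullbackForm (localMetric g' q') (coordMap n n F q q') := by
  have hc : ContinuousAt (fun w => F ((extChartAt (𝓡 n) q).symm w)) z :=
    (hF.continuous.continuousAt).comp (continuousAt_symm hz)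
  have hiso : localMetric g q =ᶠ[𝓝 z]
      pullbackForm (localMetric g' q') (coordMap n n F q q') := by
    filter_upwards [target_mem_nhds hz, hc.eventually (source_mem_nhds hq')] with w h1 h2
    rw [hgF]
    exact localMetric_pullbackMetric g' hF h1 h2
  refine ⟨?_, hiso⟩
  filter_upwards [((hg.metricNear hz).congr hiso.symm).eventually] with w h1
    using h1.surjective_fderiv

/-- A surface `f` in `M` and its image under a local isometry `F`, in arbitrary charts. -/
theorem IsSurface.sameSurface (h : IsSurface g f) (h' : IsSurface g' (F ∘ f))
    (hF : ContMDiff (𝓡 n) (𝓡 n) ∞ F) (hgF : g = pullbackMetric (m := n) g' F)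
    {x p p' : S} {q : M} {q' : M'} (hp : x ∈ (extChartAt (𝓡 2) p).source)
    (hp' : x ∈ (extChartAt (𝓡 2) p').source) (hq : f x ∈ (extChartAt (𝓡 n) q).source)
    (hq' : F (f x) ∈ (extChartAt (𝓡 n) q').source) :
    SameSurface (localMetric g q) (coordMap 2 n f p q) (localMetric g' q')
      (coordMap 2 n (F ∘ f) p' q') (coordMap n n F q q') (coordMap 2 2 id p' p)
      (extChartAt (𝓡 2) p' x) := by
  have hκ : coordMap 2 2 id p' p (extChartAt (𝓡 2) p' x) = extChartAt (𝓡 2) p x :=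
    coordMap_chart hp'
  have hφ : coordMap 2 n f p q (extChartAt (𝓡 2) p x) = extChartAt (𝓡 n) q (f x) :=
    coordMap_chart hp
  have hy := (extChartAt (𝓡 2) p).map_source hp
  have hy' := (extChartAt (𝓡 2) p').map_source hp'
  have hz := (extChartAt (𝓡 n) q).map_source hq
  have hi := (extChartAt (𝓡 2) p).left_inv hp
  have hi' := (extChartAt (𝓡 2) p').left_inv hp'
  have hj := (extChartAt (𝓡 n) q).left_inv hq
  have hsur := coordMap_surjective_fderiv h.metric hF hgF hz (q' := q') (by rwa [hj])
  refine ⟨?_, ?_, ?_, ?_, ?_, ?_, ?_⟩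
  · rw [hκ]
    exact h.surfaceNear hy (by rwa [hi])
  · exact h'.surfaceNear hy' (by rwa [hi'])
  · rw [hκ, hφ]
    exact coordMap_smoothNear hF hz (by rwa [hj])
  · exact coordMap_smoothNear contMDiff_id hy' (by rwa [hi'])
  · rw [hκ, hφ]
    exact hsur.1
  · rw [hκ, hφ]
    exact hsur.2
  · have hc := continuousAt_symm hy'
    have hc2 : ContinuousAt (fun z => f ((extChartAt (𝓡 2) p').symm z)) (extChartAt (𝓡 2) p' x) :=
      h.smooth.continuous.continuousAt.comp hc
    rw [ContinuousAt, hi'] at hc hc2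
    filter_upwards [hc.eventually (source_mem_nhds hp), hc2.eventually (source_mem_nhds hq)]
      with w h1 h2
    simp only [coordMap, Function.comp_apply, id, (extChartAt (𝓡 2) p).left_inv h1,
      (extChartAt (𝓡 n) q).left_inv h2]

section Isometry

variable (h : IsSurface g f) (h' : IsSurface g' (F ∘ f))
    (hF : ContMDiff (𝓡 n) (𝓡 n) ∞ F) (hgF : g = pullbackMetric (m := n) g' F) (x : S)
include h h' hF hgF

theorem IsSurface.sameSurface_self : SameSurface (localMetric g (f x)) (coordMap 2 n f x (f x))
    (localMetric g' (F (f x))) (coordMap 2 n (F ∘ f) x (F (f x))) (coordMap n n F (f x) (F (f x)))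
    (coordMap 2 2 id x x) (extChartAt (𝓡 2) x x) :=
  h.sameSurface h' hF hgF (mem_extChartAt_source x) (mem_extChartAt_source x)
    (mem_extChartAt_source _) (mem_extChartAt_source _)

theorem IsSurface.exteriorScalarCurvature_comp :
    exteriorScalarCurvature g' (F ∘ f) x = exteriorScalarCurvature g f x := by
  have hs := h.sameSurface_self h' hF hgF x
  rw [h'.exteriorScalarCurvature_eq_self, h.exteriorScalarCurvature_eq_self]
  have h1 := hs.extScalForm_eq hs.surface'.isOrthoFrame_chartFrame
    hs.surface.isOrthoFrame_chartFrame
  rwa [coordMap_chart (mem_extChartAt_source x)] at h1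

theorem IsSurface.meanCurvatureSq_comp :
    meanCurvatureSq g' (F ∘ f) x = meanCurvatureSq g f x := by
  have hs := h.sameSurface_self h' hF hgF x
  rw [h'.meanCurvatureSq_eq_self, h.meanCurvatureSq_eq_self]
  have h1 := hs.meanSqForm_eq hs.surface'.isOrthoFrame_chartFrame
    hs.surface.isOrthoFrame_chartFrame
  rwa [coordMap_chart (mem_extChartAt_source x)] at h1

theorem IsSurface.secondFundamentalFormSq_comp :
    secondFundamentalFormSq g' (F ∘ f) x = secondFundamentalFormSq g f x := by
  have hs := h.sameSurface_self h' hF hgF x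
  rw [h'.secondFundamentalFormSq_eq_self, h.secondFundamentalFormSq_eq_self]
  have h1 := hs.sffSqForm_eq hs.surface'.isOrthoFrame_chartFrame
    hs.surface.isOrthoFrame_chartFrame
  rwa [coordMap_chart (mem_extChartAt_source x)] at h1

end Isometry

section ChartIndependence

variable (h : IsSurface g f) {x p : S} {q : M} (hp : x ∈ (extChartAt (𝓡 2) p).source)
  (hq : f x ∈ (extChartAt (𝓡 n) q).source)
include h hp hq

theorem IsSurface.sameSurface_charts : SameSurface (localMetric g q) (coordMap 2 n f p q)
    (localMetric g (f x)) (coordMap 2 n f x (f x)) (coordMap n n id q (f x))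
    (coordMap 2 2 id x p) (extChartAt (𝓡 2) x x) :=
  h.sameSurface (F := id) h contMDiff_id (pullbackMetric_id g).symm hp (mem_extChartAt_source x)
    hq (mem_extChartAt_source _)

theorem IsSurface.exteriorScalarCurvature_eq : exteriorScalarCurvature g f x
    = extScalForm (localMetric g q) (coordMap 2 n f p q)
        (chartFrame g f p q (extChartAt (𝓡 2) p x)) (extChartAt (𝓡 2) p x) := by
  have hs := h.sameSurface_charts hp hq
  rw [h.exteriorScalarCurvature_eq_self]
  have h1 := hs.extScalForm_eq hs.surface'.isOrthoFrame_chartFrame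
    hs.surface.isOrthoFrame_chartFrame
  rwa [coordMap_chart (mem_extChartAt_source x)] at h1

theorem IsSurface.meanCurvatureSq_eq : meanCurvatureSq g f x
    = meanSqForm (localMetric g q) (coordMap 2 n f p q)
        (chartFrame g f p q (extChartAt (𝓡 2) p x)) (extChartAt (𝓡 2) p x) := by
  have hs := h.sameSurface_charts hp hq
  rw [h.meanCurvatureSq_eq_self]
  have h1 := hs.meanSqForm_eq hs.surface'.isOrthoFrame_chartFrame
    hs.surface.isOrthoFrame_chartFrame
  rwa [coordMap_chart (mem_extChartAt_source x)] at h1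

theorem IsSurface.secondFundamentalFormSq_eq : secondFundamentalFormSq g f x
    = sffSqForm (localMetric g q) (coordMap 2 n f p q)
        (chartFrame g f p q (extChartAt (𝓡 2) p x)) (extChartAt (𝓡 2) p x) := by
  have hs := h.sameSurface_charts hp hq
  rw [h.secondFundamentalFormSq_eq_self]
  have h1 := hs.sffSqForm_eq hs.surface'.isOrthoFrame_chartFrame
    hs.surface.isOrthoFrame_chartFrame
  rwa [coordMap_chart (mem_extChartAt_source x)] at h1

end ChartIndependence

omit [IsManifold (𝓡 2) ∞ S] [IsManifold (𝓡 n) ∞ M] in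
/-- A function on `S` which is continuous in the preferred charts is continuous. -/
theorem continuous_of_charts {φ : S → ℝ} {Φ : S → Coord 2 → ℝ} (hf : Continuous f)
    (h1 : ∀ x₀ x, x ∈ (extChartAt (𝓡 2) x₀).source → f x ∈ (extChartAt (𝓡 n) (f x₀)).source →
      φ x = Φ x₀ (extChartAt (𝓡 2) x₀ x))
    (h2 : ∀ x₀, ContinuousAt (Φ x₀) (extChartAt (𝓡 2) x₀ x₀)) : Continuous φ := by
  refine continuous_iff_continuousAt.2 fun x₀ => ?_
  have h3 : ContinuousAt (fun x => Φ x₀ (extChartAt (𝓡 2) x₀ x)) x₀ :=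
    (h2 x₀).comp (f := extChartAt (𝓡 2) x₀) (continuousAt_extChartAt x₀)
  refine h3.congr ?_
  filter_upwards [extChartAt_source_mem_nhds (I := 𝓡 2) x₀,
    hf.continuousAt.eventually (extChartAt_source_mem_nhds (I := 𝓡 n) (f x₀))] with x h4 h5
  exact (h1 x₀ x h4 h5).symm

theorem IsSurface.continuous_exteriorScalarCurvature (h : IsSurface g f) :
    Continuous (exteriorScalarCurvature g f) :=
  continuous_of_charts (f := f)
    (Φ := fun x₀ y => extScalForm (localMetric g (f x₀)) (coordMap 2 n f x₀ (f x₀))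
      (chartFrame g f x₀ (f x₀) y) y) h.smooth.continuous
    (fun _ _ hp hq => h.exteriorScalarCurvature_eq hp hq)
    fun x₀ => continuousAt_extScalForm (h.surfaceNear_self x₀)
      (h.surfaceNear_self x₀).continuousAt_chartFrame

theorem IsSurface.continuous_meanCurvatureSq (h : IsSurface g f) :
    Continuous (meanCurvatureSq g f) :=
  continuous_of_charts (f := f)
    (Φ := fun x₀ y => meanSqForm (localMetric g (f x₀)) (coordMap 2 n f x₀ (f x₀))
      (chartFrame g f x₀ (f x₀) y) y) h.smooth.continuous
    (fun _ _ hp hq => h.meanCurvatureSq_eq hp hq)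
    fun x₀ => continuousAt_meanSqForm (h.surfaceNear_self x₀)
      (h.surfaceNear_self x₀).continuousAt_chartFrame

theorem IsSurface.continuous_secondFundamentalFormSq (h : IsSurface g f) :
    Continuous (secondFundamentalFormSq g f) :=
  continuous_of_charts (f := f)
    (Φ := fun x₀ y => sffSqForm (localMetric g (f x₀)) (coordMap 2 n f x₀ (f x₀))
      (chartFrame g f x₀ (f x₀) y) y) h.smooth.continuous
    (fun _ _ hp hq => h.secondFundamentalFormSq_eq hp hq)
    fun x₀ => continuousAt_sffSqForm (h.surfaceNear_self x₀)
      (h.surfaceNear_self x₀).continuousAt_chartFrame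

end Invariance

section Laplacian

variable {S : Type*} [TopologicalSpace S] [ChartedSpace (Coord 2) S]

/-- The Laplacian of `v` at `x` for the metric `h`, computed in the chart around `p`. -/
def chartLaplacian (h : BilinField 2 S) (v : S → ℝ) (p x : S) : ℝ :=
  lapForm (localMetric h p) (v ∘ (extChartAt (𝓡 2) p).symm)
    (orthoFrame (localMetric h p (extChartAt (𝓡 2) p x))) (extChartAt (𝓡 2) p x)

/-- The Laplacian of `v` for the metric `h`, computed at `x` in the preferred chart around `x`. -/
def laplacian (h : BilinField 2 S) (v : S → ℝ) (x : S) : ℝ := chartLaplacian h v x x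

variable [IsManifold (𝓡 2) ∞ S] {h : BilinField 2 S} {v : S → ℝ}

/-- The Laplacian may be computed in any chart. -/
theorem laplacian_eq_chartLaplacian (hh : IsSmoothMetric h) (hv : ContMDiff (𝓡 2) 𝓘(ℝ, ℝ) ∞ v)
    {p x : S} (hp : x ∈ (extChartAt (𝓡 2) p).source) :
    laplacian h v x = chartLaplacian h v p x := by
  have hκ : coordMap 2 2 id x p (extChartAt (𝓡 2) x x) = extChartAt (𝓡 2) p x :=
    coordMap_chart (mem_extChartAt_source x)
  have hy := mem_extChartAt_target (I := 𝓡 2) x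
  have hi := extChartAt_to_inv (I := 𝓡 2) x
  have hy' := (extChartAt (𝓡 2) p).map_source hp
  have hsm : SmoothNear (coordMap 2 2 id x p) (extChartAt (𝓡 2) x x) :=
    coordMap_smoothNear contMDiff_id hy (by rwa [hi])
  obtain ⟨hs, hiso⟩ := coordMap_surjective_fderiv (F := id) (q := x) (q' := p) hh contMDiff_id
    (pullbackMetric_id h).symm hy (by rwa [hi])
  have hH := hh.metricNear hy
  have hH' := hh.metricNear hy'
  have ho := isOrthoFrame_orthoFrame hH.isInner
  have ho' := isOrthoFrame_orthoFrame hH'.isInner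
  have hv' : v ∘ (extChartAt (𝓡 2) x).symm =ᶠ[𝓝 (extChartAt (𝓡 2) x x)]
      (v ∘ (extChartAt (𝓡 2) p).symm) ∘ coordMap 2 2 id x p := by
    have hc := continuousAt_symm hy
    rw [ContinuousAt, hi] at hc
    filter_upwards [hc.eventually (source_mem_nhds hp)] with w hw
    simp only [coordMap, Function.comp_apply, id, (extChartAt (𝓡 2) p).left_inv hw]
  have hpush : IsOrthoFrame (localMetric h p (extChartAt (𝓡 2) p x)) fun i =>
      fderiv ℝ (coordMap 2 2 id x p) (extChartAt (𝓡 2) x x)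
        (orthoFrame (localMetric h x (extChartAt (𝓡 2) x x)) i) := by
    intro i j
    rw [← ho i j, hiso.eq_of_nhds, pullbackForm_apply, hκ]
  rw [laplacian, chartLaplacian, chartLaplacian, lapForm_frame hH'.isInner ho' hpush]
  refine Finset.sum_congr rfl fun i _ => ?_
  have hfun (a b : Coord 2) := hessFun_comp (v := v ∘ (extChartAt (𝓡 2) p).symm) (hκ ▸ hH') hH hiso
    hsm hs.self_of_nhds (hκ ▸ smoothNear_comp_symm hv hy') a b
  rw [hκ] at hfun
  rw [← hfun]
  have hv2 : fderiv ℝ (v ∘ (extChartAt (𝓡 2) x).symm) =ᶠ[𝓝 (extChartAt (𝓡 2) x x)]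
    fderiv ℝ ((v ∘ (extChartAt (𝓡 2) p).symm) ∘ coordMap 2 2 id x p) := hv'.fderiv
  simp only [hessFun, hv2.fderiv_eq, hv'.fderiv_eq]

theorem continuousAt_chartLaplacian (hh : IsSmoothMetric h) (hv : ContMDiff (𝓡 2) 𝓘(ℝ, ℝ) ∞ v)
    {p : S} {y : Coord 2} (hy : y ∈ (extChartAt (𝓡 2) p).target) :
    ContinuousAt (fun y => lapForm (localMetric h p) (v ∘ (extChartAt (𝓡 2) p).symm)
      (orthoFrame (localMetric h p y)) y) y :=
  continuousAt_lapForm (hh.metricNear hy) (smoothNear_comp_symm hv hy)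
    fun i => (orthoFrame_smoothNear (hh.metricNear hy).1 (hh.metricNear hy).2 i).continuousAt

theorem continuous_laplacian (hh : IsSmoothMetric h) (hv : ContMDiff (𝓡 2) 𝓘(ℝ, ℝ) ∞ v) :
    Continuous (laplacian h v) :=
  continuous_of_charts (n := 2) (f := (id : S → S)) (Φ := fun p y => lapForm (localMetric h p)
      (v ∘ (extChartAt (𝓡 2) p).symm) (orthoFrame (localMetric h p y)) y) continuous_id
    (fun _ _ hp _ => laplacian_eq_chartLaplacian hh hv hp)
    fun x₀ => continuousAt_chartLaplacian hh hv (mem_extChartAt_target x₀)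

end Laplacian

section ConformalPointwise

variable {S : Type*} [TopologicalSpace S] [ChartedSpace (Coord 2) S] [IsManifold (𝓡 2) ∞ S]
  {n : ℕ} {M : Type*} [TopologicalSpace M] [ChartedSpace (Coord n) M] [IsManifold (𝓡 n) ∞ M]
  {g : BilinField n M} {f : S → M} {u : M → ℝ}

omit [IsManifold (𝓡 2) ∞ S] [IsManifold (𝓡 n) ∞ M] in
theorem pullbackMetric_conformalMetric (g : BilinField n M) (f : S → M) (u : M → ℝ) :
    pullbackMetric (m := 2) (conformalMetric u g) f
      = conformalMetric (u ∘ f) (pullbackMetric (m := 2) g f) := rfl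

theorem IsSurface.conformal (h : IsSurface g f) (hu : ContMDiff (𝓡 n) 𝓘(ℝ, ℝ) ∞ u) :
    IsSurface (conformalMetric u g) f where
  metric := h.metric.conformal hu
  smooth := h.smooth
  induced := h.induced.conformal (hu.comp h.smooth)

omit [IsManifold (𝓡 2) ∞ S] in
theorem smoothNear_comp_symm_coordMap (hu : ContMDiff (𝓡 n) 𝓘(ℝ, ℝ) ∞ u) (x : S) :
    SmoothNear (u ∘ (extChartAt (𝓡 n) (f x)).symm)
    (coordMap 2 n f x (f x) (extChartAt (𝓡 2) x x)) := by
  rw [coordMap_self]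
  exact smoothNear_comp_symm hu (mem_extChartAt_target _)

omit [IsManifold (𝓡 2) ∞ S] [IsManifold (𝓡 n) ∞ M] in
theorem comp_symm_coordMap_self (f : S → M) (u : M → ℝ) (x : S) :
    (u ∘ (extChartAt (𝓡 n) (f x)).symm)
    (coordMap 2 n f x (f x) (extChartAt (𝓡 2) x x)) = u (f x) := by
  rw [coordMap_self, Function.comp_apply, extChartAt_to_inv]

section

variable (h : IsSurface g f) (hu : ContMDiff (𝓡 n) 𝓘(ℝ, ℝ) ∞ u) (x : S)
include h hu

theorem IsSurface.isOrthoFrame_conformal : IsOrthoFrame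
    (pullbackForm (conformalForm (u ∘ (extChartAt (𝓡 n) (f x)).symm) (localMetric g (f x)))
      (coordMap 2 n f x (f x)) (extChartAt (𝓡 2) x x))
    (chartFrame (conformalMetric u g) f x (f x) (extChartAt (𝓡 2) x x)) :=
  ((h.conformal hu).surfaceNear_self x).isOrthoFrame_chartFrame

omit hu in
/-- The Laplacian of `u ∘ f` for the induced metric, in the charts around `x` and `f x`. -/
theorem IsSurface.laplacian_comp : laplacian (pullbackMetric (m := 2) g f) (u ∘ f) x
    = lapForm (pullbackForm (localMetric g (f x)) (coordMap 2 n f x (f x)))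
        ((u ∘ (extChartAt (𝓡 n) (f x)).symm) ∘ coordMap 2 n f x (f x))
        (chartFrame g f x (f x) (extChartAt (𝓡 2) x x)) (extChartAt (𝓡 2) x x) := by
  have hy := mem_extChartAt_target (I := 𝓡 2) x
  have hi := extChartAt_to_inv (I := 𝓡 2) x
  have hc : ContinuousAt (fun z => f ((extChartAt (𝓡 2) x).symm z)) (extChartAt (𝓡 2) x x) :=
    (h.smooth.continuous.continuousAt).comp (continuousAt_symm hy)
  rw [ContinuousAt, hi] at hc
  have hs := hc.eventually (extChartAt_source_mem_nhds (I := 𝓡 n) (f x))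
  have h1 : localMetric (pullbackMetric (m := 2) g f) x =ᶠ[𝓝 (extChartAt (𝓡 2) x x)]
      pullbackForm (localMetric g (f x)) (coordMap 2 n f x (f x)) := by
    filter_upwards [target_mem_nhds hy, hs] with z h1 h2
    exact localMetric_pullbackMetric g h.smooth h1 h2
  have h2 : (u ∘ f) ∘ (extChartAt (𝓡 2) x).symm =ᶠ[𝓝 (extChartAt (𝓡 2) x x)]
      (u ∘ (extChartAt (𝓡 n) (f x)).symm) ∘ coordMap 2 n f x (f x) := by
    filter_upwards [hs] with z h2
    simp only [Function.comp_apply, symm_coordMap h2]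
  have h3 : fderiv ℝ ((u ∘ f) ∘ (extChartAt (𝓡 2) x).symm) =ᶠ[𝓝 (extChartAt (𝓡 2) x x)]
    fderiv ℝ ((u ∘ (extChartAt (𝓡 n) (f x)).symm) ∘ coordMap 2 n f x (f x)) := h2.fderiv
  simp only [laplacian, chartLaplacian, lapForm, hessFun, h3.fderiv_eq, h2.fderiv_eq,
    levi_congr h1, h1.eq_of_nhds, chartFrame]

/-- The Willmore integrand changes by a Laplacian under a conformal change of the ambient metric. -/
theorem IsSurface.willmore_integrand_conformal :
    Real.exp (2 * u (f x)) * (2 * exteriorScalarCurvature (conformalMetric u g) f x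
        + meanCurvatureSq (conformalMetric u g) f x)
      = 2 * exteriorScalarCurvature g f x + meanCurvatureSq g f x
        - 4 * laplacian (pullbackMetric (m := 2) g f) (u ∘ f) x := by
  have hS := h.surfaceNear_self x
  have hS' := (h.conformal hu).surfaceNear_self x
  have hu' := smoothNear_comp_symm_coordMap (f := f) hu x
  have ho := hS.isOrthoFrame_chartFrame
  have ho' := h.isOrthoFrame_conformal hu x
  have hI := hS'.induced.isInner
  have e1 := extScalForm_conformal hS hu' ho
  have e2 := meanSqForm_conformal hS hu' ho
  rw [localMetric_conformalMetric] at hI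
  rw [h.laplacian_comp, lapForm_comp_surface hS hu' ho, h.exteriorScalarCurvature_eq_self,
    h.meanCurvatureSq_eq_self, (h.conformal hu).exteriorScalarCurvature_eq_self,
    (h.conformal hu).meanCurvatureSq_eq_self, localMetric_conformalMetric,
    extScalForm_frame hI ho' ho.conformal, meanSqForm_frame hI ho' ho.conformal]
  rw [comp_symm_coordMap_self] at e1 e2 ⊢
  linarith

/-- The integrand `‖α‖² - ‖H‖² / 2`, the squared norm of the trace-free part of `α`, is
conformally invariant. -/
theorem IsSurface.traceFree_integrand_conformal :
    Real.exp (2 * u (f x)) * (2 * secondFundamentalFormSq (conformalMetric u g) f x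
        - meanCurvatureSq (conformalMetric u g) f x)
      = 2 * secondFundamentalFormSq g f x - meanCurvatureSq g f x := by
  have hS := h.surfaceNear_self x
  have hS' := (h.conformal hu).surfaceNear_self x
  have hu' := smoothNear_comp_symm_coordMap (f := f) hu x
  have ho := hS.isOrthoFrame_chartFrame
  have ho' := h.isOrthoFrame_conformal hu x
  have hI := hS'.induced.isInner
  have e1 := sffSqForm_conformal hS hu' ho
  have e2 := meanSqForm_conformal hS hu' ho
  rw [localMetric_conformalMetric] at hI
  rw [h.secondFundamentalFormSq_eq_self,
    h.meanCurvatureSq_eq_self, (h.conformal hu).secondFundamentalFormSq_eq_self,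
    (h.conformal hu).meanCurvatureSq_eq_self, localMetric_conformalMetric,
    sffSqForm_frame hI ho' ho.conformal, meanSqForm_frame hI ho' ho.conformal]
  rw [comp_symm_coordMap_self] at e1 e2 ⊢
  linarith

end

end ConformalPointwise

/-! ### Integration, and the divergence theorem on a closed surface -/

open MeasureTheory in
/-- The integral of a directional derivative of a compactly supported function vanishes. -/
theorem integral_fderiv_eq_zero {n : ℕ} {Y : Coord n → ℝ} (hY : ContDiff ℝ ∞ Y)
    (hc : HasCompactSupport Y) (v : Coord n) : ∫ z, fderiv ℝ Y z v = 0 := by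
  have hd : Continuous (fderiv ℝ Y) := hY.continuous_fderiv (by simp)
  have h := integral_mul_fderiv_eq_neg_fderiv_mul_of_integrable (μ := volume)
    (f := fun _ : Coord n => (1 : ℝ)) (g := Y) (v := v) (by simp)
    (by
      simp only [one_mul]
      exact (hd.clm_apply continuous_const).integrable_of_hasCompactSupport
        (hc.fderiv_apply (𝕜 := ℝ) v))
    (by simpa using hY.continuous.integrable_of_hasCompactSupport hc)
    (fun _ _ => by fun_prop) (fun z _ => (hY.differentiable (by simp)) z)
  simpa using h

section PullbackDensity

/-- The transformation law of the Gram determinant under a change of coordinates. -/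
theorem gramMatrix_pullbackForm_det {H : Coord 2 → Coord 2 →L[ℝ] Coord 2 →L[ℝ] ℝ}
    {κ : Coord 2 → Coord 2} {y : Coord 2} :
    (gramMatrix (pullbackForm H κ) y).det
      = (fderiv ℝ κ y).det ^ 2 * (gramMatrix H (κ y)).det := by
  set A := fderiv ℝ κ y with hA
  have hdet : A.det
      = A (coordVec 0) 0 * A (coordVec 1) 1 - A (coordVec 1) 0 * A (coordVec 0) 1 := by
    rw [ContinuousLinearMap.det,
      ← LinearMap.det_toMatrix (EuclideanSpace.basisFun (Fin 2) ℝ).toBasis, Matrix.det_fin_two]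
    simp [LinearMap.toMatrix_apply, coordVec]
  have e (i : Fin 2) := sum_smul_coordVec (A (coordVec i))
  rw [gramMatrix_det_two, gramMatrix_det_two, hdet]
  simp only [pullbackForm_apply, ← hA]
  rw [← e 0, ← e 1]
  simp only [Fin.sum_univ_two, map_add, map_smul, add_apply, smul_apply, smul_eq_mul]
  simp [coordVec]
  ring

end PullbackDensity

section Integration

variable {S : Type*} [TopologicalSpace S] [ChartedSpace (Coord 2) S]

/-- The area density of the metric `h` in the chart around `p`. -/
def areaDensity (h : BilinField 2 S) (p : S) (y : Coord 2) : ℝ :=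
  √(gramMatrix (localMetric h p) y).det

/-- The integral of `ψ` over the domain of the chart around `p`. -/
def chartIntegral (h : BilinField 2 S) (p : S) (ψ : S → ℝ) : ℝ :=
  ∫ y in (extChartAt (𝓡 2) p).target, ψ ((extChartAt (𝓡 2) p).symm y) * areaDensity h p y

theorem areaDensity_conformalMetric (h : BilinField 2 S) (w : S → ℝ) (p : S) (y : Coord 2) :
    areaDensity (conformalMetric w h) p y
      = Real.exp (2 * w ((extChartAt (𝓡 2) p).symm y)) * areaDensity h p y := by
  have h1 : (gramMatrix (localMetric (conformalMetric w h) p) y).det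
      = Real.exp (2 * w ((extChartAt (𝓡 2) p).symm y)) ^ 2
        * (gramMatrix (localMetric h p) y).det := by
    rw [localMetric_conformalMetric, gramMatrix_det_two, gramMatrix_det_two]
    simp only [conformalForm_apply, Function.comp_apply]
    ring
  rw [areaDensity, h1, Real.sqrt_mul (sq_nonneg _), Real.sqrt_sq (Real.exp_pos _).le]
  rfl

theorem chartIntegral_conformalMetric (h : BilinField 2 S) (w : S → ℝ) (p : S) (ψ : S → ℝ) :
    chartIntegral (conformalMetric w h) p ψ
      = chartIntegral h p fun x => Real.exp (2 * w x) * ψ x := by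
  unfold chartIntegral
  congr 1
  funext y
  rw [areaDensity_conformalMetric]
  ring

theorem chartIntegral_const_mul (h : BilinField 2 S) (p : S) (c : ℝ) (ψ : S → ℝ) :
    chartIntegral h p (fun x => c * ψ x) = c * chartIntegral h p ψ := by
  unfold chartIntegral
  rw [← MeasureTheory.integral_const_mul]
  congr 1
  funext y
  ring

variable [IsManifold (𝓡 2) ∞ S] {h : BilinField 2 S}

theorem IsSmoothMetric.areaDensity_smoothNear (hh : IsSmoothMetric h) {p : S} {y : Coord 2}
    (hy : y ∈ (extChartAt (𝓡 2) p).target) : SmoothNear (areaDensity h p) y := by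
  filter_upwards [(hh.metricNear hy).1.gramMatrix_det, (hh.metricNear hy).eventually] with z h1 h2
  exact h1.sqrt h2.gramMatrix_det_pos.ne'

omit [IsManifold (𝓡 2) ∞ S] in
theorem symm_mem_tsupport {p : S} {ψ : S → ℝ} {y : Coord 2}
    (hy : y ∈ (extChartAt (𝓡 2) p).target)
    (h : (extChartAt (𝓡 2) p).symm y ∈ tsupport ψ) : y ∈ extChartAt (𝓡 2) p '' tsupport ψ :=
  ⟨_, h, (extChartAt (𝓡 2) p).right_inv hy⟩

omit [IsManifold (𝓡 2) ∞ S] in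
theorem isCompact_chart_image [CompactSpace S] {p : S} {ψ : S → ℝ}
    (hs : tsupport ψ ⊆ (extChartAt (𝓡 2) p).source) :
    IsCompact (extChartAt (𝓡 2) p '' tsupport ψ) :=
  (isClosed_tsupport ψ).isCompact.image_of_continuousOn ((continuousOn_extChartAt p).mono hs)

open MeasureTheory in
theorem integrableOn_chart [CompactSpace S] (hh : IsSmoothMetric h) {p : S} {ψ : S → ℝ}
    (hψ : Continuous ψ) (hs : tsupport ψ ⊆ (extChartAt (𝓡 2) p).source) :
    IntegrableOn (fun y => ψ ((extChartAt (𝓡 2) p).symm y) * areaDensity h p y)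
      (extChartAt (𝓡 2) p).target := by
  have hsub : extChartAt (𝓡 2) p '' tsupport ψ ⊆ (extChartAt (𝓡 2) p).target := by
    rintro _ ⟨x, hx, rfl⟩
    exact (extChartAt (𝓡 2) p).map_source (hs hx)
  refine IntegrableOn.of_forall_sdiff_eq_zero (s := extChartAt (𝓡 2) p '' tsupport ψ)
    (ContinuousOn.integrableOn_compact (isCompact_chart_image hs) fun y hy => ?_)
    (isOpen_extChartAt_target p).measurableSet fun y hy => ?_
  · exact ((hψ.continuousAt.comp (continuousAt_symm (hsub hy))).mul
      (hh.areaDensity_smoothNear (hsub hy)).continuousAt).continuousWithinAt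
  · rw [image_eq_zero_of_notMem_tsupport fun hmem => hy.2 (symm_mem_tsupport hy.1 hmem), zero_mul]

theorem chartIntegral_add [CompactSpace S] (hh : IsSmoothMetric h) {p : S} {ψ ψ' : S → ℝ}
    (hψ : Continuous ψ) (hs : tsupport ψ ⊆ (extChartAt (𝓡 2) p).source)
    (hψ' : Continuous ψ') (hs' : tsupport ψ' ⊆ (extChartAt (𝓡 2) p).source) :
    chartIntegral h p (fun x => ψ x + ψ' x) = chartIntegral h p ψ + chartIntegral h p ψ' := by
  unfold chartIntegral
  rw [← MeasureTheory.integral_add (integrableOn_chart hh hψ hs) (integrableOn_chart hh hψ' hs')]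
  congr 1
  funext y
  ring

theorem chartIntegral_sum [CompactSpace S] (hh : IsSmoothMetric h) {p : S} {ι : Type*}
    (T : Finset ι) {ψ : ι → S → ℝ} (hψ : ∀ i, Continuous (ψ i))
    (hs : ∀ i, tsupport (ψ i) ⊆ (extChartAt (𝓡 2) p).source) :
    chartIntegral h p (fun x => ∑ i ∈ T, ψ i x) = ∑ i ∈ T, chartIntegral h p (ψ i) := by
  unfold chartIntegral
  rw [← MeasureTheory.integral_finsetSum _ fun i _ => integrableOn_chart hh (hψ i) (hs i)]
  congr 1
  funext y
  rw [Finset.sum_mul]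

/-- The integral of a function supported in two chart domains may be computed in either chart. -/
theorem chartIntegral_eq {p q : S} {ψ : S → ℝ}
    (hp : ∀ x, x ∉ (extChartAt (𝓡 2) p).source → ψ x = 0)
    (hq : ∀ x, x ∉ (extChartAt (𝓡 2) q).source → ψ x = 0) :
    chartIntegral h p ψ = chartIntegral h q ψ := by
  set V : Set (Coord 2) := (extChartAt (𝓡 2) p).target ∩
    (extChartAt (𝓡 2) p).symm ⁻¹' (extChartAt (𝓡 2) q).source with hV
  have hVo : IsOpen V :=
    (continuousOn_extChartAt_symm p).isOpen_inter_preimage (isOpen_extChartAt_target p)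
      (isOpen_extChartAt_source q)
  set τ := coordMap 2 2 id p q with hτ
  have hτinv : ∀ y ∈ V, (extChartAt (𝓡 2) q).symm (τ y) = (extChartAt (𝓡 2) p).symm y :=
    fun y hy => symm_coordMap (f := id) hy.2
  have himg : τ '' V = (extChartAt (𝓡 2) q).target ∩
      (extChartAt (𝓡 2) q).symm ⁻¹' (extChartAt (𝓡 2) p).source := by
    ext z
    constructor
    · rintro ⟨y, hy, rfl⟩
      refine ⟨(extChartAt (𝓡 2) q).map_source hy.2, ?_⟩
      rw [mem_preimage, hτinv y hy]
      exact (extChartAt (𝓡 2) p).map_target hy.1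
    · rintro ⟨hz, hz'⟩
      have e := (extChartAt (𝓡 2) p).left_inv hz'
      refine ⟨extChartAt (𝓡 2) p ((extChartAt (𝓡 2) q).symm z),
        ⟨(extChartAt (𝓡 2) p).map_source hz', ?_⟩, ?_⟩
      · rw [mem_preimage, e]
        exact (extChartAt (𝓡 2) q).map_target hz
      · simp only [hτ, coordMap, Function.comp_apply, id, e, (extChartAt (𝓡 2) q).right_inv hz]
  have hinj : InjOn τ V := by
    intro y hy y' hy' he
    have h1 := hτinv y hy
    rw [he, hτinv y' hy'] at h1
    rw [← (extChartAt (𝓡 2) p).right_inv hy.1, ← (extChartAt (𝓡 2) p).right_inv hy'.1, h1]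
  have hder : ∀ y ∈ V, HasFDerivWithinAt τ (fderiv ℝ τ y) V y := fun y hy =>
    (coordMap_smoothNear contMDiff_id hy.1 hy.2).differentiableAt.hasFDerivAt.hasFDerivWithinAt
  have hdens : ∀ y ∈ V, areaDensity h p y = |(fderiv ℝ τ y).det| * areaDensity h q (τ y) := by
    intro y hy
    have h1 := localMetric_pullbackMetric h (f := id) contMDiff_id hy.1 hy.2
    rw [pullbackMetric_id] at h1
    have h2 : gramMatrix (localMetric h p) y
        = gramMatrix (pullbackForm (localMetric h q) τ) y := by
      simp only [gramMatrix, h1, hτ]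
    rw [areaDensity, h2, gramMatrix_pullbackForm_det, Real.sqrt_mul (sq_nonneg _),
      Real.sqrt_sq_eq_abs]
    rfl
  have h1 : chartIntegral h p ψ
      = ∫ y in V, ψ ((extChartAt (𝓡 2) p).symm y) * areaDensity h p y := by
    rw [chartIntegral]
    refine MeasureTheory.setIntegral_eq_of_subset_of_forall_sdiff_eq_zero
      (isOpen_extChartAt_target p).measurableSet inter_subset_left fun y hy => ?_
    rw [hq _ fun hmem => hy.2 ⟨hy.1, hmem⟩, zero_mul]
  have h2 : chartIntegral h q ψ
      = ∫ z in τ '' V, ψ ((extChartAt (𝓡 2) q).symm z) * areaDensity h q z := by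
    rw [himg, chartIntegral]
    refine MeasureTheory.setIntegral_eq_of_subset_of_forall_sdiff_eq_zero
      (isOpen_extChartAt_target q).measurableSet inter_subset_left fun y hy => ?_
    rw [hp _ fun hmem => hy.2 ⟨hy.1, hmem⟩, zero_mul]
  rw [h1, h2, MeasureTheory.integral_image_eq_integral_abs_det_fderiv_smul _ hVo.measurableSet
    hder hinj]
  refine MeasureTheory.setIntegral_congr_fun hVo.measurableSet fun y hy => ?_
  simp only [hdens y hy, hτinv y hy, smul_eq_mul]
  ring

omit [IsManifold (𝓡 2) ∞ S] in
theorem laplacian_eq_zero_of_eventuallyEq {w : S → ℝ} {x : S} (hw : w =ᶠ[𝓝 x] 0) :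
    laplacian h w x = 0 := by
  have hc := continuousAt_symm (mem_extChartAt_target (I := 𝓡 2) x)
  rw [ContinuousAt, extChartAt_to_inv] at hc
  have h1 : w ∘ (extChartAt (𝓡 2) x).symm =ᶠ[𝓝 (extChartAt (𝓡 2) x x)] fun _ => 0 :=
    hc.eventually hw
  have h2 : fderiv ℝ (w ∘ (extChartAt (𝓡 2) x).symm) =ᶠ[𝓝 (extChartAt (𝓡 2) x x)]
    fderiv ℝ fun _ => (0 : ℝ) := h1.fderiv
  have h3 : fderiv ℝ (fun _ : Coord 2 => (0 : ℝ)) = fun _ => 0 := by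
    funext z; simp
  simp only [laplacian, chartLaplacian, lapForm, hessFun, h1.fderiv_eq, h2.fderiv_eq, h3]
  simp

omit [IsManifold (𝓡 2) ∞ S] in
theorem tsupport_laplacian_subset (w : S → ℝ) : tsupport (laplacian h w) ⊆ tsupport w := by
  refine closure_minimal (fun x hx => ?_) (isClosed_tsupport w)
  by_contra hn
  exact hx (laplacian_eq_zero_of_eventuallyEq (notMem_tsupport_iff_eventuallyEq.1 hn))

/-- The Laplacian of a function supported in a chart domain has integral zero: in the chart, it is
the divergence of a compactly supported vector field. -/
theorem chartIntegral_laplacian [CompactSpace S] (hh : IsSmoothMetric h) {q : S} {w : S → ℝ}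
    (hw : ContMDiff (𝓡 2) 𝓘(ℝ, ℝ) ∞ w) (hs : tsupport w ⊆ (extChartAt (𝓡 2) q).source) :
    chartIntegral h q (laplacian h w) = 0 := by
  set K := extChartAt (𝓡 2) q '' tsupport w with hK
  have hKc : IsCompact K := isCompact_chart_image hs
  have hKt : K ⊆ (extChartAt (𝓡 2) q).target := by
    rintro _ ⟨x, hx, rfl⟩
    exact (extChartAt (𝓡 2) q).map_source (hs hx)
  -- `Y` are the components of the vector field `√(det h) grad w`, extended by zero to the plane
  set X : Coord 2 → Coord 2 := gradForm (localMetric h q) (w ∘ (extChartAt (𝓡 2) q).symm) with hX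
  set Y : Fin 2 → Coord 2 → ℝ := fun k => indicator (extChartAt (𝓡 2) q).target
    fun z => areaDensity h q z * X z k with hY
  have hXsm {z : Coord 2} (hz : z ∈ (extChartAt (𝓡 2) q).target) : SmoothNear X z :=
    (hh.metricNear hz).gradForm_smoothNear (smoothNear_comp_symm hw hz)
  have hY0 (k : Fin 2) : ∀ z ∉ K, Y k z = 0 := by
    intro z hz
    by_cases hzt : z ∈ (extChartAt (𝓡 2) q).target
    · have h1 : (extChartAt (𝓡 2) q).symm z ∉ tsupport w := fun hm =>
        hz (symm_mem_tsupport hzt hm)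
      have h2 : w ∘ (extChartAt (𝓡 2) q).symm =ᶠ[𝓝 z] fun _ => 0 :=
        (continuousAt_symm hzt).eventually (notMem_tsupport_iff_eventuallyEq.1 h1)
      have h3 : X z = 0 := by
        rw [hX, gradForm, h2.fderiv_eq]
        simp
      simp [hY, h3]
    · exact indicator_of_notMem hzt _
  have hYeq (k : Fin 2) {z : Coord 2} (hz : z ∈ (extChartAt (𝓡 2) q).target) :
      Y k =ᶠ[𝓝 z] fun z => areaDensity h q z * X z k := by
    filter_upwards [target_mem_nhds hz] with z' hz'
    exact indicator_of_mem hz' _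
  have hYzero (k : Fin 2) {z : Coord 2} (hz : z ∉ K) : Y k =ᶠ[𝓝 z] fun _ => 0 := by
    filter_upwards [hKc.isClosed.isOpen_compl.mem_nhds hz] with z' hz' using hY0 k z' hz'
  have hYsm (k : Fin 2) : ContDiff ℝ ∞ (Y k) := by
    refine contDiff_iff_contDiffAt.2 fun z => ?_
    by_cases hz : z ∈ K
    · refine ContDiffAt.congr_of_eventuallyEq ?_ (hYeq k (hKt hz))
      exact (hh.areaDensity_smoothNear (hKt hz)).contDiffAt.mul
        ((EuclideanSpace.proj (𝕜 := ℝ) k).contDiff.contDiffAt.comp z (hXsm (hKt hz)).contDiffAt)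
    · exact contDiffAt_const.congr_of_eventuallyEq (hYzero k hz)
  have hYc (k : Fin 2) : HasCompactSupport (Y k) := HasCompactSupport.intro hKc (hY0 k)
  have hcont (k : Fin 2) : Continuous fun z => fderiv ℝ (Y k) z (coordVec k) :=
    ((hYsm k).continuous_fderiv (by simp)).clm_apply continuous_const
  have hint (k : Fin 2) : MeasureTheory.Integrable fun z => fderiv ℝ (Y k) z (coordVec k) :=
    (hcont k).integrable_of_hasCompactSupport ((hYc k).fderiv_apply (𝕜 := ℝ) _)
  have h1 : chartIntegral h q (laplacian h w)
      = ∫ z in (extChartAt (𝓡 2) q).target, ∑ k, fderiv ℝ (Y k) z (coordVec k) := by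
    refine MeasureTheory.setIntegral_congr_fun (isOpen_extChartAt_target q).measurableSet
      fun z hz => ?_
    have hm := hh.metricNear hz
    beta_reduce
    rw [laplacian_eq_chartLaplacian hh hw ((extChartAt (𝓡 2) q).map_target hz), chartLaplacian,
      (extChartAt (𝓡 2) q).right_inv hz, areaDensity,
      lapForm_eq_divergence hm (smoothNear_comp_symm hw hz) (isOrthoFrame_orthoFrame hm.isInner)]
    refine Finset.sum_congr rfl fun k _ => ?_
    rw [(hYeq k hz).fderiv_eq]
    rfl
  rw [h1, MeasureTheory.setIntegral_eq_integral_of_forall_compl_eq_zero,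
    MeasureTheory.integral_finsetSum _ fun k _ => hint k]
  · simp only [integral_fderiv_eq_zero (hYsm _) (hYc _), Finset.sum_const_zero]
  · intro z hz
    refine Finset.sum_eq_zero fun k _ => ?_
    rw [(hYzero k fun hm => hz (hKt hm)).fderiv_eq]
    simp

theorem laplacian_add {v w : S → ℝ} (hv : ContMDiff (𝓡 2) 𝓘(ℝ, ℝ) ∞ v)
    (hw : ContMDiff (𝓡 2) 𝓘(ℝ, ℝ) ∞ w) (x : S) :
    laplacian h (v + w) x = laplacian h v x + laplacian h w x := by
  have hy := mem_extChartAt_target (I := 𝓡 2) x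
  have hv' := smoothNear_comp_symm hv hy
  have hw' := smoothNear_comp_symm hw hy
  have h0 : (v + w) ∘ (extChartAt (𝓡 2) x).symm
      = (v ∘ (extChartAt (𝓡 2) x).symm) + (w ∘ (extChartAt (𝓡 2) x).symm) := rfl
  have h1 : fderiv ℝ ((v ∘ (extChartAt (𝓡 2) x).symm) + (w ∘ (extChartAt (𝓡 2) x).symm))
      =ᶠ[𝓝 (extChartAt (𝓡 2) x x)] fderiv ℝ (v ∘ (extChartAt (𝓡 2) x).symm)
        + fderiv ℝ (w ∘ (extChartAt (𝓡 2) x).symm) := by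
    filter_upwards [hv'.eventually, hw'.eventually] with z h2 h3
    exact fderiv_add h2.differentiableAt h3.differentiableAt
  simp only [laplacian, chartLaplacian, lapForm, hessFun, h0, h1.fderiv_eq, h1.eq_of_nhds,
    ← Finset.sum_add_distrib]
  rw [fderiv_add hv'.fderiv.differentiableAt hw'.fderiv.differentiableAt]
  refine Finset.sum_congr rfl fun i _ => ?_
  simp only [Pi.add_apply, add_apply]
  ring

theorem laplacian_sum {ι : Type*} (T : Finset ι) {w : ι → S → ℝ}
    (hw : ∀ i, ContMDiff (𝓡 2) 𝓘(ℝ, ℝ) ∞ (w i)) (x : S) :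
    laplacian h (∑ i ∈ T, w i) x = ∑ i ∈ T, laplacian h (w i) x := by
  classical
  induction T using Finset.induction_on with
  | empty => simpa using laplacian_eq_zero_of_eventuallyEq (h := h) (w := 0) (x := x) (.refl _ _)
  | insert a T ha ih =>
    have hsum : ContMDiff (𝓡 2) 𝓘(ℝ, ℝ) ∞ (∑ i ∈ T, w i) := by
      have := contMDiff_finsetSum (t := T) (f := w) fun i _ => hw i
      convert this using 1
      funext x
      simp
    rw [Finset.sum_insert ha, Finset.sum_insert ha, laplacian_add (hw a) hsum, ih]

variable [CompactSpace S] [T2Space S]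

theorem chartPartition_subordinate (p : S) :
    tsupport (chartPartition S p) ⊆ (extChartAt (𝓡 2) p).source := by
  rw [extChartAt_source]
  exact (SmoothPartitionOfUnity.exists_isSubordinate_chartAt_source (𝓡 2) S).choose_spec p

variable (S) in
theorem chartPartition_finite : {p : S | (chartPartition S p : S → ℝ) ≠ 0}.Finite := by
  have := (chartPartition S).locallyFinite.finite_nonempty_of_compact
  simpa only [Function.support_nonempty_iff] using this

variable (S) in
/-- The charts that carry the partition of unity. -/
def chartFinset : Finset S := (chartPartition_finite S).toFinset

theorem chartPartition_eq_zero {p : S} (hp : p ∉ chartFinset S) :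
    (chartPartition S p : S → ℝ) = 0 := by
  by_contra hne
  exact hp ((chartPartition_finite S).mem_toFinset.2 hne)

theorem sum_chartPartition (x : S) : ∑ p ∈ chartFinset S, chartPartition S p x = 1 := by
  rw [← (chartPartition S).sum_eq_one (mem_univ x)]
  refine (finsum_eq_sum_of_support_subset _ fun p hp => ?_).symm
  by_contra hn
  refine hp ?_
  change chartPartition S p x = 0
  rw [chartPartition_eq_zero hn]
  rfl

theorem areaIntegral_eq_sum (h : BilinField 2 S) (φ : S → ℝ) : areaIntegral h φ
    = ∑ p ∈ chartFinset S, chartIntegral h p fun x => chartPartition S p x * φ x := by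
  change ∑ᶠ p : S, chartIntegral h p (fun x => chartPartition S p x * φ x) = _
  refine finsum_eq_sum_of_support_subset _ fun p hp => ?_
  by_contra hn
  refine hp ?_
  simp [chartIntegral, chartPartition_eq_zero hn]

theorem areaIntegral_const_mul (h : BilinField 2 S) (c : ℝ) (φ : S → ℝ) :
    areaIntegral h (fun x => c * φ x) = c * areaIntegral h φ := by
  simp only [areaIntegral_eq_sum, Finset.mul_sum, ← chartIntegral_const_mul, mul_left_comm]

theorem areaIntegral_conformalMetric (h : BilinField 2 S) (w : S → ℝ) (φ : S → ℝ) :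
    areaIntegral (conformalMetric w h) φ = areaIntegral h fun x => Real.exp (2 * w x) * φ x := by
  simp only [areaIntegral_eq_sum, chartIntegral_conformalMetric, mul_left_comm]

theorem continuous_chartPartition_mul (p : S) {φ : S → ℝ} (hφ : Continuous φ) :
    Continuous fun x => chartPartition S p x * φ x :=
  (chartPartition S p).contMDiff.continuous.mul hφ

theorem tsupport_chartPartition_mul_subset (p : S) (φ : S → ℝ) :
    tsupport (fun x => chartPartition S p x * φ x) ⊆ (extChartAt (𝓡 2) p).source :=
  (tsupport_mul_subset_left (f := chartPartition S p) (g := φ)).trans (chartPartition_subordinate p)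

theorem areaIntegral_add (hh : IsSmoothMetric h) {φ φ' : S → ℝ} (hφ : Continuous φ)
    (hφ' : Continuous φ') :
    areaIntegral h (fun x => φ x + φ' x) = areaIntegral h φ + areaIntegral h φ' := by
  simp only [areaIntegral_eq_sum, ← Finset.sum_add_distrib, mul_add]
  exact Finset.sum_congr rfl fun p _ => chartIntegral_add hh (continuous_chartPartition_mul p hφ)
    (tsupport_chartPartition_mul_subset p φ) (continuous_chartPartition_mul p hφ')
    (tsupport_chartPartition_mul_subset p φ')

theorem areaIntegral_sum (hh : IsSmoothMetric h) {ι : Type*} (T : Finset ι) {φ : ι → S → ℝ}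
    (hφ : ∀ i, Continuous (φ i)) :
    areaIntegral h (fun x => ∑ i ∈ T, φ i x) = ∑ i ∈ T, areaIntegral h (φ i) := by
  simp only [areaIntegral_eq_sum]
  rw [Finset.sum_comm]
  refine Finset.sum_congr rfl fun p _ => ?_
  simp only [Finset.mul_sum]
  exact chartIntegral_sum hh T (fun i => continuous_chartPartition_mul p (hφ i))
    fun i => tsupport_chartPartition_mul_subset p (φ i)

/-- The integral of a function supported in one chart domain is its integral in that chart. -/
theorem areaIntegral_eq_chartIntegral (hh : IsSmoothMetric h) {q : S} {ψ : S → ℝ}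
    (hψ : Continuous ψ) (hs : tsupport ψ ⊆ (extChartAt (𝓡 2) q).source) :
    areaIntegral h ψ = chartIntegral h q ψ := by
  have hs' (p : S) : tsupport (fun x => chartPartition S p x * ψ x)
      ⊆ (extChartAt (𝓡 2) q).source :=
    (tsupport_mul_subset_right (f := chartPartition S p) (g := ψ)).trans hs
  have h1 (p : S) : chartIntegral h p (fun x => chartPartition S p x * ψ x)
      = chartIntegral h q (fun x => chartPartition S p x * ψ x) :=
    chartIntegral_eq
      (fun x hx => image_eq_zero_of_notMem_tsupport (f := fun x => chartPartition S p x * ψ x)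
        fun hm =>
        hx (tsupport_chartPartition_mul_subset p ψ hm))
      (fun x hx => image_eq_zero_of_notMem_tsupport (f := fun x => chartPartition S p x * ψ x)
        fun hm => hx (hs' p hm))
  rw [areaIntegral_eq_sum]
  simp only [h1]
  rw [← chartIntegral_sum hh _ (fun p => continuous_chartPartition_mul p hψ) hs']
  simp only [← Finset.sum_mul, sum_chartPartition, one_mul]

/-- The divergence theorem: the Laplacian of a function on a closed surface has integral zero. -/
theorem areaIntegral_laplacian (hh : IsSmoothMetric h) {v : S → ℝ}
    (hv : ContMDiff (𝓡 2) 𝓘(ℝ, ℝ) ∞ v) : areaIntegral h (laplacian h v) = 0 := by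
  set w : S → S → ℝ := fun p x => chartPartition S p x * v x with hw
  have hws (p : S) : ContMDiff (𝓡 2) 𝓘(ℝ, ℝ) ∞ (w p) := (chartPartition S p).contMDiff.mul hv
  have hvw : v = ∑ p ∈ chartFinset S, w p := by
    funext x
    simp only [Finset.sum_apply, hw, ← Finset.sum_mul, sum_chartPartition, one_mul]
  have h1 : laplacian h v = fun x => ∑ p ∈ chartFinset S, laplacian h (w p) x := by
    funext x
    conv_lhs => rw [hvw]
    exact laplacian_sum _ hws x
  rw [h1, areaIntegral_sum hh _ fun p => continuous_laplacian hh (hws p)]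
  refine Finset.sum_eq_zero fun p _ => ?_
  have hs := tsupport_chartPartition_mul_subset p v
  rw [areaIntegral_eq_chartIntegral hh (continuous_laplacian hh (hws p))
    ((tsupport_laplacian_subset _).trans hs), chartIntegral_laplacian hh (hws p) hs]

end Integration

/-! ### Smooth metrics, and conformal invariance of the functionals -/

section SmoothMetrics

variable {n : ℕ} {M : Type*} [TopologicalSpace M] [ChartedSpace (Coord n) M] [IsManifold (𝓡 n) ∞ M]

/-- The vector field with constant coordinates `v` in a chart is smooth. -/
theorem contMDiffAt_coordField {p : M} {y : Coord n} (hy : y ∈ (extChartAt (𝓡 n) p).target)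
    (v : Coord n) :
    ContMDiffAt (𝓡 n) (𝓡 n).tangent ∞ (fun z => (⟨(extChartAt (𝓡 n) p).symm z,
      mfderiv (𝓡 n) (𝓡 n) (extChartAt (𝓡 n) p).symm z v⟩ : TangentBundle (𝓡 n) M)) y := by
  have ho : IsOpen (extChartAt (𝓡 n) p).target := isOpen_extChartAt_target p
  have h1 := (contMDiffOn_extChartAt_symm (I := 𝓡 n) (n := ∞) p).contMDiffOn_tangentMapWithin
    (m := ∞) (by simp) ho.uniqueMDiffOn
  have h2 : ContMDiffAt (𝓡 n) (𝓡 n).tangent ∞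
      (fun z : Coord n => (⟨z, v⟩ : TangentBundle (𝓡 n) (Coord n))) y :=
    contMDiffAt_vectorSpace_iff_contDiffAt.2 contDiffAt_const
  have h3 := (h1.contMDiffAt (x := ⟨y, v⟩)
    ((ho.preimage (FiberBundle.continuous_proj (Coord n) _)).mem_nhds hy)).comp y h2
  refine h3.congr_of_eventuallyEq ?_
  filter_upwards [ho.mem_nhds hy] with z hz
  simp only [Function.comp_apply, tangentMapWithin, mfderivWithin_of_isOpen ho hz]

theorem RiemMetric.isSmoothMetric (g : RiemMetric n M) : IsSmoothMetric g.inner where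
  symm x v w := g.symm x v w
  pos x v hv := g.pos x v hv
  smooth p y hy := by
    have ho : IsOpen (extChartAt (𝓡 n) p).target := isOpen_extChartAt_target p
    have h0 : ContDiffOn ℝ ∞ (localMetric g.inner p) (extChartAt (𝓡 n) p).target := by
      refine contDiffOn_clm_apply.2 fun v => contDiffOn_clm_apply.2 fun w => fun z hz => ?_
      have h : ContMDiffAt (𝓡 n) ((𝓡 n).prod 𝓘(ℝ, ℝ)) ∞
          (fun z => Bundle.TotalSpace.mk' ℝ (E := Bundle.Trivial M ℝ)
            ((extChartAt (𝓡 n) p).symm z)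
            (g.inner _ (mfderiv (𝓡 n) (𝓡 n) (extChartAt (𝓡 n) p).symm z v)
            (mfderiv (𝓡 n) (𝓡 n) (extChartAt (𝓡 n) p).symm z w))) z := by
        apply ContMDiffAt.clm_bundle_apply₂ (F₁ := Coord n) (F₂ := Coord n)
        · exact g.contMDiff.contMDiffAt.comp z (contMDiffAt_symm hz)
        · exact contMDiffAt_coordField hz v
        · exact contMDiffAt_coordField hz w
      simp only [Bundle.contMDiffAt_totalSpace] at h
      exact h.2.contDiffAt.contDiffWithinAt
    filter_upwards [ho.mem_nhds hy] with z hz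
    exact h0.contDiffAt (ho.mem_nhds hz)

/-- The Euclidean metric of `ℝⁿ`. -/
def euclideanMetric (n : ℕ) : BilinField n (Coord n) :=
  fun _ => (innerSL ℝ : Coord n →L[ℝ] Coord n →L[ℝ] ℝ)

theorem isSmoothMetric_euclideanMetric (n : ℕ) : IsSmoothMetric (euclideanMetric n) where
  symm _ v w := real_inner_comm w v
  pos _ _ hv := real_inner_self_pos.2 hv
  smooth p y _ := by
    have h : localMetric (euclideanMetric n) p = fun _ => innerSL ℝ := by
      funext z
      have hs : ((extChartAt (𝓡 n) p).symm : Coord n → Coord n) = id := rfl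
      have hd : coordDeriv n n (extChartAt (𝓡 n) p).symm z = ContinuousLinearMap.id ℝ _ := by
        rw [coordDeriv_eq_fderiv, hs, fderiv_id]
      ext v w
      rw [localMetric_apply, hd]
      rfl
    rw [h]
    exact .of_forall fun _ => contDiffAt_const

theorem isSmoothMetric_roundMetric (m : ℕ) : IsSmoothMetric (roundMetric m) := by
  have := Fact.mk (finrank_euclideanSpace_fin (𝕜 := ℝ) (n := m + 1))
  refine (isSmoothMetric_euclideanMetric (m + 1)).pullback contMDiff_coe_sphere fun x v hv => ?_
  refine (isSmoothMetric_euclideanMetric (m + 1)).pos x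
    (coordDeriv m (m + 1) ((↑) : UnitSphere m → Coord (m + 1)) x v) fun h => hv ?_
  exact injective_mvfderiv_subtypeVal_sphere x (h.trans (map_zero _).symm)

end SmoothMetrics

section ConformalInvariance

variable {S : Type*} [TopologicalSpace S] [ChartedSpace (Coord 2) S] [IsManifold (𝓡 2) ∞ S]
  [CompactSpace S] [T2Space S] {n : ℕ} {M : Type*} [TopologicalSpace M] [ChartedSpace (Coord n) M]
  [IsManifold (𝓡 n) ∞ M] {g : BilinField n M} {f : S → M} {u : M → ℝ}

theorem IsSurface.willmore_eq_integral (h : IsSurface g f) :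
    willmore g f = areaIntegral (pullbackMetric (m := 2) g f)
      fun x => 2 * exteriorScalarCurvature g f x + meanCurvatureSq g f x := by
  rw [areaIntegral_add h.induced (h.continuous_exteriorScalarCurvature.const_mul 2)
    h.continuous_meanCurvatureSq, areaIntegral_const_mul]
  rfl

theorem IsSurface.traceFree_eq_integral (h : IsSurface g f) :
    2 * Pii g f - Psi g f = areaIntegral (pullbackMetric (m := 2) g f)
      fun x => 2 * secondFundamentalFormSq g f x - meanCurvatureSq g f x := by
  have h1 : (fun x => 2 * secondFundamentalFormSq g f x - meanCurvatureSq g f x)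
      = fun x => 2 * secondFundamentalFormSq g f x + (-1) * meanCurvatureSq g f x := by
    funext x
    ring
  rw [h1, areaIntegral_add h.induced (h.continuous_secondFundamentalFormSq.const_mul 2)
    (h.continuous_meanCurvatureSq.const_mul (-1)), areaIntegral_const_mul,
    areaIntegral_const_mul, neg_one_mul]
  rfl

/-- The Willmore energy is invariant under conformal changes of the ambient metric: the integrand
changes by a Laplacian. -/
theorem IsSurface.willmore_conformalMetric (h : IsSurface g f)
    (hu : ContMDiff (𝓡 n) 𝓘(ℝ, ℝ) ∞ u) : willmore (conformalMetric u g) f = willmore g f := by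
  have hw : ContMDiff (𝓡 2) 𝓘(ℝ, ℝ) ∞ (u ∘ f) := hu.comp h.smooth
  have h1 : (fun x => Real.exp (2 * (u ∘ f) x) *
      (2 * exteriorScalarCurvature (conformalMetric u g) f x
        + meanCurvatureSq (conformalMetric u g) f x))
      = fun x => (2 * exteriorScalarCurvature g f x + meanCurvatureSq g f x)
        + (-4) * laplacian (pullbackMetric (m := 2) g f) (u ∘ f) x := by
    funext x
    rw [Function.comp_apply, h.willmore_integrand_conformal hu]
    ring
  rw [(h.conformal hu).willmore_eq_integral, h.willmore_eq_integral,
    pullbackMetric_conformalMetric, areaIntegral_conformalMetric, h1,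
    areaIntegral_add h.induced, areaIntegral_const_mul, areaIntegral_laplacian h.induced hw,
    mul_zero, add_zero]
  · exact (h.continuous_exteriorScalarCurvature.const_mul 2).add h.continuous_meanCurvatureSq
  · exact (continuous_laplacian h.induced hw).const_mul (-4)

/-- `‖α‖² - ‖H‖² / 2` is the squared norm of the trace-free part of `α`, and its integral is
invariant under conformal changes of the ambient metric. -/
theorem IsSurface.traceFree_conformalMetric (h : IsSurface g f)
    (hu : ContMDiff (𝓡 n) 𝓘(ℝ, ℝ) ∞ u) :
    2 * Pii (conformalMetric u g) f - Psi (conformalMetric u g) f = 2 * Pii g f - Psi g f := by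
  rw [(h.conformal hu).traceFree_eq_integral, h.traceFree_eq_integral,
    pullbackMetric_conformalMetric, areaIntegral_conformalMetric]
  congr 1
  funext x
  exact h.traceFree_integrand_conformal hu x

section Comp

variable {F : M → M}

omit [CompactSpace S] [T2Space S] [IsManifold (𝓡 2) ∞ S] [IsManifold (𝓡 n) ∞ M] in
theorem pullbackMetric_comp (hF : ContMDiff (𝓡 n) (𝓡 n) ∞ F) (hf : ContMDiff (𝓡 2) (𝓡 n) ∞ f) :
    pullbackMetric (m := 2) g (F ∘ f)
      = pullbackMetric (m := 2) (pullbackMetric (m := n) g F) f := by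
  funext x
  refine ContinuousLinearMap.ext fun v => ContinuousLinearMap.ext fun w => ?_
  simp only [pullbackMetric_apply]
  rw [mfderiv_comp x (hF.contMDiffAt.mdifferentiableAt (by simp))
    (hf.contMDiffAt.mdifferentiableAt (by simp))]
  rfl

variable (h : IsSurface g f) (hu : ContMDiff (𝓡 n) 𝓘(ℝ, ℝ) ∞ u)
  (hF : ContMDiff (𝓡 n) (𝓡 n) ∞ F) (hFu : pullbackMetric (m := n) g F = conformalMetric u g)
include h hu hF hFu

omit [CompactSpace S] [T2Space S] in
theorem IsSurface.comp : IsSurface g (F ∘ f) where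
  metric := h.metric
  smooth := hF.comp h.smooth
  induced := by
    rw [pullbackMetric_comp hF h.smooth, hFu]
    exact (h.conformal hu).induced

/-- `F` is an isometry from `e^{2u} g` to `g`, so the integrands for `F ∘ f` in `g` and for `f` in
`e^{2u} g` agree. -/
theorem IsSurface.theta_comp : Theta g (F ∘ f) = Theta (conformalMetric u g) f := by
  rw [Theta, pullbackMetric_comp hF h.smooth, hFu]
  congr 1
  funext x
  exact (h.conformal hu).exteriorScalarCurvature_comp (h.comp hu hF hFu) hF hFu.symm x

theorem IsSurface.psi_comp : Psi g (F ∘ f) = Psi (conformalMetric u g) f := by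
  rw [Psi, pullbackMetric_comp hF h.smooth, hFu]
  congr 1
  funext x
  exact (h.conformal hu).meanCurvatureSq_comp (h.comp hu hF hFu) hF hFu.symm x

theorem IsSurface.pii_comp : Pii g (F ∘ f) = Pii (conformalMetric u g) f := by
  rw [Pii, pullbackMetric_comp hF h.smooth, hFu]
  congr 1
  funext x
  exact (h.conformal hu).secondFundamentalFormSq_comp (h.comp hu hF hFu) hF hFu.symm x

theorem IsSurface.willmore_comp : willmore g (F ∘ f) = willmore g f := by
  rw [willmore, h.theta_comp hu hF hFu, h.psi_comp hu hF hFu]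
  exact h.willmore_conformalMetric hu

end Comp

/-- The equalities of `Θ`, `Ψ`, `Π` imply each other, since `2Θ + Ψ` and `2Π - Ψ` are
conformally invariant. -/
theorem IsSurface.equalities_conformalMetric (h : IsSurface g f)
    (hu : ContMDiff (𝓡 n) 𝓘(ℝ, ℝ) ∞ u) :
    willmore (conformalMetric u g) f = willmore g f ∧
      (Theta (conformalMetric u g) f = Theta g f ↔ Psi (conformalMetric u g) f = Psi g f) ∧
      (Psi (conformalMetric u g) f = Psi g f ↔ Pii (conformalMetric u g) f = Pii g f) := by
  have h1 := h.willmore_conformalMetric hu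
  have h2 := h.traceFree_conformalMetric hu
  have h3 := h1
  simp only [willmore] at h3
  exact ⟨h1, ⟨fun _ => by linarith, fun _ => by linarith⟩,
    ⟨fun _ => by linarith, fun _ => by linarith⟩⟩

omit [CompactSpace S] [T2Space S] [IsManifold (𝓡 n) ∞ M] in
theorem IsIsometricEmbedding.isSurface {gS : RiemMetric 2 S}
    (hf : IsIsometricEmbedding gS.inner g f) (hg : IsSmoothMetric g) : IsSurface g f where
  metric := hg
  smooth := hf.isSmoothEmbedding.contMDiff
  induced := by
    rw [hf.pullback_eq]
    exact RiemMetric.isSmoothMetric gS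

end ConformalInvariance

end

theorem theorem4
    {S : Type*} [TopologicalSpace S] [ChartedSpace (Coord 2) S] [IsManifold (𝓡 2) ∞ S]
    [CompactSpace S] [T2Space S] :
    -- a surface in a general background
    (∀ {n : ℕ} {M : Type*} [TopologicalSpace M] [ChartedSpace (Coord n) M]
      [IsManifold (𝓡 n) ∞ M] [T2Space M] [SecondCountableTopology M]
      (gM : RiemMetric n M) (g : RiemMetric 2 S) (f : S → M),
      IsIsometricEmbedding g.inner gM.inner f →
      -- deformations `F t ∘ f` by conformal diffeomorphisms of the background
      (∀ F : unitInterval → (M ≃ₘ^∞⟮𝓡 n, 𝓡 n⟯ M),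
        (∀ x, F 0 x = x) → (∀ t, IsConformalDiffeo gM.inner (F t)) →
        ∀ t,
          willmore gM.inner (F t ∘ f) = willmore gM.inner f ∧
          (Theta gM.inner (F t ∘ f) = Theta gM.inner f ↔
            Psi gM.inner (F t ∘ f) = Psi gM.inner f) ∧
          (Psi gM.inner (F t ∘ f) = Psi gM.inner f ↔
            Pii gM.inner (F t ∘ f) = Pii gM.inner f)) ∧
      -- conformal deformations `e^{2 u t} g` of the background metric along the fixed surface
      (∀ u : unitInterval → M → ℝ,
        (∀ x, u 0 x = 0) → (∀ t, ContMDiff (𝓡 n) 𝓘(ℝ, ℝ) ∞ (u t)) →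
        ∀ t,
          willmore (conformalMetric (u t) gM.inner) f = willmore gM.inner f ∧
          (Theta (conformalMetric (u t) gM.inner) f = Theta gM.inner f ↔
            Psi (conformalMetric (u t) gM.inner) f = Psi gM.inner f) ∧
          (Psi (conformalMetric (u t) gM.inner) f = Psi gM.inner f ↔
            Pii (conformalMetric (u t) gM.inner) f = Pii gM.inner f))) ∧
    -- conformal automorphisms of the round sphere
    (∀ (m : ℕ) (g : RiemMetric 2 S) (f : S → UnitSphere m),
      IsIsometricEmbedding g.inner (roundMetric m) f →
      ∀ F : UnitSphere m ≃ₘ^∞⟮𝓡 m, 𝓡 m⟯ UnitSphere m,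
        IsConformalDiffeo (roundMetric m) F →
        willmore (roundMetric m) (F ∘ f) = willmore (roundMetric m) f) := by
  refine ⟨fun gM g f hf => ?_, fun m g f hf F ⟨u, hu, hFu⟩ => ?_⟩
  · have h := hf.isSurface (RiemMetric.isSmoothMetric gM)
    refine ⟨fun F _ hF t => ?_, fun u _ hu t => h.equalities_conformalMetric (hu t)⟩
    obtain ⟨u, hu, hFu⟩ := hF t
    rw [h.theta_comp hu (F t).contMDiff hFu, h.psi_comp hu (F t).contMDiff hFu,
      h.pii_comp hu (F t).contMDiff hFu]
    exact ⟨h.willmore_comp hu (F t).contMDiff hFu, (h.equalities_conformalMetric hu).2⟩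
  · exact (hf.isSurface (isSmoothMetric_roundMetric m)).willmore_comp hu F.contMDiff hFu
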